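/- For integers $n,m$, an edge coloring of $K_n$ with $m$ colors is one in which exactly $m$ colors occur. Let $g(n,K_p|{\uparrow}K_q)$ denote the largest $m$ such that there is an edge coloring of $K_n$ with $m$ colors in which every copy of $K_p$ contains a color class having $K_q$ as a subgraph (that is, every copy of $K_p$ contains a monochromatic $K_q$); it is $0$ if there is no such coloring. For a family $\mathcal H$ of graphs, let $\mathrm{Ar}(n,\mathcal H)$ denote the smallest $k$ such that every edge coloring of $K_n$ with at least $k$ colors contains a rainbow copy of some member of $\mathcal H$ (all edges of the copy have distinct colors). Write $C_\ell$ for the cycle of length $\ell$ and $\cup$ for vertex-disjoint union. Let $q\ge 4$ and $p=2q-2$. Then there is $n_0=n_0(p)$ such that for all $n>n_0$, $$(p-q)n-\binom{p-q+1}{2}+1\ \le\ g(n,K_p|{\uparrow}K_q)\ \le\ \mathrm{Ar}\bigl(n,\{C_{2p-2q+1}\cup K_2,\ C_{2p-2q+2}\}\bigr)\ \le\ (p-q)n .$$ -/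

import Mathlib

open SimpleGraph

/-- A family of graphs: a predicate on graphs. -/
abbrev GraphFamily := (V : Type) → SimpleGraph V → Prop

/-- The family of all graphs that contain `F` as a (not necessarily induced) subgraph. -/
def upFamily {W : Type} (F : SimpleGraph W) : GraphFamily :=
  fun _ H => F ⊑ H

/-- The family consisting of the two graphs `A` and `B`, up to isomorphism. -/
def pairFamily {W₁ W₂ : Type} (A : SimpleGraph W₁) (B : SimpleGraph W₂) : GraphFamily :=
  fun _ H => Nonempty (H ≃g A) ∨ Nonempty (H ≃g B)

/-- An edge coloring of `Kₙ` in which exactly the `m` colors of `Fin m` are used. -/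
def UsesAllColors {n m : ℕ} (C : TopEdgeLabeling (Fin n) (Fin m)) : Prop :=
  Function.Surjective C

/-- The edges of color `k` in the copy `φ` of `G`, as a graph on the vertices of `Kₙ`. -/
def colorGraph {n m : ℕ} {W : Type} {G : SimpleGraph W} (C : TopEdgeLabeling (Fin n) (Fin m))
    (φ : Copy G (⊤ : SimpleGraph (Fin n))) (k : Fin m) : SimpleGraph (Fin n) :=
  φ.toSubgraph.spanningCoe ⊓ C.labelGraph k

/-- The copy `φ` of `G` contains a color class that is a member of `𝓕`. A color class is a
nonempty set of edges, regarded as a graph without isolated vertices. -/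
def IsPierced {n m : ℕ} {W : Type} {G : SimpleGraph W} (𝓕 : GraphFamily)
    (C : TopEdgeLabeling (Fin n) (Fin m)) (φ : Copy G (⊤ : SimpleGraph (Fin n))) : Prop :=
  ∃ k : Fin m, colorGraph C φ k ≠ ⊥ ∧
    𝓕 (colorGraph C φ k).support ((colorGraph C φ k).induce (colorGraph C φ k).support)

/-- The piercing function `g(n, G | 𝓕)`: the largest `m` such that some edge coloring of `Kₙ` with
exactly `m` colors has the property that every copy of `G` contains a color class belonging to `𝓕`;
it is `0` if there is no such coloring. (Only `m ≤ n.choose 2` can occur.) -/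
noncomputable def piercing {W : Type} (n : ℕ) (G : SimpleGraph W) (𝓕 : GraphFamily) : ℕ :=
  sSup {m : ℕ | ∃ C : TopEdgeLabeling (Fin n) (Fin m), UsesAllColors C ∧
    ∀ φ : Copy G (⊤ : SimpleGraph (Fin n)), IsPierced 𝓕 C φ}

/-- The copy `φ` of `H` is rainbow: distinct edges have distinct colors. -/
def IsRainbow {n m : ℕ} {W : Type} {H : SimpleGraph W} (C : TopEdgeLabeling (Fin n) (Fin m))
    (φ : Copy H (⊤ : SimpleGraph (Fin n))) : Prop :=
  Function.Injective fun e : H.edgeSet => C (φ.mapEdgeSet e)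

/-- The anti-Ramsey number `Ar(n, 𝓗)`: the smallest `k` such that every edge coloring of `Kₙ` with
at least `k` colors contains a rainbow copy of a member of `𝓗`. (Every `k > n.choose 2` has this
property.) -/
noncomputable def antiRamsey (n : ℕ) (𝓗 : GraphFamily) : ℕ :=
  sInf {k : ℕ | ∀ m : ℕ, k ≤ m → ∀ C : TopEdgeLabeling (Fin n) (Fin m), UsesAllColors C →
    ∃ (W : Type) (H : SimpleGraph W), 𝓗 W H ∧
      ∃ φ : Copy H (⊤ : SimpleGraph (Fin n)), IsRainbow C φ}

/-! Put `r = q - 2`, so that `p = 2r + 2`, `q = r + 2`, and the cycles have lengths `2r + 1` and `2r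
+ 2`.

Lower bound: give every edge meeting a fixed set of `r` vertices its own color and all other edges
one common color. Any `2r + 2` vertices include `r + 2` outside the fixed set.

Upper bound on the anti-Ramsey number: more than `r (n - 1)` colors force a rainbow cycle of length
`2r + 1` or `2r + 2` (`exists_rainbowCycle_of_card_colors`). In a minimal counterexample, deleting a
nonempty set `Q` of at most `2r` vertices destroys more than `r |Q|` colors, those exclusive to `Q`.
One representative edge per color, directed away from a vertex to which its color is exclusive,
gives a digraph of minimum out-degree at least `r + 1`. A longest-path argument
(`exists_small_closed`) finds a closed set of at most `2r` vertices in it, and Ore's criterion makes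
this set rainbow Hamilton-connected. A largest such "linked" set of at most `2r` vertices has two
suitable edges leaving it; a spanning rainbow path of the set, these edges and a tail outside the
set close up to a forbidden cycle, since a tail that cannot be prolonged would yield a larger linked
set. Finally, a rainbow `C_{2r+1}` with neither a rainbow `C_{2r+2}` nor a disjoint edge of a new
color leaves fewer than `r n` colors (`card_colors_lt_of_rainbowCycle`).

Middle inequality: an extremal pierced coloring contains no rainbow member of the family. In a
`C_{2r+2}`, any `r + 2` vertices span two cycle edges, so they are not monochromatic. For `C_{2r+1}
∪ K_2`, piercing makes each outside vertex see alternate cycle vertices in one cycle color, and the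
disjoint edge forces the remaining cycle vertices to be monochromatic too. This leaves fewer colors
than the lower-bound construction has (`HasMonoCliques.card_colors_add_le`). -/

/-! ### Inward paths and small closed sets in digraphs. -/

/-- A path, given by its first `n` vertices, each of whose edges is an arc of `R` that leaves an
inner vertex of the path. -/
def InwardPath {V : Type*} (R : V → V → Prop) (n : ℕ) (f : ℕ → V) : Prop :=
  Set.InjOn f (Set.Iio n) ∧ ∀ i, i + 1 < n →
    (1 ≤ i ∧ R (f i) (f (i + 1))) ∨ (i + 2 < n ∧ R (f (i + 1)) (f i))

/-- A path in the underlying graph of the digraph `R`. -/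
def SymPath {V : Type*} (R : V → V → Prop) (n : ℕ) (f : ℕ → V) : Prop :=
  Set.InjOn f (Set.Iio n) ∧ ∀ i, i + 1 < n → R (f i) (f (i + 1)) ∨ R (f (i + 1)) (f i)

/-- A cycle in the underlying graph of the digraph `R`. -/
def SymCycle {V : Type*} (R : V → V → Prop) (n : ℕ) (f : ℕ → V) : Prop :=
  SymPath R n f ∧ (R (f 0) (f (n - 1)) ∨ R (f (n - 1)) (f 0))

section Digraph

variable {V : Type*} {R : V → V → Prop}

lemma InwardPath.symPath {n : ℕ} {f : ℕ → V} (h : InwardPath R n f) : SymPath R n f :=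
  ⟨h.1, fun i hi => (h.2 i hi).imp And.right And.right⟩

lemma injOn_reverse {n : ℕ} {f : ℕ → V} (h : Set.InjOn f (Set.Iio n)) :
    Set.InjOn (fun i => f (n - 1 - i)) (Set.Iio n) := by
  intro i hi j hj hij
  simp only [Set.mem_Iio] at hi hj
  have := h (show n - 1 - i ∈ Set.Iio n by simp; omega)
    (show n - 1 - j ∈ Set.Iio n by simp; omega) hij
  omega

lemma InwardPath.reverse {n : ℕ} {f : ℕ → V} (h : InwardPath R n f) :
    InwardPath R n (fun i => f (n - 1 - i)) := by
  refine ⟨injOn_reverse h.1, fun i hi => ?_⟩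
  have := h.2 (n - 1 - (i + 1)) (by omega)
  have e : n - 1 - (i + 1) + 1 = n - 1 - i := by omega
  rw [e] at this
  rcases this with ⟨h1, h2⟩ | ⟨h1, h2⟩
  · right; exact ⟨by omega, h2⟩
  · left; exact ⟨by omega, h2⟩

/-- Once the path is prolonged its old last vertex is inner, so an arc leaving it becomes
admissible. -/
lemma InwardPath.append {n : ℕ} {f : ℕ → V} (h : InwardPath R n f) (hn : 2 ≤ n) {x : V}
    (hx : ∀ i < n, f i ≠ x) (hR : R (f (n - 1)) x) :
    InwardPath R (n + 1) (fun i => if i < n then f i else x) := by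
  refine ⟨?_, ?_⟩
  · intro i hi j hj hij
    simp only [Set.mem_Iio] at hi hj
    by_cases h1 : i < n <;> by_cases h2 : j < n <;> simp only [h1, h2, if_true, if_false] at hij
    · exact h.1 h1 h2 hij
    · exact absurd hij (hx i h1)
    · exact absurd hij.symm (hx j h2)
    · omega
  · intro i hi
    by_cases h1 : i + 1 < n
    · have h2 : i < n := by omega
      simp only [h1, h2, if_true]
      rcases h.2 i h1 with ⟨a, b⟩ | ⟨a, b⟩
      · exact Or.inl ⟨a, b⟩
      · exact Or.inr ⟨by omega, b⟩
    · have h2 : i = n - 1 := by omega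
      subst h2
      have h3 : n - 1 < n := by omega
      simp only [h1, h3, if_true, if_false]
      exact Or.inl ⟨by omega, hR⟩

/-- A cycle can be opened at any of its vertices. -/
lemma SymCycle.rotate {n : ℕ} {f : ℕ → V} (h : SymCycle R n f) {k : ℕ} (hk : k < n) :
    SymCycle R n (fun i => f ((k + i) % n)) := by
  have hn : 0 < n := by omega
  have key : ∀ i, R (f (i % n)) (f ((i + 1) % n)) ∨ R (f ((i + 1) % n)) (f (i % n)) := by
    intro i
    have hi := Nat.mod_lt i hn
    by_cases h1 : i % n + 1 < n
    · have : (i + 1) % n = i % n + 1 := by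
        rw [Nat.add_mod, Nat.mod_eq_of_lt (a := 1) (by omega), Nat.mod_eq_of_lt h1]
      rw [this]; exact h.1.2 _ h1
    · have h2 : i % n = n - 1 := by omega
      have : (i + 1) % n = 0 := by
        have e : (i + 1) % n = (i % n + 1) % n := by simp
        rw [e, h2, Nat.sub_add_cancel hn, Nat.mod_self]
      rw [this, h2]; exact h.2.symm
  refine ⟨⟨?_, fun i _ => key (k + i)⟩, ?_⟩
  · intro i hi j hj hij
    simp only [Set.mem_Iio] at hi hj
    have := h.1.1 (show (k + i) % n ∈ Set.Iio n from Nat.mod_lt _ hn)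
      (show (k + j) % n ∈ Set.Iio n from Nat.mod_lt _ hn) hij
    have h2 : i ≡ j [MOD n] := Nat.ModEq.add_left_cancel' k this
    exact Nat.ModEq.eq_of_lt_of_lt h2 hi hj
  · have := key (k + (n - 1))
    have e : (k + (n - 1) + 1) % n = (k + 0) % n := by
      rw [show k + (n - 1) + 1 = k + n by omega, Nat.add_mod_right, Nat.add_zero]
    rw [e] at this
    exact this.symm

/-- If the first vertex of a path has an arc that leaves the path, then many edges of the path are
arcs in the forward direction only, provided that there are no longer inward paths. -/
lemma card_forward_edges [Fintype V] [DecidableEq V] [DecidableRel R] (hirr : ∀ v, ¬ R v v)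
    {r M : ℕ} (hdeg : ∀ v, r + 1 ≤ (Finset.univ.filter (R v)).card)
    (hmax : ∀ n f, M < n → n ≤ 2 * r + 2 → ¬ InwardPath R n f) (hM : 3 ≤ M) (hMr : M ≤ 2 * r)
    {p : ℕ → V} (hp : SymPath R M p) {x : V} (hx : ∀ i < M, p i ≠ x) (hxR : R (p 0) x)
    (hcyc : M = 2 * r → ¬ R (p (M - 1)) x) :
    r ≤ ((Finset.range (M - 1)).filter (fun i => 1 ≤ i ∧ ¬ R (p (i + 1)) (p i))).card +
      (if M = 2 * r then 0 else 1) := by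
  set B := (Finset.range (M - 1)).filter (fun i => 1 ≤ i ∧ ¬ R (p (i + 1)) (p i)) with hB
  -- Bounds the out-neighbors of the last vertex: apart from `p (M - 2)` and possibly `x`, each is
  -- some `p j` for which the edge after `p (j + 1)` is not an arc backwards.
  have hsub : Finset.univ.filter (R (p (M - 1))) ⊆
      (B.image (fun i => p (i - 1)) ∪ {p (M - 2)}) ∪ (if M = 2 * r then ∅ else {x}) := by
    intro w hw
    simp only [Finset.mem_filter, Finset.mem_univ, true_and] at hw
    by_cases hwx : w = x
    · subst hwx
      have : M ≠ 2 * r := fun h => hcyc h hw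
      simp [this]
    by_cases hwp : ∃ j < M, p j = w
    · obtain ⟨j, hj, rfl⟩ := hwp
      have hj1 : j ≠ M - 1 := fun h => hirr _ (h ▸ hw)
      by_cases hj2 : j = M - 2
      · subst hj2; simp
      apply Finset.mem_union_left
      apply Finset.mem_union_left
      refine Finset.mem_image.2 ⟨j + 1, ?_, by simp⟩
      rw [hB, Finset.mem_filter, Finset.mem_range]
      refine ⟨by omega, by omega, fun hbad => ?_⟩
      -- Pósa rotation: `x, p 0, …, p j, p (M - 1), …, p (j + 1)`. Its last edge leaves the inner
      -- vertex `p (j + 2)` exactly by the assumption `hbad`.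
      refine hmax (M + 1) (fun k => if k = 0 then x else if k ≤ j + 1 then p (k - 1) else
        p (M + 1 + j - k)) (by omega) (by omega) ⟨?_, ?_⟩
      · intro a ha b hb hab
        simp only [Set.mem_Iio] at ha hb
        have inj : ∀ a b, a < M → b < M → p a = p b → a = b := fun a b h1 h2 h3 => hp.1 h1 h2 h3
        dsimp only at hab
        split_ifs at hab with h1 h2 h3 h4 h5 h6 h7 h8
        · omega
        · exact absurd hab.symm (hx _ (by omega))
        · exact absurd hab.symm (hx _ (by omega))
        · exact absurd hab (hx _ (by omega))
        · have := inj _ _ (by omega) (by omega) hab; omega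
        · have := inj _ _ (by omega) (by omega) hab; omega
        · exact absurd hab (hx _ (by omega))
        · have := inj _ _ (by omega) (by omega) hab; omega
        · have := inj _ _ (by omega) (by omega) hab; omega
      · intro k hk
        dsimp only
        rcases Nat.eq_zero_or_pos k with rfl | hk0
        · right; simpa using ⟨by omega, hxR⟩
        have h0 : k ≠ 0 := by omega
        have h0' : k + 1 ≠ 0 := by omega
        simp only [h0, h0', if_false]
        by_cases h1 : k + 1 ≤ j + 1
        · have h2 : k ≤ j + 1 := by omega
          simp only [h1, h2, if_true]
          have := hp.2 (k - 1) (by omega)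
          rw [show k - 1 + 1 = k + 1 - 1 by omega] at this
          exact this.imp (fun h => ⟨by omega, h⟩) (fun h => ⟨by omega, h⟩)
        · by_cases h2 : k ≤ j + 1
          · have h3 : k = j + 1 := by omega
            subst h3
            simp only [h1, if_false, le_refl, if_true]
            right
            refine ⟨by omega, ?_⟩
            rw [show M + 1 + j - (j + 1 + 1) = M - 1 by omega]
            simpa using hw
          · simp only [h1, h2, if_false]
            by_cases h3 : k = M - 1
            · subst h3
              left
              rw [show M + 1 + j - (M - 1) = j + 1 + 1 by omega,
                show M + 1 + j - (M - 1 + 1) = j + 1 by omega]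
              exact ⟨by omega, hbad⟩
            · have := hp.2 (M + 1 + j - (k + 1)) (by omega)
              rw [show M + 1 + j - (k + 1) + 1 = M + 1 + j - k by omega] at this
              rcases this with h | h
              · right; exact ⟨by omega, h⟩
              · left; exact ⟨by omega, h⟩
    · exfalso
      push Not at hwp
      -- An out-neighbor off the path extends it at both ends. Two vertices are gained at once,
      -- which is why inward paths on `2r + 2` vertices must be excluded too.
      refine hmax (M + 2) (fun k => if k = 0 then x else if k ≤ M then p (k - 1) else w)
        (by omega) (by omega) ⟨?_, ?_⟩
      · intro a ha b hb hab
        simp only [Set.mem_Iio] at ha hb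
        dsimp only at hab
        split_ifs at hab with h1 h2 h3 h4 h5 h6 h7 h8
        · omega
        · exact absurd hab.symm (hx _ (by omega))
        · exact absurd hab.symm hwx
        · exact absurd hab (hx _ (by omega))
        · have := hp.1 (show a - 1 < M by omega) (show b - 1 < M by omega) hab; omega
        · exact absurd hab (hwp _ (by omega))
        · exact absurd hab hwx
        · exact absurd hab.symm (hwp _ (by omega))
        · omega
      · intro k hk
        dsimp only
        rcases Nat.eq_zero_or_pos k with rfl | hk0
        · right
          have : 1 ≤ M := by omega
          simpa [this] using ⟨by omega, hxR⟩
        have h0 : k ≠ 0 := by omega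
        have h0' : k + 1 ≠ 0 := by omega
        simp only [h0, h0', if_false]
        by_cases h1 : k + 1 ≤ M
        · have h2 : k ≤ M := by omega
          simp only [h1, h2, if_true]
          have := hp.2 (k - 1) (by omega)
          rw [show k - 1 + 1 = k + 1 - 1 by omega] at this
          exact this.imp (fun h => ⟨by omega, h⟩) (fun h => ⟨by omega, h⟩)
        · have h3 : k = M := by omega
          subst h3
          simp only [h1, if_false, le_refl, if_true]
          left; exact ⟨by omega, hw⟩
  have h1 := (hdeg (p (M - 1))).trans (Finset.card_le_card hsub)
  have h2 : (if M = 2 * r then (∅ : Finset V) else {x}).card = if M = 2 * r then 0 else 1 := by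
    split_ifs <;> simp
  have h3 := Finset.card_union_le (B.image (fun i => p (i - 1)) ∪ {p (M - 2)})
    (if M = 2 * r then ∅ else {x})
  have h4 := Finset.card_union_le (B.image (fun i => p (i - 1))) {p (M - 2)}
  have h5 : (B.image (fun i => p (i - 1))).card ≤ B.card := Finset.card_image_le
  simp only [Finset.card_singleton] at h4
  omega

/-- A digraph of large minimum out-degree without inward paths on `2r+1` or `2r+2` vertices and
without cycles on `2r+1` vertices has a small closed set of vertices. -/
theorem exists_small_closed [Fintype V] [Nonempty V] [DecidableEq V] [DecidableRel R]
    (hirr : ∀ v, ¬ R v v) {r : ℕ} (hr : 2 ≤ r)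
    (hdeg : ∀ v, r + 1 ≤ (Finset.univ.filter (R v)).card)
    (hno1 : ∀ f, ¬ InwardPath R (2 * r + 1) f) (hno2 : ∀ f, ¬ InwardPath R (2 * r + 2) f)
    (hcyc : ∀ f, ¬ SymCycle R (2 * r + 1) f) :
    ∃ Q : Finset V, Q.Nonempty ∧ Q.card ≤ 2 * r ∧ ∀ v ∈ Q, ∀ w, R v w → w ∈ Q := by
  classical
  obtain ⟨M, hM3, hMr, ⟨f, hf⟩, hmax⟩ : ∃ M, 3 ≤ M ∧ M ≤ 2 * r ∧ (∃ f, InwardPath R M f) ∧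
      ∀ n f, M < n → n ≤ 2 * r + 2 → ¬ InwardPath R n f := by
    have h3 : ∃ f, InwardPath R 3 f := by
      obtain ⟨u⟩ := ‹Nonempty V›
      have : 1 < (Finset.univ.filter (R u)).card := by have := hdeg u; omega
      obtain ⟨a, ha, b, hb, hab⟩ := Finset.one_lt_card.1 this
      simp only [Finset.mem_filter, Finset.mem_univ, true_and] at ha hb
      have hau : a ≠ u := fun h => hirr u (h ▸ ha)
      have hbu : b ≠ u := fun h => hirr u (h ▸ hb)
      refine ⟨fun k => if k = 0 then a else if k = 1 then u else b, ?_, ?_⟩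
      · intro i hi j hj hij
        simp only [Set.mem_Iio] at hi hj
        interval_cases i <;> interval_cases j <;> simp_all
      · intro i hi
        have : i < 2 := by omega
        interval_cases i <;> simp [ha, hb]
    let P : ℕ → Prop := fun n => ∃ f, InwardPath R n f
    have hP3 : P 3 := h3
    refine ⟨Nat.findGreatest P (2 * r), Nat.le_findGreatest (by omega) hP3,
      Nat.findGreatest_le _, Nat.findGreatest_spec (P := P) (m := 3) (by omega) hP3, ?_⟩
    intro n f h1 h2 h3
    by_cases h4 : n ≤ 2 * r
    · exact Nat.findGreatest_is_greatest h1 h4 ⟨f, h3⟩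
    · rcases (show n = 2 * r + 1 ∨ n = 2 * r + 2 by omega) with rfl | rfl
      · exact hno1 f h3
      · exact hno2 f h3
  -- By maximality of `M`, all out-neighbors of the ends of a longest inward path lie on it.
  have hend : ∀ g, InwardPath R M g → ∀ x, R (g (M - 1)) x → ∃ i < M, g i = x := by
    intro g hg x hx
    by_contra hcon
    push Not at hcon
    exact hmax _ _ (by omega) (by omega) (hg.append (by omega) hcon hx)
  have hlast := hend f hf
  have hfirst : ∀ x, R (f 0) x → ∃ i < M, f i = x := by
    intro x hx
    have := hend _ hf.reverse x (by simpa using hx)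
    obtain ⟨i, hi, h⟩ := this
    exact ⟨M - 1 - i, by omega, h⟩
  -- Dirac's crossing argument: both ends send at least `r + 1` arcs into a path with `M - 1 < 2r +
  -- 2` edges, so two of them cross at some edge and close a cycle on the same vertices.
  obtain ⟨i, hi, hi0, hil⟩ : ∃ i, i < M - 1 ∧ R (f 0) (f (i + 1)) ∧ R (f (M - 1)) (f i) := by
    set I0 := (Finset.range (M - 1)).filter (fun i => R (f 0) (f (i + 1)))
    set Il := (Finset.range (M - 1)).filter (fun i => R (f (M - 1)) (f i))
    have h0 : r + 1 ≤ I0.card := by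
      refine (hdeg (f 0)).trans ?_
      refine (Finset.card_le_card (t := I0.image (fun i => f (i + 1))) ?_).trans
        Finset.card_image_le
      intro w hw
      simp only [Finset.mem_filter, Finset.mem_univ, true_and] at hw
      obtain ⟨j, hj, rfl⟩ := hfirst w hw
      have hj0 : j ≠ 0 := by rintro rfl; exact hirr _ hw
      refine Finset.mem_image.2 ⟨j - 1, ?_, by rw [Nat.sub_add_cancel (by omega)]⟩
      refine Finset.mem_filter.2 ⟨Finset.mem_range.2 (by omega), ?_⟩
      rwa [Nat.sub_add_cancel (by omega)]
    have hl : r + 1 ≤ Il.card := by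
      refine (hdeg (f (M - 1))).trans ?_
      refine (Finset.card_le_card (t := Il.image f) ?_).trans Finset.card_image_le
      intro w hw
      simp only [Finset.mem_filter, Finset.mem_univ, true_and] at hw
      obtain ⟨j, hj, rfl⟩ := hlast w hw
      have hj0 : j ≠ M - 1 := by rintro rfl; exact hirr _ hw
      refine Finset.mem_image.2 ⟨j, ?_, rfl⟩
      exact Finset.mem_filter.2 ⟨Finset.mem_range.2 (by omega), hw⟩
    have hu : (I0 ∪ Il).card ≤ M - 1 := by
      refine (Finset.card_le_card (t := Finset.range (M - 1)) ?_).trans (by simp)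
      exact Finset.union_subset (Finset.filter_subset _ _) (Finset.filter_subset _ _)
    have hui := Finset.card_union_add_card_inter I0 Il
    have : 0 < (I0 ∩ Il).card := by omega
    obtain ⟨i, hi⟩ := Finset.card_pos.1 this
    rw [Finset.mem_inter, Finset.mem_filter, Finset.mem_filter, Finset.mem_range] at hi
    exact ⟨i, hi.1.1, hi.1.2, hi.2.2⟩
  obtain ⟨g, hg⟩ : ∃ g, SymCycle R M g := by
    refine ⟨fun k => if k ≤ i then f k else f (M + i - k), ⟨⟨?_, ?_⟩, ?_⟩⟩
    · intro a ha b hb hab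
      simp only [Set.mem_Iio] at ha hb
      have inj : ∀ a b, a < M → b < M → f a = f b → a = b := fun a b h1 h2 h3 => hf.1 h1 h2 h3
      dsimp only at hab
      split_ifs at hab with h1 h2 h3
      all_goals have := inj _ _ (by omega) (by omega) hab; omega
    · intro k hk
      dsimp only
      by_cases h1 : k + 1 ≤ i
      · have h2 : k ≤ i := by omega
        simp only [h1, h2, if_true]
        exact hf.symPath.2 k hk
      · by_cases h2 : k ≤ i
        · have : k = i := by omega
          subst this
          simp only [h1, le_refl, if_true, if_false]
          right
          rwa [show M + k - (k + 1) = M - 1 by omega]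
        · simp only [h1, h2, if_false]
          have := hf.symPath.2 (M + i - (k + 1)) (by omega)
          rw [show M + i - (k + 1) + 1 = M + i - k by omega] at this
          exact this.symm
    · have h1 : ¬ M - 1 ≤ i := by omega
      simp only [Nat.zero_le, if_true, h1, if_false]
      left
      rwa [show M + i - (M - 1) = i + 1 by omega]
  refine ⟨(Finset.range M).image g, ?_, ?_, ?_⟩
  · exact ⟨g 0, Finset.mem_image_of_mem _ (Finset.mem_range.2 (by omega))⟩
  · exact Finset.card_image_le.trans (by simpa using hMr)
  -- If an arc leaves the cycle at `v`, the cycle is opened at `v` and traversed in both directions,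
  -- as `p` and `p'`.
  intro v hv x hvx
  by_contra hxQ
  obtain ⟨k, hk, rfl⟩ := Finset.mem_image.1 hv
  rw [Finset.mem_range] at hk
  have hxg : ∀ i < M, g i ≠ x := fun i hi h =>
    hxQ (Finset.mem_image.2 ⟨i, Finset.mem_range.2 hi, h⟩)
  set p : ℕ → V := fun i => g ((k + i) % M) with hp
  have hpc : SymCycle R M p := hg.rotate hk
  have hp0 : R (p 0) x := by simpa [hp, Nat.mod_eq_of_lt hk] using hvx
  have hpx : ∀ i < M, p i ≠ x := fun i _ => hxg _ (Nat.mod_lt _ (by omega))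
  set p' : ℕ → V := fun i => if i = 0 then p 0 else p (M - i) with hp'
  have hpp' : SymPath R M p' := by
    refine ⟨?_, ?_⟩
    · intro a ha b hb hab
      simp only [Set.mem_Iio] at ha hb
      have inj : ∀ a b, a < M → b < M → p a = p b → a = b := fun a b h1 h2 h3 => hpc.1.1 h1 h2 h3
      simp only [hp'] at hab
      split_ifs at hab with h1 h2 h3
      all_goals first | omega | (have := inj _ _ (by omega) (by omega) hab; omega)
    · intro j hj
      simp only [hp']
      rcases Nat.eq_zero_or_pos j with rfl | h0
      · simpa using hpc.2
      · have h1 : j ≠ 0 := by omega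
        simp only [h1, if_false, Nat.succ_ne_zero]
        have := hpc.1.2 (M - (j + 1)) (by omega)
        rw [show M - (j + 1) + 1 = M - j by omega] at this
        exact this.symm
  have hnocyc : ∀ q : ℕ → V, SymPath R M q → (∀ i < M, q i ≠ x) → R (q 0) x →
      M = 2 * r → ¬ R (q (M - 1)) x := by
    intro q hq hqx hq0 hM2 hqM
    refine hcyc (fun i => if i < M then q i else x) ⟨⟨?_, ?_⟩, ?_⟩
    · intro a ha b hb hab
      simp only [Set.mem_Iio] at ha hb
      dsimp only at hab
      split_ifs at hab with h1 h2 h3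
      · exact hq.1 h1 h2 hab
      · exact absurd hab (hqx _ h1)
      · exact absurd hab.symm (hqx _ h3)
      · omega
    · intro j hj
      have h1 : j < M := by omega
      by_cases h2 : j + 1 < M
      · simp only [h1, h2, if_true]; exact hq.2 j h2
      · simp only [h1, h2, if_true, if_false]
        left; rwa [show j = M - 1 by omega]
    · have h1 : 0 < M := by omega
      have h2 : ¬ (2 * r + 1 - 1 < M) := by omega
      simp only [h1, h2, if_true, if_false]
      left; exact hq0
  have hp'x : ∀ i < M, p' i ≠ x := by
    intro i hi
    simp only [hp']
    split_ifs
    · exact hpx _ (by omega)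
    · exact hpx _ (by omega)
  have hp'0 : R (p' 0) x := by simpa [hp'] using hp0
  have c1 := card_forward_edges hirr hdeg hmax hM3 hMr hpc.1 hpx hp0 (hnocyc p hpc.1 hpx hp0)
  have c2 := card_forward_edges hirr hdeg hmax hM3 hMr hpp' hp'x hp'0
    (hnocyc p' hpp' hp'x hp'0)
  set B1 := (Finset.range (M - 1)).filter (fun i => 1 ≤ i ∧ ¬ R (p (i + 1)) (p i))
  set B2 := (Finset.range (M - 1)).filter (fun i => 1 ≤ i ∧ ¬ R (p' (i + 1)) (p' i))
  -- Each cycle edge is an arc in some direction, so it is not forward-only for both traversals.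
  -- Edge `b` of `p'` is edge `M - 1 - b` of `p`, and only the indices `1, …, M - 2` occur.
  have hB : B1.card + B2.card ≤ M - 2 := by
    have h1 : B2.card = (B2.image (fun i => M - 1 - i)).card := by
      rw [Finset.card_image_of_injOn]
      intro a ha b hb hab
      simp only [B2, Finset.coe_filter, Finset.mem_range, Set.mem_ofPred_eq] at ha hb
      dsimp only at hab
      omega
    rw [h1, ← Finset.card_union_of_disjoint]
    · refine (Finset.card_le_card (t := Finset.Icc 1 (M - 2)) ?_).trans (by simp)
      intro a ha
      simp only [B1, B2, Finset.mem_union, Finset.mem_filter, Finset.mem_image,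
        Finset.mem_range] at ha
      rw [Finset.mem_Icc]
      rcases ha with h | ⟨b, hb, rfl⟩ <;> omega
    · rw [Finset.disjoint_left]
      intro a ha hb
      simp only [B1, B2, Finset.mem_filter, Finset.mem_image, Finset.mem_range] at ha hb
      obtain ⟨b, ⟨hb1, hb2, hb3⟩, rfl⟩ := hb
      have h0 : b ≠ 0 := by omega
      simp only [hp', h0, if_false, Nat.succ_ne_zero] at hb3
      rw [show M - (b + 1) = M - 1 - b by omega,
        show M - b = M - 1 - b + 1 by omega] at hb3
      rcases hpc.1.2 (M - 1 - b) (by omega) with h | h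
      · exact hb3 h
      · exact ha.2.2 h
  -- The two bounds add up to `2r ≤ M - 2` if `M = 2r`, and to `2r ≤ M` if `M < 2r`.
  split_ifs at c1 c2 <;> omega

end Digraph

/-! ### Hamilton-connected graphs. -/

/-- `f` enumerates `Q` so that consecutive vertices are adjacent in `H`. -/
def HamPath {V : Type*} (H : SimpleGraph V) (Q : Finset V) (f : ℕ → V) : Prop :=
  Set.InjOn f (Set.Iio Q.card) ∧ (∀ i < Q.card, f i ∈ Q) ∧
    ∀ i, i + 1 < Q.card → H.Adj (f i) (f (i + 1))

/-- Any two vertices of `Q` are the ends of a path of `H` with vertex set `Q`. -/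
def HamConnected {V : Type*} (H : SimpleGraph V) (Q : Finset V) : Prop :=
  ∀ z ∈ Q, ∀ z' ∈ Q, z ≠ z' → ∃ f, HamPath H Q f ∧ f 0 = z ∧ f (Q.card - 1) = z'

section Ham

variable {V : Type*} {H : SimpleGraph V}

lemma HamPath.reverse {Q : Finset V} {f : ℕ → V} (h : HamPath H Q f) :
    HamPath H Q (fun i => f (Q.card - 1 - i)) := by
  refine ⟨injOn_reverse h.1, fun i hi => h.2.1 _ (by omega), fun i hi => ?_⟩
  have := h.2.2 (Q.card - 1 - (i + 1)) (by omega)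
  rw [show Q.card - 1 - (i + 1) + 1 = Q.card - 1 - i by omega] at this
  exact this.symm

lemma exists_index_of_mem {Q : Finset V} {f : ℕ → V} (h1 : Set.InjOn f (Set.Iio Q.card))
    (h2 : ∀ i < Q.card, f i ∈ Q) {x : V} (hx : x ∈ Q) : ∃ i < Q.card, f i = x := by
  classical
  have : (Finset.range Q.card).image f = Q := by
    apply Finset.eq_of_subset_of_card_le
    · intro y hy
      obtain ⟨i, hi, rfl⟩ := Finset.mem_image.1 hy
      exact h2 i (Finset.mem_range.1 hi)
    · rw [Finset.card_image_of_injOn (by simpa [Set.InjOn] using h1), Finset.card_range]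
  rw [← this] at hx
  obtain ⟨i, hi, rfl⟩ := Finset.mem_image.1 hx
  exact ⟨i, Finset.mem_range.1 hi, rfl⟩

/-- Reversing the segment `lo + 1, …, hi` of a path. -/
lemma HamPath.reverse_segment {Q : Finset V} {f : ℕ → V} (h1 : Set.InjOn f (Set.Iio Q.card))
    (h2 : ∀ i < Q.card, f i ∈ Q) {lo hi : ℕ} (hlt : lo < hi) (hhi : hi + 1 < Q.card)
    (h3 : ∀ i, i + 1 < Q.card → i ≠ lo → i ≠ hi → H.Adj (f i) (f (i + 1)))
    (h4 : H.Adj (f lo) (f hi)) (h5 : H.Adj (f (lo + 1)) (f (hi + 1))) :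
    ∃ g, HamPath H Q g ∧ g 0 = f 0 ∧ g (Q.card - 1) = f (Q.card - 1) := by
  refine ⟨fun k => if lo + 1 ≤ k ∧ k ≤ hi then f (lo + 1 + hi - k) else f k, ⟨?_, ?_, ?_⟩, ?_, ?_⟩
  · intro a ha b hb hab
    simp only [Set.mem_Iio] at ha hb
    have inj : ∀ a b, a < Q.card → b < Q.card → f a = f b → a = b :=
      fun a b h h' h'' => h1 h h' h''
    dsimp only at hab
    split_ifs at hab with c1 c2 c3
    all_goals have := inj _ _ (by omega) (by omega) hab; omega
  · intro i hi
    dsimp only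
    split_ifs
    · exact h2 _ (by omega)
    · exact h2 _ hi
  · intro k hk
    dsimp only
    by_cases e1 : k = lo
    · subst e1
      rw [if_neg (by omega), if_pos (by omega), show k + 1 + hi - (k + 1) = hi by omega]
      exact h4
    by_cases e2 : k = hi
    · subst e2
      rw [if_pos (by omega), if_neg (by omega), show lo + 1 + k - k = lo + 1 by omega]
      exact h5
    by_cases e3 : lo + 1 ≤ k ∧ k ≤ hi
    · rw [if_pos e3, if_pos (by omega)]
      have := h3 (lo + 1 + hi - (k + 1)) (by omega) (by omega) (by omega)
      rw [show lo + 1 + hi - (k + 1) + 1 = lo + 1 + hi - k by omega] at this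
      exact this.symm
    · rw [if_neg e3, if_neg (by omega)]
      exact h3 k hk e1 e2
  · dsimp only; rw [if_neg (by omega)]
  · dsimp only; rw [if_neg (by omega)]

/-- A single non-edge of a spanning path can be avoided if its ends have large degree sum. -/
lemma HamPath.avoid_edge [DecidableEq V] [DecidableRel H.Adj] {Q : Finset V} {f : ℕ → V}
    (h1 : Set.InjOn f (Set.Iio Q.card)) (h2 : ∀ i < Q.card, f i ∈ Q) {i₀ : ℕ}
    (hi₀ : i₀ + 1 < Q.card) (h3 : ∀ i, i + 1 < Q.card → i ≠ i₀ → H.Adj (f i) (f (i + 1)))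
    (hdeg : Q.card + 1 ≤ (Q.filter (H.Adj (f i₀))).card + (Q.filter (H.Adj (f (i₀ + 1)))).card) :
    ∃ g, HamPath H Q g ∧ g 0 = f 0 ∧ g (Q.card - 1) = f (Q.card - 1) := by
  set A := (Finset.range (Q.card - 1)).filter (fun j => H.Adj (f i₀) (f j)) with hA
  set B := (Finset.range (Q.card - 1)).filter (fun j => H.Adj (f (i₀ + 1)) (f (j + 1))) with hB
  have hA1 : (Q.filter (H.Adj (f i₀))).card ≤ A.card + 1 := by
    refine (Finset.card_le_card (t := A.image f ∪ {f (Q.card - 1)}) ?_).trans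
      ((Finset.card_union_le _ _).trans (by simpa using Finset.card_image_le))
    intro x hx
    rw [Finset.mem_filter] at hx
    obtain ⟨j, hj, rfl⟩ := exists_index_of_mem h1 h2 hx.1
    by_cases hj' : j = Q.card - 1
    · subst hj'; simp
    · apply Finset.mem_union_left
      exact Finset.mem_image_of_mem _ (Finset.mem_filter.2
        ⟨Finset.mem_range.2 (by omega), hx.2⟩)
  have hB1 : (Q.filter (H.Adj (f (i₀ + 1)))).card ≤ B.card + 1 := by
    refine (Finset.card_le_card (t := B.image (fun j => f (j + 1)) ∪ {f 0}) ?_).trans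
      ((Finset.card_union_le _ _).trans (by simpa using Finset.card_image_le))
    intro x hx
    rw [Finset.mem_filter] at hx
    obtain ⟨j, hj, rfl⟩ := exists_index_of_mem h1 h2 hx.1
    by_cases hj' : j = 0
    · subst hj'; simp
    · apply Finset.mem_union_left
      refine Finset.mem_image.2 ⟨j - 1, Finset.mem_filter.2 ⟨Finset.mem_range.2 (by omega), ?_⟩, ?_⟩
      · rw [Nat.sub_add_cancel (by omega)]; exact hx.2
      · rw [Nat.sub_add_cancel (by omega)]
  -- Index `i₀` is in neither set, while `|A| + |B| ≥ |Q| - 1`. A common index `j` provides two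
  -- chords that replace the edges at `j` and `i₀` after the segment between them is reversed.
  have hu : (A ∪ B).card ≤ Q.card - 2 := by
    refine (Finset.card_le_card (t := (Finset.range (Q.card - 1)).erase i₀) ?_).trans ?_
    · intro j hj
      rw [Finset.mem_union, hA, hB, Finset.mem_filter, Finset.mem_filter] at hj
      rw [Finset.mem_erase]
      rcases hj with hj | hj
      · exact ⟨fun h => H.irrefl (h ▸ hj.2), hj.1⟩
      · exact ⟨fun h => H.irrefl (h ▸ hj.2), hj.1⟩
    · rw [Finset.card_erase_of_mem (Finset.mem_range.2 (by omega)), Finset.card_range]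
      omega
  have hui := Finset.card_union_add_card_inter A B
  obtain ⟨j, hj⟩ := Finset.card_pos.1 (show 0 < (A ∩ B).card by omega)
  rw [Finset.mem_inter, hA, hB, Finset.mem_filter, Finset.mem_filter, Finset.mem_range] at hj
  obtain ⟨⟨hj1, hj2⟩, -, hj3⟩ := hj
  rcases lt_trichotomy j i₀ with hlt | rfl | hlt
  · exact HamPath.reverse_segment h1 h2 hlt hi₀ (fun i hi _ h => h3 i hi h) hj2.symm hj3.symm
  · exact absurd hj2 (H.irrefl)
  · exact HamPath.reverse_segment h1 h2 hlt (by omega) (fun i hi h _ => h3 i hi h) hj2 hj3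

lemma hamConnected_of_complete [DecidableEq V] {Q : Finset V}
    (h : ∀ a ∈ Q, ∀ b ∈ Q, a ≠ b → H.Adj a b) : HamConnected H Q := by
  intro z hz z' hz' hzz
  set m := ((Q.erase z).erase z').toList with hm
  have hz'' : z' ∈ Q.erase z := Finset.mem_erase.2 ⟨hzz.symm, hz'⟩
  have hlen : (z :: (m ++ [z'])).length = Q.card := by
    have h1 := Finset.card_erase_of_mem hz''
    have h2 := Finset.card_erase_of_mem hz
    have h3 : 0 < (Q.erase z).card := Finset.card_pos.2 ⟨_, hz''⟩
    simp [hm, h1, h2]; omega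
  have hnd : (z :: (m ++ [z'])).Nodup := by
    rw [List.nodup_cons, List.nodup_append]
    refine ⟨?_, Finset.nodup_toList _, by simp, ?_⟩
    · simp [hm, hzz]
    · intro a ha b hb
      rw [List.mem_singleton] at hb
      subst hb
      rintro rfl
      simp [hm] at ha
  have hmem : ∀ x ∈ z :: (m ++ [z']), x ∈ Q := by
    intro x hx
    simp [hm] at hx
    rcases hx with rfl | hx | rfl
    · exact hz
    · exact hx.2.2
    · exact hz'
  have inj : Set.InjOn (fun i => (z :: (m ++ [z'])).getD i z) (Set.Iio Q.card) := by
    intro a ha b hb hab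
    rw [Set.mem_Iio, ← hlen] at ha hb
    dsimp only at hab
    rw [List.getD_eq_getElem _ _ ha, List.getD_eq_getElem _ _ hb] at hab
    exact (List.Nodup.getElem_inj_iff hnd).1 hab
  have hin : ∀ i < Q.card, (z :: (m ++ [z'])).getD i z ∈ Q := by
    intro i hi
    rw [← hlen] at hi
    rw [List.getD_eq_getElem _ _ hi]
    exact hmem _ (List.getElem_mem hi)
  refine ⟨fun i => (z :: (m ++ [z'])).getD i z, ⟨inj, hin, ?_⟩, by simp, ?_⟩
  · intro i hi
    refine h _ (hin i (by omega)) _ (hin (i + 1) hi) (fun e => ?_)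
    have := inj (show i < Q.card by omega) (show i + 1 < Q.card by omega) e
    omega
  · have : Q.card - 1 = m.length + 1 := by rw [← hlen]; simp
    dsimp only
    rw [this]
    simp

/-- Ore's criterion for a graph to be Hamilton-connected, for graphs of large minimum degree. -/
theorem hamConnected_of_degree [Fintype V] [DecidableEq V] {Q : Finset V} {r : ℕ}
    (hQ : Q.card ≤ 2 * r) :
    ∀ (H : SimpleGraph V) [DecidableRel H.Adj],
      (∀ a ∈ Q, r + 1 ≤ (Q.filter (H.Adj a)).card) → HamConnected H Q := by
  -- Bondy–Chvátal closure: induction on the number of missing edges. A missing edge is added, and a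
  -- Hamilton path using it is rerouted by `HamPath.avoid_edge`.
  suffices ∀ (k : ℕ) (H : SimpleGraph V) [DecidableRel H.Adj],
      (Q.offDiag.filter (fun e => ¬ H.Adj e.1 e.2)).card = k →
      (∀ a ∈ Q, r + 1 ≤ (Q.filter (H.Adj a)).card) → HamConnected H Q from
    fun H _ h => this _ H rfl h
  intro k
  induction k using Nat.strong_induction_on with
  | _ k ih =>
    intro H _ hk hdeg
    classical
    by_cases hcomp : ∀ a ∈ Q, ∀ b ∈ Q, a ≠ b → H.Adj a b
    · exact hamConnected_of_complete hcomp
    push Not at hcomp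
    obtain ⟨a, ha, b, hb, hab, hnab⟩ := hcomp
    set H' : SimpleGraph V := H ⊔ SimpleGraph.edge a b with hH'
    have hHH' : ∀ x y, H.Adj x y → H'.Adj x y := fun x y h => Or.inl h
    have hH'ab : H'.Adj a b := Or.inr (by simp [SimpleGraph.edge_adj, hab])
    have hcard : (Q.offDiag.filter (fun e => ¬ H'.Adj e.1 e.2)).card < k := by
      rw [← hk]
      apply Finset.card_lt_card
      rw [Finset.ssubset_iff_of_subset]
      · refine ⟨(a, b), ?_, ?_⟩
        · simp [ha, hb, hab, hnab]
        · simp [hH'ab]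
      · intro e he
        rw [Finset.mem_filter] at he ⊢
        exact ⟨he.1, fun h => he.2 (hHH' _ _ h)⟩
    have hc' := ih _ hcard H' rfl (fun x hx => (hdeg x hx).trans (Finset.card_le_card
      (fun y hy => by
        rw [Finset.mem_filter] at hy ⊢
        exact ⟨hy.1, hHH' _ _ hy.2⟩)))
    intro z hz z' hz' hzz
    obtain ⟨f, ⟨h1, h2, h3⟩, hf0, hf1⟩ := hc' z hz z' hz' hzz
    by_cases hall : ∀ i, i + 1 < Q.card → H.Adj (f i) (f (i + 1))
    · exact ⟨f, ⟨h1, h2, hall⟩, hf0, hf1⟩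
    push Not at hall
    obtain ⟨i, hi, hni⟩ := hall
    have key : ∀ j, j + 1 < Q.card → ¬ H.Adj (f j) (f (j + 1)) →
        (f j = a ∧ f (j + 1) = b) ∨ (f j = b ∧ f (j + 1) = a) := by
      intro j hj hnj
      rcases h3 j hj with h | h
      · exact absurd h hnj
      · rw [SimpleGraph.edge_adj] at h
        exact h.1.imp (fun h => ⟨h.1, h.2⟩) (fun h => ⟨h.1, h.2⟩)
    have inj : ∀ a b, a < Q.card → b < Q.card → f a = f b → a = b :=
      fun a b h h' h'' => h1 h h' h''
    obtain ⟨g, hg, hg0, hg1⟩ := HamPath.avoid_edge (H := H) h1 h2 hi (fun j hj hji => by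
      by_contra hnj
      rcases key i hi hni with ⟨e1, e2⟩ | ⟨e1, e2⟩ <;> rcases key j hj hnj with ⟨e3, e4⟩ | ⟨e3, e4⟩
      · exact hji (inj _ _ (by omega) (by omega) (e3.trans e1.symm))
      · have := inj _ _ (by omega) (by omega) (e3.trans e2.symm)
        have := inj _ _ (by omega) (by omega) (e4.trans e1.symm)
        omega
      · have := inj _ _ (by omega) (by omega) (e3.trans e2.symm)
        have := inj _ _ (by omega) (by omega) (e4.trans e1.symm)
        omega
      · exact hji (inj _ _ (by omega) (by omega) (e3.trans e1.symm)))
      (by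
        have := hdeg _ (h2 i (by omega))
        have := hdeg _ (h2 (i + 1) hi)
        omega)
    exact ⟨g, hg, hg0.trans hf0, hg1.trans hf1⟩

lemma HamPath.cons [DecidableEq V] {Q : Finset V} {w : V} (hw : w ∉ Q) {f : ℕ → V}
    (hf : HamPath H Q f) (hadj : H.Adj w (f 0)) :
    HamPath H (insert w Q) (fun k => if k = 0 then w else f (k - 1)) := by
  have hc := Finset.card_insert_of_notMem hw
  rw [HamPath, hc]
  refine ⟨?_, ?_, ?_⟩
  · intro a ha b hb hab
    simp only [Set.mem_Iio] at ha hb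
    dsimp only at hab
    split_ifs at hab with c1 c2 c3
    · omega
    · exact absurd (hab ▸ hf.2.1 (b - 1) (by omega)) hw
    · exact absurd (hab ▸ hf.2.1 (a - 1) (by omega)) hw
    · have := hf.1 (show a - 1 < Q.card by omega) (show b - 1 < Q.card by omega) hab
      omega
  · intro i hi
    split_ifs
    · exact Finset.mem_insert_self _ _
    · exact Finset.mem_insert_of_mem (hf.2.1 _ (by omega))
  · intro i hi
    rcases Nat.eq_zero_or_pos i with rfl | h0
    · simpa using hadj
    · have h1 : i ≠ 0 := by omega
      simp only [h1, if_false, Nat.succ_ne_zero]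
      have := hf.2.2 (i - 1) (by omega)
      rwa [show i - 1 + 1 = i + 1 - 1 by omega] at this

/-- A vertex of large degree can be added to a Hamilton-connected set. -/
theorem HamConnected.insert_vertex [DecidableEq V] [DecidableRel H.Adj] {Q : Finset V} {r : ℕ}
    (hQ : HamConnected H Q)
    (hrich : r + 2 ≤ (Q.filter (fun u => r + 1 ≤ (Q.filter (H.Adj u)).card)).card)
    {w : V} (hw : w ∉ Q) (hdeg : Q.card + 2 ≤ (Q.filter (H.Adj w)).card + r) :
    HamConnected H (insert w Q) := by
  have hc := Finset.card_insert_of_notMem hw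
  have hsr : r + 2 ≤ Q.card := hrich.trans (Finset.card_le_card (Finset.filter_subset _ _))
  have hstart : ∀ z' ∈ Q, ∃ f, HamPath H (insert w Q) f ∧ f 0 = w ∧
      f ((insert w Q).card - 1) = z' := by
    intro z' hz'
    obtain ⟨q, hq⟩ := Finset.card_pos.1 (show 0 < ((Q.filter (H.Adj w)).erase z').card by
      have := Finset.pred_card_le_card_erase (s := Q.filter (H.Adj w)) (a := z')
      omega)
    rw [Finset.mem_erase, Finset.mem_filter] at hq
    obtain ⟨f, hf, hf0, hf1⟩ := hQ q hq.2.1 z' hz' hq.1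
    refine ⟨_, hf.cons hw (by rw [hf0]; exact hq.2.2), by simp, ?_⟩
    rw [hc]
    have : Q.card ≠ 0 := by omega
    simp [this, hf1]
  intro z hz z' hz' hzz
  rcases Finset.mem_insert.1 hz with rfl | hzQ
  · rcases Finset.mem_insert.1 hz' with rfl | hzQ'
    · exact absurd rfl hzz
    · exact hstart z' hzQ'
  rcases Finset.mem_insert.1 hz' with rfl | hzQ'
  · obtain ⟨f, hf, hf0, hf1⟩ := hstart z hzQ
    refine ⟨_, hf.reverse, by simpa using hf1, by simpa using hf0⟩
  obtain ⟨f, hf, hf0, hf1⟩ := hQ z hzQ z' hzQ' hzz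
  set R := Q.filter (fun u => r + 1 ≤ (Q.filter (H.Adj u)).card)
  set A := (Finset.range (Q.card - 1)).filter (fun j => H.Adj w (f j)) with hA
  set B := (Finset.range (Q.card - 1)).filter (fun j => f (j + 1) ∈ R) with hB
  have hA1 : (Q.filter (H.Adj w)).card ≤ A.card + 1 := by
    refine (Finset.card_le_card (t := A.image f ∪ {f (Q.card - 1)}) ?_).trans
      ((Finset.card_union_le _ _).trans (by simpa using Finset.card_image_le))
    intro x hx
    rw [Finset.mem_filter] at hx
    obtain ⟨j, hj, rfl⟩ := exists_index_of_mem hf.1 hf.2.1 hx.1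
    by_cases hj' : j = Q.card - 1
    · subst hj'; simp
    · apply Finset.mem_union_left
      exact Finset.mem_image_of_mem _ (Finset.mem_filter.2
        ⟨Finset.mem_range.2 (by omega), hx.2⟩)
  have hB1 : R.card ≤ B.card + 1 := by
    refine (Finset.card_le_card (t := B.image (fun j => f (j + 1)) ∪ {f 0}) ?_).trans
      ((Finset.card_union_le _ _).trans (by simpa using Finset.card_image_le))
    intro x hx
    obtain ⟨j, hj, rfl⟩ := exists_index_of_mem hf.1 hf.2.1 (Finset.mem_filter.1 hx).1
    by_cases hj' : j = 0
    · subst hj'; simp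
    · apply Finset.mem_union_left
      refine Finset.mem_image.2 ⟨j - 1, Finset.mem_filter.2 ⟨Finset.mem_range.2 (by omega), ?_⟩, ?_⟩
      · rw [Nat.sub_add_cancel (by omega)]; exact hx
      · rw [Nat.sub_add_cancel (by omega)]
  -- Here `|A| ≥ |Q| + 1 - r` and `|B| ≥ r + 1`, so some neighbor `f i` of `w` is followed by a
  -- vertex of degree at least `r + 1`.
  have hu : (A ∪ B).card ≤ Q.card - 1 := by
    refine (Finset.card_le_card (t := Finset.range (Q.card - 1)) ?_).trans (by simp)
    exact Finset.union_subset (Finset.filter_subset _ _) (Finset.filter_subset _ _)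
  have hui := Finset.card_union_add_card_inter A B
  obtain ⟨i, hi⟩ := Finset.card_pos.1 (show 0 < (A ∩ B).card by omega)
  rw [Finset.mem_inter, hA, hB, Finset.mem_filter, Finset.mem_filter, Finset.mem_range] at hi
  obtain ⟨⟨hi1, hi2⟩, -, hi3⟩ := hi
  have hwf : ∀ j < Q.card, f j ≠ w := fun j hj h => hw (h ▸ hf.2.1 j hj)
  -- With `w` inserted after `f i`, only the edge from `w` to `f (i + 1)` may be missing. Their
  -- degree sum is at least `|Q| + 3`, so it can be avoided.
  set g : ℕ → V := fun k => if k ≤ i then f k else if k = i + 1 then w else f (k - 1) with hg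
  have hgi : g (i + 1) = w := by simp [hg]
  have hgi2 : g (i + 1 + 1) = f (i + 1) := by simp [hg]
  have key := HamPath.avoid_edge (H := H) (Q := insert w Q) (f := g) (i₀ := i + 1) ?_ ?_ (by omega)
    ?_ ?_
  · obtain ⟨p, hp, hp0, hp1⟩ := key
    refine ⟨p, hp, ?_, ?_⟩
    · rw [hp0, ← hf0]; simp [hg]
    · rw [hp1, ← hf1, hc]
      simp only [hg, Nat.add_sub_cancel]
      rw [if_neg (by omega), if_neg (by omega)]
  · rw [hc]
    intro a ha b hb hab
    have inj : ∀ a b, a < Q.card → b < Q.card → f a = f b → a = b :=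
      fun a b h h' h'' => hf.1 h h' h''
    simp only [Set.mem_Iio] at ha hb
    simp only [hg] at hab
    split_ifs at hab with c1 c2 c3 c4 c5 c6
    all_goals first
      | omega
      | exact absurd hab (hwf _ (by omega))
      | exact absurd hab.symm (hwf _ (by omega))
      | (have := inj _ _ (by omega) (by omega) hab; omega)
  · rw [hc]
    intro j hj
    simp only [hg]
    split_ifs
    · exact Finset.mem_insert_of_mem (hf.2.1 _ (by omega))
    · exact Finset.mem_insert_self _ _
    · exact Finset.mem_insert_of_mem (hf.2.1 _ (by omega))
  · rw [hc]
    intro j hj hji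
    simp only [hg]
    by_cases c1 : j + 1 ≤ i
    · rw [if_pos (by omega), if_pos c1]; exact hf.2.2 j (by omega)
    by_cases c2 : j = i
    · subst c2
      rw [if_pos le_rfl, if_neg (by omega), if_pos rfl]; exact hi2.symm
    · rw [if_neg (by omega), if_neg hji, if_neg c1, if_neg (by omega)]
      have := hf.2.2 (j - 1) (by omega)
      rwa [show j - 1 + 1 = j + 1 - 1 by omega] at this
  · rw [hgi, hgi2, hc]
    have h1 : (Q.filter (H.Adj w)).card ≤ ((insert w Q).filter (H.Adj w)).card :=
      Finset.card_le_card (Finset.filter_subset_filter _ (Finset.subset_insert _ _))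
    have h2 : (Q.filter (H.Adj (f (i + 1)))).card ≤
        ((insert w Q).filter (H.Adj (f (i + 1)))).card :=
      Finset.card_le_card (Finset.filter_subset_filter _ (Finset.subset_insert _ _))
    have h3 := (Finset.mem_filter.1 hi3).2
    omega

end Ham

/-! ### Colors exclusive to a vertex set. -/

section Coloring

variable {V K : Type*} [DecidableEq K]

/-- The colors of the edges inside `U`. -/
def colorsIn (c : V → V → K) (U : Finset V) : Finset K :=
  U.offDiag.image fun e => c e.1 e.2

variable [DecidableEq V] in
/-- The colors all of whose edges have an end in `Q`. -/
def exclusiveColors [Fintype V] (c : V → V → K) (Q : Finset V) : Finset K :=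
  colorsIn c Finset.univ \ colorsIn c Qᶜ

/-- The vertices `f 0, …, f (N - 1)` form a cycle of length `N` with edges of distinct colors. -/
def RainbowCycle {V K : Type*} (c : V → V → K) (N : ℕ) (f : ℕ → V) : Prop :=
  Set.InjOn f (Set.Iio N) ∧ Set.InjOn (fun i => c (f i) (f ((i + 1) % N))) (Set.Iio N)

/-- The colors of consecutive pairs of a list of vertices. -/
def edgeColors {V K : Type*} (c : V → V → K) : List V → List K
  | [] => []
  | [_] => []
  | a :: b :: l => c a b :: edgeColors c (b :: l)

variable {c : V → V → K}

lemma mem_colorsIn {U : Finset V} {k : K} :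
    k ∈ colorsIn c U ↔ ∃ x ∈ U, ∃ y ∈ U, x ≠ y ∧ c x y = k := by
  simp only [colorsIn, Finset.mem_image, Finset.mem_offDiag, Prod.exists]
  constructor
  · rintro ⟨x, y, ⟨hx, hy, hxy⟩, h⟩; exact ⟨x, hx, y, hy, hxy, h⟩
  · rintro ⟨x, hx, y, hy, hxy, h⟩; exact ⟨x, y, ⟨hx, hy, hxy⟩, h⟩

lemma colorsIn_mono {U U' : Finset V} (h : U ⊆ U') : colorsIn c U ⊆ colorsIn c U' := by
  intro k hk
  rw [mem_colorsIn] at hk ⊢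
  obtain ⟨x, hx, y, hy, h'⟩ := hk
  exact ⟨x, h hx, y, h hy, h'⟩

variable [DecidableEq V]

lemma colorsIn_eq_image_sym2 (hc : ∀ x y, c x y = c y x) (U : Finset V) :
    colorsIn c U = (U.offDiag.image (Function.uncurry Sym2.mk)).image (Sym2.lift ⟨c, hc⟩) := by
  rw [Finset.image_image]
  rfl

lemma card_colorsIn_le (hc : ∀ x y, c x y = c y x) (U : Finset V) :
    (colorsIn c U).card ≤ U.card.choose 2 := by
  rw [colorsIn_eq_image_sym2 hc, ← Sym2.card_image_offDiag]
  exact Finset.card_image_le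

lemma eq_of_color_eq_of_card_colorsIn (hc : ∀ x y, c x y = c y x) {U : Finset V}
    (h : (colorsIn c U).card = U.card.choose 2) {x y x' y' : V} (hx : x ∈ U) (hy : y ∈ U)
    (hx' : x' ∈ U) (hy' : y' ∈ U) (hxy : x ≠ y) (hxy' : x' ≠ y') (he : c x y = c x' y') :
    s(x, y) = s(x', y') := by
  rw [colorsIn_eq_image_sym2 hc, ← Sym2.card_image_offDiag, Finset.card_image_iff] at h
  refine h ?_ ?_ he
  · exact Finset.mem_coe.2 (Finset.mem_image.2
      ⟨(x, y), Finset.mem_offDiag.2 ⟨hx, hy, hxy⟩, rfl⟩)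
  · exact Finset.mem_coe.2 (Finset.mem_image.2
      ⟨(x', y'), Finset.mem_offDiag.2 ⟨hx', hy', hxy'⟩, rfl⟩)

section Exclusive

variable [Fintype V]

lemma mem_exclusiveColors {Q : Finset V} {k : K} : k ∈ exclusiveColors c Q ↔
    (∃ x y, x ≠ y ∧ c x y = k) ∧ ∀ x y, x ≠ y → c x y = k → x ∈ Q ∨ y ∈ Q := by
  simp only [exclusiveColors, Finset.mem_sdiff, mem_colorsIn, Finset.mem_univ, true_and,
    Finset.mem_compl]
  refine and_congr Iff.rfl ⟨fun h x y hxy hk => ?_, ?_⟩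
  · by_contra hcon
    push Not at hcon
    exact h ⟨x, hcon.1, y, hcon.2, hxy, hk⟩
  · rintro h ⟨x, hx, y, hy, hxy, hk⟩
    rcases h x y hxy hk with h | h
    · exact hx h
    · exact hy h

lemma exclusiveColors_mono {Q Q' : Finset V} (h : Q ⊆ Q') :
    exclusiveColors c Q ⊆ exclusiveColors c Q' := by
  intro k hk
  rw [mem_exclusiveColors] at hk ⊢
  exact ⟨hk.1, fun x y hxy he => (hk.2 x y hxy he).imp (fun h' => h h') (fun h' => h h')⟩

lemma color_mem_exclusiveColors_singleton {v x y : V} (h : c x y ∈ exclusiveColors c {v})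
    (hxy : x ≠ y) : x = v ∨ y = v := by
  simpa using (mem_exclusiveColors.1 h).2 x y hxy rfl

/-- An exclusive color of `Q` that does not occur inside `Q` is the color of an edge
leaving `Q`. -/
lemma exists_leaving_edge (hc : ∀ x y, c x y = c y x) {Q P : Finset V} {k : K}
    (hk : k ∈ exclusiveColors c Q) (hQP : Q ⊆ P) (hin : k ∉ colorsIn c P) :
    ∃ q ∈ Q, ∃ x, x ∉ P ∧ c q x = k := by
  obtain ⟨⟨x, y, hxy, h⟩, h'⟩ := mem_exclusiveColors.1 hk
  rcases h' x y hxy h with hx | hy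
  · refine ⟨x, hx, y, fun hy => hin (mem_colorsIn.2 ⟨x, hQP hx, y, hy, hxy, h⟩), h⟩
  · refine ⟨y, hy, x, fun hx => hin (mem_colorsIn.2 ⟨x, hx, y, hQP hy, hxy, h⟩), ?_⟩
    rw [hc, h]

end Exclusive

end Coloring

/-! ### Rainbow cycles from vertex lists. -/

section EdgeColors

variable {V K : Type*} {c : V → V → K}

lemma edgeColors_append {l m : List V} (hl : l ≠ []) (hm : m ≠ []) :
    edgeColors c (l ++ m) =
      edgeColors c l ++ c (l.getLast hl) (m.head hm) :: edgeColors c m := by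
  induction l with
  | nil => exact absurd rfl hl
  | cons a l ih =>
    cases l with
    | nil =>
      cases m with
      | nil => exact absurd rfl hm
      | cons b m => simp [edgeColors]
    | cons b l =>
      have := ih (by simp)
      simp only [List.cons_append] at this ⊢
      simp [edgeColors, this]

lemma length_edgeColors (l : List V) : (edgeColors c l).length = l.length - 1 := by
  induction l with
  | nil => rfl
  | cons a l ih =>
    cases l with
    | nil => rfl
    | cons b l => simp [edgeColors, ih]

lemma getElem_edgeColors (l : List V) (i : ℕ) (h : i + 1 < l.length) :
    (edgeColors c l)[i]'(by rw [length_edgeColors]; omega) = c l[i] l[i + 1] := by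
  induction l generalizing i with
  | nil => simp at h
  | cons a l ih =>
    cases l with
    | nil => simp at h
    | cons b l =>
      cases i with
      | zero => simp [edgeColors]
      | succ i => exact ih i (by simpa using h)

lemma rainbowCycle_of_path {N : ℕ} {f : ℕ → V} (hf : Set.InjOn f (Set.Iio N))
    (h1 : ∀ i j, i + 1 < N → j + 1 < N → c (f i) (f (i + 1)) = c (f j) (f (j + 1)) → i = j)
    (h2 : ∀ i, i + 1 < N → c (f (N - 1)) (f 0) ≠ c (f i) (f (i + 1))) : RainbowCycle c N f := by
  refine ⟨hf, fun i hi j hj hij => ?_⟩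
  simp only [Set.mem_Iio] at hi hj
  dsimp only at hij
  by_cases hi' : i + 1 < N <;> by_cases hj' : j + 1 < N
  · rw [Nat.mod_eq_of_lt hi', Nat.mod_eq_of_lt hj'] at hij
    exact h1 i j hi' hj' hij
  · rw [Nat.mod_eq_of_lt hi', show j + 1 = N by omega, Nat.mod_self,
      show j = N - 1 by omega] at hij
    exact absurd hij.symm (h2 i hi')
  · rw [Nat.mod_eq_of_lt hj', show i + 1 = N by omega, Nat.mod_self,
      show i = N - 1 by omega] at hij
    exact absurd hij (h2 j hj')
  · omega

lemma rainbowCycle_of_list {l : List V} (hl : l ≠ []) (h1 : l.Nodup) (h2 : (edgeColors c l).Nodup)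
    (h3 : c (l.getLast hl) (l.head hl) ∉ edgeColors c l) :
    ∃ f, RainbowCycle c l.length f := by
  have hpos : 0 < l.length := List.length_pos_iff.2 hl
  have hlen := length_edgeColors (c := c) l
  have hget : ∀ i (hi : i < l.length), l.getD i (l.head hl) = l[i] :=
    fun i hi => List.getD_eq_getElem _ _ hi
  refine ⟨fun i => l.getD i (l.head hl), rainbowCycle_of_path ?_ ?_ ?_⟩
  · intro i hi j hj hij
    simp only [Set.mem_Iio] at hi hj
    dsimp only at hij
    rw [hget i hi, hget j hj] at hij
    exact (List.Nodup.getElem_inj_iff h1).1 hij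
  · intro i j hi hj hij
    rw [hget i (by omega), hget _ hi, hget j (by omega), hget _ hj, ← getElem_edgeColors (c := c) l i hi,
      ← getElem_edgeColors (c := c) l j hj] at hij
    exact (List.Nodup.getElem_inj_iff h2).1 hij
  · intro i hi hij
    rw [hget i (by omega), hget _ hi, hget _ hpos, hget _ (by omega),
      ← getElem_edgeColors (c := c) l i hi, ← List.getLast_eq_getElem hl, ← List.head_eq_getElem hl] at hij
    exact h3 (hij ▸ List.getElem_mem _)

lemma mem_edgeColors {l : List V} {k : K} (h : k ∈ edgeColors c l) :
    ∃ i, ∃ h : i + 1 < l.length, k = c l[i] l[i + 1] := by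
  obtain ⟨i, hi, rfl⟩ := List.getElem_of_mem h
  rw [length_edgeColors] at hi
  exact ⟨i, by omega, getElem_edgeColors l i (by omega)⟩

end EdgeColors

/-! ### Linked sets and rainbow cycles through them. -/

section Linked

variable {V K : Type*} [Fintype V] [DecidableEq V] [DecidableEq K] {c : V → V → K}

open scoped Classical in
/-- `Q` carries a Hamilton-connected rainbow graph with colors exclusive to `Q` and with many
vertices of large degree. -/
def IsLinked (c : V → V → K) (r : ℕ) (Q : Finset V) : Prop :=
  ∃ H : SimpleGraph V,
    (∀ a b, H.Adj a b → a ∈ Q ∧ b ∈ Q ∧ c a b ∈ exclusiveColors c Q) ∧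
    (∀ a b a' b', H.Adj a b → H.Adj a' b' → c a b = c a' b' → s(a, b) = s(a', b')) ∧
    HamConnected H Q ∧
    r + 2 ≤ (Q.filter (fun u => r + 1 ≤ (Q.filter (H.Adj u)).card)).card

lemma IsLinked.le_card {r : ℕ} {Q : Finset V} (h : IsLinked c r Q) : r + 2 ≤ Q.card := by
  obtain ⟨H, -, -, -, h⟩ := h
  exact h.trans (Finset.card_le_card (Finset.filter_subset _ _))

/-- A vertex with many exclusive colors that occur only on edges to `Q` can be added to a
linked set `Q`. -/
lemma IsLinked.insert_vertex (hc : ∀ x y, c x y = c y x) {r : ℕ} {Q : Finset V}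
    (hQ : IsLinked c r Q) {w : V} (hw : w ∉ Q) {A : Finset K}
    (hA : A ⊆ exclusiveColors c {w}) (hAQ : ∀ y, y ≠ w → c w y ∈ A → y ∈ Q)
    (hcard : Q.card + 2 ≤ A.card + r) : IsLinked c r (insert w Q) := by
  classical
  obtain ⟨H, hH1, hH2, hH3, hH4⟩ := hQ
  have hex : ∀ k ∈ A, ∃ y ∈ Q, c w y = k := by
    intro k hk
    obtain ⟨⟨x, y, hxy, h⟩, h'⟩ := mem_exclusiveColors.1 (hA hk)
    rcases h' x y hxy h with hx | hy
    · rw [Finset.mem_singleton] at hx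
      subst hx
      exact ⟨y, hAQ y hxy.symm (h ▸ hk), h⟩
    · rw [Finset.mem_singleton] at hy
      subst hy
      rw [hc] at h
      exact ⟨x, hAQ x hxy (h ▸ hk), h⟩
  have : Nonempty V := ⟨w⟩
  choose! y hyQ hy using hex
  have hyw : ∀ k ∈ A, y k ≠ w := fun k hk h => hw (h ▸ hyQ k hk)
  let H' : SimpleGraph V :=
    { Adj := fun a b => H.Adj a b ∨ (a = w ∧ ∃ k ∈ A, b = y k) ∨ (b = w ∧ ∃ k ∈ A, a = y k)
      symm := ⟨by
        rintro a b (h | h | h)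
        · exact Or.inl h.symm
        · exact Or.inr (Or.inr h)
        · exact Or.inr (Or.inl h)⟩
      loopless := ⟨by
        rintro a (h | ⟨rfl, k, hk, h⟩ | ⟨rfl, k, hk, h⟩)
        · exact H.irrefl h
        · exact hyw k hk h.symm
        · exact hyw k hk h.symm⟩ }
  have hHH' : ∀ a b, H.Adj a b → H'.Adj a b := fun a b h => Or.inl h
  have hrich : r + 2 ≤ (Q.filter (fun u => r + 1 ≤ (Q.filter (H'.Adj u)).card)).card := by
    refine hH4.trans (Finset.card_le_card ?_)
    intro u hu
    rw [Finset.mem_filter] at hu ⊢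
    refine ⟨hu.1, hu.2.trans (Finset.card_le_card ?_)⟩
    intro v hv
    rw [Finset.mem_filter] at hv ⊢
    exact ⟨hv.1, hHH' _ _ hv.2⟩
  have hham : HamConnected H' Q := by
    intro z hz z' hz' hzz
    obtain ⟨f, hf, h⟩ := hH3 z hz z' hz' hzz
    exact ⟨f, ⟨hf.1, hf.2.1, fun i hi => hHH' _ _ (hf.2.2 i hi)⟩, h⟩
  have hkind : ∀ a b, H'.Adj a b → H.Adj a b ∨ ∃ k ∈ A, c a b = k ∧ s(a, b) = s(w, y k) := by
    rintro a b (h | ⟨rfl, k, hk, rfl⟩ | ⟨rfl, k, hk, rfl⟩)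
    · exact Or.inl h
    · exact Or.inr ⟨k, hk, hy k hk, rfl⟩
    · exact Or.inr ⟨k, hk, by rw [hc, hy k hk], Sym2.eq_swap⟩
  -- A color of `A` is exclusive to `w`, which lies outside `Q`, so the old edges do not have it.
  have hno : ∀ a b k, H.Adj a b → k ∈ A → c a b ≠ k := by
    intro a b k h hk he
    obtain ⟨ha, hb, -⟩ := hH1 a b h
    rcases color_mem_exclusiveColors_singleton (he ▸ hA hk) h.ne with rfl | rfl
    · exact hw ha
    · exact hw hb
  refine ⟨H', ?_, ?_, ?_, ?_⟩
  · rintro a b (h | ⟨rfl, k, hk, rfl⟩ | ⟨rfl, k, hk, rfl⟩)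
    · obtain ⟨h1, h2, h3⟩ := hH1 a b h
      exact ⟨Finset.mem_insert_of_mem h1, Finset.mem_insert_of_mem h2,
        exclusiveColors_mono (Finset.subset_insert _ _) h3⟩
    · refine ⟨Finset.mem_insert_self _ _, Finset.mem_insert_of_mem (hyQ k hk), ?_⟩
      rw [hy k hk]
      exact exclusiveColors_mono (by simp) (hA hk)
    · refine ⟨Finset.mem_insert_of_mem (hyQ k hk), Finset.mem_insert_self _ _, ?_⟩
      rw [hc, hy k hk]
      exact exclusiveColors_mono (by simp) (hA hk)
  · intro a b a' b' h h' he
    rcases hkind a b h with h1 | ⟨k, hk, h1, h2⟩ <;> rcases hkind a' b' h' with h3 | ⟨k', hk', h3, h4⟩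
    · exact hH2 a b a' b' h1 h3 he
    · exact absurd (he.trans h3) (hno a b k' h1 hk')
    · exact absurd (he.symm.trans h1) (hno a' b' k h3 hk)
    · have : k = k' := h1.symm.trans (he.trans h3)
      subst this
      rw [h2, h4]
  · refine hham.insert_vertex hrich hw (hcard.trans ?_)
    refine Nat.add_le_add_right ?_ r
    refine Finset.card_le_card_of_injOn y ?_ ?_
    · intro k hk
      exact Finset.mem_coe.2 (Finset.mem_filter.2
        ⟨hyQ k hk, Or.inr (Or.inl ⟨rfl, k, hk, rfl⟩)⟩)
    · intro k hk k' hk' he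
      rw [← hy k hk, ← hy k' hk', he]
  · refine hrich.trans (Finset.card_le_card ?_)
    intro u hu
    rw [Finset.mem_filter] at hu ⊢
    refine ⟨Finset.mem_insert_of_mem hu.1, hu.2.trans (Finset.card_le_card fun v hv => ?_)⟩
    simp only [Finset.mem_filter] at hv ⊢
    exact ⟨Finset.mem_insert_of_mem hv.1, hv.2⟩

/-- A linked set is traversed by rainbow paths. -/
lemma IsLinked.exists_list {r : ℕ} {Q : Finset V} (h : IsLinked c r Q) {q q' : V} (hq : q ∈ Q)
    (hq' : q' ∈ Q) (hqq : q ≠ q') : ∃ l : List V, ∃ hl : l ≠ [], l.length = Q.card ∧ l.Nodup ∧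
      (∀ x ∈ l, x ∈ Q) ∧ l.head hl = q ∧ l.getLast hl = q' ∧ (edgeColors c l).Nodup ∧
      ∀ k ∈ edgeColors c l, k ∈ colorsIn c Q ∧ k ∈ exclusiveColors c Q := by
  obtain ⟨H, hH1, hH2, hH3, -⟩ := h
  obtain ⟨f, ⟨hf1, hf2, hf3⟩, hf0, hf4⟩ := hH3 q hq q' hq' hqq
  have hpos : 0 < Q.card := Finset.card_pos.2 ⟨q, hq⟩
  have hl : (List.range Q.card).map f ≠ [] :=
    List.ne_nil_of_length_pos (by simpa using hpos)
  refine ⟨(List.range Q.card).map f, hl, by simp, ?_, ?_, ?_, ?_, ?_, ?_⟩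
  · rw [List.nodup_map_iff_inj_on List.nodup_range]
    intro a ha b hb hab
    exact hf1 (List.mem_range.1 ha) (List.mem_range.1 hb) hab
  · intro x hx
    obtain ⟨i, hi, rfl⟩ := List.mem_map.1 hx
    exact hf2 i (List.mem_range.1 hi)
  · rw [List.head_eq_getElem]; simp [hf0]
  · rw [List.getLast_eq_getElem]; simp [hf4]
  · rw [List.nodup_iff_injective_getElem]
    rintro ⟨i, hi⟩ ⟨j, hj⟩ hij
    rw [length_edgeColors] at hi hj
    simp only [List.length_map, List.length_range] at hi hj
    dsimp only at hij
    rw [getElem_edgeColors _ _ (by simp; omega), getElem_edgeColors _ _ (by simp; omega)] at hij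
    simp only [List.getElem_map, List.getElem_range] at hij
    have := hH2 _ _ _ _ (hf3 i (by omega)) (hf3 j (by omega)) hij
    have inj : ∀ a b, a < Q.card → b < Q.card → f a = f b → a = b :=
      fun a b h h' h'' => hf1 h h' h''
    rcases Sym2.eq_iff.1 this with ⟨h1, -⟩ | ⟨h1, h2⟩
    · have := inj _ _ (by omega) (by omega) h1
      simpa using this
    · have := inj _ _ (by omega) (by omega) h1
      have := inj _ _ (by omega) (by omega) h2
      omega
  · intro k hk
    obtain ⟨i, hi, rfl⟩ := mem_edgeColors hk
    simp only [List.length_map, List.length_range] at hi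
    simp only [List.getElem_map, List.getElem_range]
    have hadj := hf3 i hi
    obtain ⟨h1, h2, h3⟩ := hH1 _ _ hadj
    exact ⟨mem_colorsIn.2 ⟨_, h1, _, h2, hadj.ne, rfl⟩, h3⟩

/-- A rainbow path outside `Q`, listed from its last vertex to its first vertex `x`, in which each
edge has an exclusive color of its vertex closer to `x`. -/
structure IsTail (c : V → V → K) (Q : Finset V) (x' : V) (l : List V) : Prop where
  nodup : l.Nodup
  notMem : ∀ y ∈ l, y ∉ Q ∧ y ≠ x'
  colors_nodup : (edgeColors c l).Nodup
  exclusive : ∀ k ∈ edgeColors c l, k ∉ exclusiveColors c Q ∧ ∃ v ∈ l.tail,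
    k ∈ exclusiveColors c {v}

lemma notMem_exclusiveColors {Q : Finset V} {x y : V} (hx : x ∉ Q) (hy : y ∉ Q) (hxy : x ≠ y) :
    c x y ∉ exclusiveColors c Q := by
  intro h
  rcases (mem_exclusiveColors.1 h).2 x y hxy rfl with h | h
  · exact hx h
  · exact hy h

/-- Every tail color is exclusive to a tail vertex other than the head, and an edge from outside the
tail to the head misses those vertices. This serves both to prolong the tail and to close the cycle.
-/
lemma IsTail.closing_notMem {Q : Finset V} {x' : V} {l : List V} (hl : IsTail c Q x' l)
    (hne : l ≠ []) {y : V} (hy : y ∉ l) : c y (l.head hne) ∉ edgeColors c l := by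
  intro hk
  obtain ⟨-, v, hv, h⟩ := hl.exclusive _ hk
  have hhead : l.head hne ∉ l.tail := by
    have := hl.nodup
    rw [← List.cons_head_tail hne, List.nodup_cons] at this
    exact this.1
  have hyh : y ≠ l.head hne := fun e => hy (e ▸ List.head_mem hne)
  rcases color_mem_exclusiveColors_singleton h hyh with rfl | rfl
  · exact hy (List.mem_of_mem_tail hv)
  · exact hhead hv

/-- A tail from `x` and a vertex `x'` are joined by a rainbow path through a linked set `Q`;
together they give a rainbow cycle. -/
lemma IsLinked.exists_rainbowCycle {r : ℕ} {Q : Finset V}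
    (hQ : IsLinked c r Q) {q q' x' : V} (hq : q ∈ Q) (hq' : q' ∈ Q) (hqq : q ≠ q')
    (hx' : x' ∉ Q) {l : List V} (hne : l ≠ []) (hl : IsTail c Q x' l)
    (h1 : c (l.getLast hne) q ∈ exclusiveColors c Q) (h2 : c (l.getLast hne) q ∉ colorsIn c Q)
    (h3 : c q' x' ∈ exclusiveColors c Q) (h4 : c q' x' ∉ colorsIn c Q)
    (h5 : c (l.getLast hne) q ≠ c q' x') :
    ∃ f, RainbowCycle c (l.length + Q.card + 1) f := by
  obtain ⟨m, hm, hmlen, hmnd, hmQ, hmh, hml, hmc, hmk⟩ := hQ.exists_list hq hq' hqq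
  have hne1 : m ++ [x'] ≠ [] := by simp
  have hne2 : l ++ (m ++ [x']) ≠ [] := by simp
  have hcol : edgeColors c (l ++ (m ++ [x'])) = edgeColors c l ++
      c (l.getLast hne) q :: (edgeColors c m ++ [c q' x']) := by
    rw [edgeColors_append hne hne1, edgeColors_append hm (by simp)]
    simp [List.head_append_of_ne_nil hm, hmh, hml, edgeColors]
  have hhead : l.head hne ∈ l := List.head_mem hne
  have hout := hl.notMem _ hhead
  have hclose : c x' (l.head hne) ∉ exclusiveColors c Q :=
    notMem_exclusiveColors hx' hout.1 hout.2.symm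
  have := rainbowCycle_of_list (c := c) hne2 ?_ ?_ ?_
  · simpa [hmlen, add_assoc] using this
  · rw [List.nodup_append, List.nodup_append]
    refine ⟨hl.nodup, ⟨hmnd, by simp, ?_⟩, ?_⟩
    · rintro a ha b hb rfl
      rw [List.mem_singleton] at hb
      exact hx' (hb ▸ hmQ a ha)
    · rintro a ha b hb rfl
      rcases List.mem_append.1 hb with h | h
      · exact (hl.notMem a ha).1 (hmQ a h)
      · exact (hl.notMem a ha).2 (List.mem_singleton.1 h)
  -- Three kinds of colors are kept apart: tail colors are not exclusive to `Q`, colors of the path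
  -- in `Q` are exclusive and occur inside `Q`, and the two link colors are exclusive but do not
  -- occur inside `Q`.
  · rw [hcol, List.nodup_append, List.nodup_cons, List.nodup_append]
    refine ⟨hl.colors_nodup, ⟨?_, hmc, by simp, ?_⟩, ?_⟩
    · rw [List.mem_append, List.mem_singleton]
      rintro (h | h)
      · exact h2 (hmk _ h).1
      · exact h5 h
    · rintro a ha b hb rfl
      rw [List.mem_singleton] at hb
      exact h4 (hb ▸ (hmk a ha).1)
    · rintro a ha b hb rfl
      apply (hl.exclusive a ha).1
      rcases List.mem_cons.1 hb with rfl | hb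
      · exact h1
      rcases List.mem_append.1 hb with hb | hb
      · exact (hmk a hb).2
      · exact (List.mem_singleton.1 hb) ▸ h3
  · have e1 : (l ++ (m ++ [x'])).getLast hne2 = x' := by simp
    have e2 : (l ++ (m ++ [x'])).head hne2 = l.head hne := List.head_append_of_ne_nil hne
    rw [e1, e2, hcol, List.mem_append, List.mem_cons, List.mem_append, List.mem_singleton]
    rintro (h | h | h | h)
    · exact hl.closing_notMem hne (fun hmem => (hl.notMem _ hmem).2 rfl) h
    · exact hclose (h ▸ h1)
    · exact hclose (hmk _ h).2
    · exact hclose (h ▸ h3)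

/-- The case in which the two edges leaving `Q` end in the same vertex. -/
lemma IsLinked.exists_rainbowCycle_insert (hc : ∀ x y, c x y = c y x) {r : ℕ} {Q : Finset V}
    (hQ : IsLinked c r Q) {q q' x : V} (hq : q ∈ Q) (hq' : q' ∈ Q) (hqq : q ≠ q')
    (hx : x ∉ Q) (h2 : c q x ∉ colorsIn c Q) (h4 : c q' x ∉ colorsIn c Q)
    (h5 : c q x ≠ c q' x) : ∃ f, RainbowCycle c (Q.card + 1) f := by
  obtain ⟨m, hm, hmlen, hmnd, hmQ, hmh, hml, hmc, hmk⟩ := hQ.exists_list hq hq' hqq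
  have hne1 : m ++ [x] ≠ [] := by simp
  have hcol : edgeColors c (m ++ [x]) = edgeColors c m ++ [c q' x] := by
    rw [edgeColors_append hm (by simp)]
    simp [hml, edgeColors]
  have := rainbowCycle_of_list (c := c) hne1 ?_ ?_ ?_
  · simpa [hmlen] using this
  · rw [List.nodup_append]
    refine ⟨hmnd, by simp, ?_⟩
    rintro a ha b hb rfl
    rw [List.mem_singleton] at hb
    exact hx (hb ▸ hmQ a ha)
  · rw [hcol, List.nodup_append]
    refine ⟨hmc, by simp, ?_⟩
    rintro a ha b hb rfl
    rw [List.mem_singleton] at hb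
    exact h4 (hb ▸ (hmk a ha).1)
  · have e1 : (m ++ [x]).getLast hne1 = x := by simp
    have e2 : (m ++ [x]).head hne1 = q := by rw [List.head_append_of_ne_nil hm, hmh]
    rw [e1, e2, hcol, List.mem_append, List.mem_singleton, hc x q]
    rintro (h | h)
    · exact h2 (hmk _ h).1
    · exact h5 h

end Linked

lemma two_mul_choose_two (n : ℕ) : 2 * n.choose 2 = n * (n - 1) := by
  rw [Nat.choose_two_right]
  exact Nat.mul_div_cancel' (Nat.even_mul_pred_self n).two_dvd

/-! ### Forbidden cycles in a minimal coloring. -/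

section Existence

variable {V K : Type*} [Fintype V] [DecidableEq V] [DecidableEq K] {c : V → V → K}

/-- If every vertex has many exclusive colors, then there is a short rainbow cycle or a
linked set. -/
lemma exists_isLinked [Nonempty V] (hc : ∀ x y, c x y = c y x) {r : ℕ} (hr : 2 ≤ r)
    (hdeg : ∀ v, r + 1 ≤ (exclusiveColors c {v}).card)
    (hno1 : ∀ f, ¬ RainbowCycle c (2 * r + 1) f) (hno2 : ∀ f, ¬ RainbowCycle c (2 * r + 2) f) :
    ∃ Q : Finset V, IsLinked c r Q ∧ Q.card ≤ 2 * r := by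
  classical
  -- One representative edge per color makes the underlying graph of `R` rainbow. A color exclusive
  -- to `v` has its representative at `v`, so no out-degree is lost.
  obtain ⟨e, he⟩ : ∃ e : K → V × V, ∀ k ∈ colorsIn c Finset.univ,
      (e k).1 ≠ (e k).2 ∧ c (e k).1 (e k).2 = k := by
    have : ∀ k ∈ colorsIn c Finset.univ, ∃ p : V × V, p.1 ≠ p.2 ∧ c p.1 p.2 = k := by
      intro k hk
      obtain ⟨x, -, y, -, h⟩ := mem_colorsIn.1 hk
      exact ⟨(x, y), h⟩
    choose! e he using this
    exact ⟨e, he⟩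
  let R : V → V → Prop := fun v w => v ≠ w ∧ c v w ∈ exclusiveColors c {v} ∧
    s((e (c v w)).1, (e (c v w)).2) = s(v, w)
  have hR : ∀ v w, R v w → v ≠ w ∧ c v w ∈ exclusiveColors c {v} ∧
    s((e (c v w)).1, (e (c v w)).2) = s(v, w) := fun v w h => h
  have hsym : ∀ a b, (R a b ∨ R b a) → a ≠ b ∧ s((e (c a b)).1, (e (c a b)).2) = s(a, b) := by
    rintro a b (h | h)
    · exact ⟨h.1, h.2.2⟩
    · obtain ⟨h1, -, h3⟩ := h
      rw [hc a b, h3]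
      exact ⟨h1.symm, Sym2.eq_swap⟩
  have hrain : ∀ a b a' b', (R a b ∨ R b a) → (R a' b' ∨ R b' a') → c a b = c a' b' →
      s(a, b) = s(a', b') := by
    intro a b a' b' h h' heq
    rw [← (hsym a b h).2, ← (hsym a' b' h').2, heq]
  have hpath : ∀ n f, SymPath R n f → ∀ i j, i + 1 < n → j + 1 < n →
      c (f i) (f (i + 1)) = c (f j) (f (j + 1)) → i = j := by
    intro n f hf i j hi hj hij
    have inj : ∀ a b, a < n → b < n → f a = f b → a = b := fun a b h h' h'' => hf.1 h h' h''
    rcases Sym2.eq_iff.1 (hrain _ _ _ _ (hf.2 i hi) (hf.2 j hj) hij) with ⟨h1, -⟩ | ⟨h1, h2⟩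
    · exact inj _ _ (by omega) (by omega) h1
    · have := inj _ _ (by omega) (by omega) h1
      have := inj _ _ (by omega) (by omega) h2
      omega
  -- The edge joining the two ends of an inward path contains no inner vertex, so it has none of the
  -- path's colors, each of which is exclusive to an inner vertex.
  have hinw : ∀ n f, InwardPath R n f → RainbowCycle c n f := by
    intro n f hf
    refine rainbowCycle_of_path hf.1 (hpath n f hf.symPath) ?_
    intro i hi heq
    have inj : ∀ a b, a < n → b < n → f a = f b → a = b := fun a b h h' h'' => hf.1 h h' h''
    obtain ⟨m, hm1, hm2, hm⟩ : ∃ m, 1 ≤ m ∧ m + 1 < n ∧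
        c (f i) (f (i + 1)) ∈ exclusiveColors c {f m} := by
      rcases hf.2 i hi with ⟨h1, h2⟩ | ⟨h1, h2⟩
      · exact ⟨i, h1, hi, h2.2.1⟩
      · refine ⟨i + 1, by omega, by omega, ?_⟩
        rw [hc]; exact h2.2.1
    rw [← heq] at hm
    have hne : f (n - 1) ≠ f 0 := fun h => by
      have := inj _ _ (by omega) (by omega) h
      omega
    rcases color_mem_exclusiveColors_singleton hm hne with h | h
    · have := inj _ _ (by omega) (by omega) h
      omega
    · have := inj _ _ (by omega) (by omega) h
      omega
  have hcyc : ∀ f, SymCycle R (2 * r + 1) f → RainbowCycle c (2 * r + 1) f := by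
    intro f hf
    refine rainbowCycle_of_path hf.1.1 (hpath _ f hf.1) ?_
    intro i hi heq
    have inj : ∀ a b, a < 2 * r + 1 → b < 2 * r + 1 → f a = f b → a = b :=
      fun a b h h' h'' => hf.1.1 h h' h''
    rcases Sym2.eq_iff.1 (hrain _ _ _ _ hf.2.symm (hf.1.2 i hi) heq) with ⟨h1, h2⟩ | ⟨h1, h2⟩
    · have := inj _ _ (by omega) (by omega) h1
      omega
    · have := inj _ _ (by omega) (by omega) h1
      have := inj _ _ (by omega) (by omega) h2
      omega
  have hRdeg : ∀ v, r + 1 ≤ (Finset.univ.filter (R v)).card := by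
    intro v
    refine (hdeg v).trans ((Finset.card_le_card ?_).trans
      (Finset.card_image_le (s := Finset.univ.filter (R v)) (f := c v)))
    intro k hk
    obtain ⟨h1, h2⟩ := he k (Finset.mem_sdiff.1 hk).1
    have h3 : c (e k).1 (e k).2 ∈ exclusiveColors c {v} := by rw [h2]; exact hk
    rcases color_mem_exclusiveColors_singleton h3 h1 with h | h
    · refine Finset.mem_image.2 ⟨(e k).2, Finset.mem_filter.2 ⟨Finset.mem_univ _, ?_⟩, ?_⟩
      · subst h
        refine ⟨h1, h3, ?_⟩
        rw [h2]
      · rw [← h, h2]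
    · refine Finset.mem_image.2 ⟨(e k).1, Finset.mem_filter.2 ⟨Finset.mem_univ _, ?_⟩, ?_⟩
      · subst h
        rw [hc] at h2 h3
        refine ⟨h1.symm, h3, ?_⟩
        rw [h2]
        exact Sym2.eq_swap
      · rw [← h, hc, h2]
  obtain ⟨Q, hQne, hQcard, hQcl⟩ := exists_small_closed (R := R) (fun v h => h.1 rfl) hr hRdeg
    (fun f h => hno1 f (hinw _ f h)) (fun f h => hno2 f (hinw _ f h))
    (fun f h => hno1 f (hcyc f h))
  let H : SimpleGraph V :=
    { Adj := fun a b => a ∈ Q ∧ b ∈ Q ∧ (R a b ∨ R b a)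
      symm := ⟨fun a b h => ⟨h.2.1, h.1, h.2.2.symm⟩⟩
      loopless := ⟨fun a h => (h.2.2.elim (fun h => h.1 rfl) (fun h => h.1 rfl))⟩ }
  have hHdeg : ∀ a ∈ Q, r + 1 ≤ (Q.filter (H.Adj a)).card := by
    intro a ha
    refine (hRdeg a).trans (Finset.card_le_card fun w hw => ?_)
    have hw' : R a w := (Finset.mem_filter.1 hw).2
    have hwQ := hQcl a ha w hw'
    exact Finset.mem_filter.2 ⟨hwQ, ha, hwQ, Or.inl hw'⟩
  have hrQ : r + 2 ≤ Q.card := by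
    obtain ⟨a, ha⟩ := hQne
    have h1 : (Q.filter (H.Adj a)).card ≤ (Q.erase a).card := by
      refine Finset.card_le_card fun w hw => ?_
      rw [Finset.mem_filter] at hw
      exact Finset.mem_erase.2 ⟨hw.2.ne.symm, hw.1⟩
    rw [Finset.card_erase_of_mem ha] at h1
    have := hHdeg a ha
    omega
  refine ⟨Q, ⟨H, ?_, ?_, ?_, ?_⟩, hQcard⟩
  · rintro a b ⟨ha, hb, h | h⟩
    · exact ⟨ha, hb, exclusiveColors_mono (Finset.singleton_subset_iff.2 ha) h.2.1⟩
    · refine ⟨ha, hb, exclusiveColors_mono (Finset.singleton_subset_iff.2 hb) ?_⟩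
      rw [hc]; exact h.2.1
  · rintro a b a' b' ⟨-, -, h⟩ ⟨-, -, h'⟩ heq
    exact hrain a b a' b' h h' heq
  · exact hamConnected_of_degree hQcard H (fun a ha => by convert hHdeg a ha)
  · refine hrQ.trans (Finset.card_le_card fun u hu => ?_)
    simp only [Finset.mem_filter]
    exact ⟨hu, by convert hHdeg u hu⟩

/-- A coloring with many colors that is minimal with this property has a rainbow cycle of
length `2r+1` or `2r+2`. -/
lemma exists_rainbowCycle_of_minimal (hc : ∀ x y, c x y = c y x) {r : ℕ} (hr : 2 ≤ r)
    (hbig : r * (Fintype.card V - 1) + 1 ≤ (colorsIn c Finset.univ).card)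
    (hsmall : ∀ U : Finset V, U.Nonempty → U ≠ Finset.univ →
      (colorsIn c U).card ≤ r * (U.card - 1)) :
    ∃ f, RainbowCycle c (2 * r + 1) f ∨ RainbowCycle c (2 * r + 2) f := by
  classical
  by_contra hcon
  push Not at hcon
  have hno1 : ∀ f, ¬ RainbowCycle c (2 * r + 1) f := fun f => (hcon f).1
  have hno2 : ∀ f, ¬ RainbowCycle c (2 * r + 2) f := fun f => (hcon f).2
  -- On at most `2r` vertices there are only `n (n - 1) / 2 ≤ r (n - 1)` edges.
  have hV : 2 * r + 1 ≤ Fintype.card V := by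
    by_contra hlt
    have h1 := hbig.trans (card_colorsIn_le hc _)
    rw [Finset.card_univ] at h1
    have h2 := two_mul_choose_two (Fintype.card V)
    have h3 := Nat.mul_le_mul_right (Fintype.card V - 1) (show Fintype.card V ≤ 2 * r by omega)
    rw [mul_assoc] at h3
    omega
  have : Nonempty V := Fintype.card_pos_iff.1 (by omega)
  -- By minimality the complement of `Q` carries at most `r (n - |Q| - 1)` colors.
  have hexcl : ∀ Q : Finset V, Q.Nonempty → Q.card ≤ 2 * r →
      r * Q.card + 1 ≤ (exclusiveColors c Q).card := by
    intro Q hQ hcard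
    have h1 := Finset.le_card_sdiff (colorsIn c Qᶜ) (colorsIn c Finset.univ)
    have h2 := hsmall Qᶜ (Finset.card_pos.1 (by rw [Finset.card_compl]; omega))
      (fun h => hQ.ne_empty ((compl_eq_top).1 h))
    rw [Finset.card_compl] at h2
    have h3 : r * (Fintype.card V - 1) = r * (Fintype.card V - Q.card - 1) + r * Q.card := by
      rw [← mul_add]; congr 1; omega
    rw [exclusiveColors]
    omega
  have hlink : ∃ Q : Finset V, IsLinked c r Q ∧ Q.card ≤ 2 * r :=
    exists_isLinked hc hr (fun v => by
      have h1 := hexcl {v} (Finset.singleton_nonempty v) (by simp; omega)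
      simpa using h1) hno1 hno2
  obtain ⟨Q, hQ, hQcard, hQmax⟩ : ∃ Q : Finset V, IsLinked c r Q ∧ Q.card ≤ 2 * r ∧
      ∀ Q', IsLinked c r Q' → Q'.card ≤ 2 * r → Q'.card ≤ Q.card := by
    obtain ⟨Q, hQ, hmax⟩ := Finset.exists_max_image
      (Finset.univ.filter fun Q : Finset V => IsLinked c r Q ∧ Q.card ≤ 2 * r) Finset.card
      (by obtain ⟨Q, hQ⟩ := hlink; exact ⟨Q, by simpa using hQ⟩)
    simp only [Finset.mem_filter, Finset.mem_univ, true_and] at hQ hmax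
    exact ⟨Q, hQ.1, hQ.2, fun Q' h1 h2 => hmax Q' ⟨h1, h2⟩⟩
  have hsr := hQ.le_card
  set s := Q.card with hs
  -- `S` has more exclusive colors than `P` has edges, so one of them appears only on edges that
  -- leave `P`.
  have hleave : ∀ S P : Finset V, S.Nonempty → S ⊆ Q → Q ⊆ P →
      (P.card.choose 2) < r * S.card + 1 →
      ∃ q ∈ S, ∃ x, x ∉ P ∧ c q x ∈ exclusiveColors c S ∧ c q x ∉ colorsIn c P := by
    intro S P hS hSQ hQP hlt
    have h1 := hexcl S hS ((Finset.card_le_card hSQ).trans hQcard)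
    have h2 := card_colorsIn_le hc P
    obtain ⟨k, hk, hk'⟩ := Finset.exists_mem_notMem_of_card_lt_card
      (show (colorsIn c P).card < (exclusiveColors c S).card by omega)
    obtain ⟨q, hq, x, hx, rfl⟩ := exists_leaving_edge hc hk (hSQ.trans hQP) hk'
    exact ⟨q, hq, x, hx, hk, hk'⟩
  have hQne : Q.Nonempty := Finset.card_pos.1 (by omega)
  obtain ⟨q1, hq1, x1, hx1, hg1, hg1'⟩ := hleave Q Q hQne subset_rfl subset_rfl (by
    have h1 := two_mul_choose_two s
    have h2 := Nat.mul_le_mul_left s (show s - 1 ≤ 2 * r by omega)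
    rw [← hs]
    nlinarith)
  -- Removing `q1` makes the second edge start elsewhere and have another color: the edge from `q1`
  -- to `x1` does not meet `Q.erase q1`. The count is `s (s - 1) / 2 ≤ r (s - 1)`.
  obtain ⟨q2, hq2, x2, hx2, hg2, hg2'⟩ := hleave (Q.erase q1) Q
    (Finset.card_pos.1 (by rw [Finset.card_erase_of_mem hq1]; omega))
    (Finset.erase_subset _ _) subset_rfl (by
    have h1 := two_mul_choose_two s
    have h2 := Nat.mul_le_mul_right (s - 1) hQcard
    rw [Finset.card_erase_of_mem hq1, ← hs]
    nlinarith)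
  have hq21 : q2 ≠ q1 := (Finset.mem_erase.1 hq2).1
  have hq2Q : q2 ∈ Q := (Finset.mem_erase.1 hq2).2
  have hg12 : c q1 x1 ≠ c q2 x2 := by
    intro h
    rw [← h] at hg2
    have hne : q1 ≠ x1 := fun e => hx1 (e ▸ hq1)
    rcases (mem_exclusiveColors.1 hg2).2 q1 x1 hne rfl with h | h
    · simp at h
    · exact hx1 (Finset.mem_of_mem_erase h)
  have hg2Q : c q2 x2 ∈ exclusiveColors c Q :=
    exclusiveColors_mono (Finset.erase_subset _ _) hg2
  have hsingle : ∀ x x', x ∉ Q → x ≠ x' → IsTail c Q x' [x] := by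
    intro x x' hx hxx
    exact ⟨by simp, by simpa using ⟨hx, hxx⟩, by simp [edgeColors], by simp [edgeColors]⟩
  rcases Nat.lt_or_ge s (2 * r) with hlt | hge
  swap
  · have hs2 : s = 2 * r := by omega
    by_cases hxx : x1 = x2
    · subst hxx
      obtain ⟨f, hf⟩ := hQ.exists_rainbowCycle_insert hc hq1 hq2Q hq21.symm hx1 hg1' hg2' hg12
      rw [← hs, hs2] at hf
      exact hno1 f hf
    · obtain ⟨f, hf⟩ := hQ.exists_rainbowCycle hq1 hq2Q hq21.symm hx2
        (List.cons_ne_nil x1 []) (hsingle x1 x2 hx1 hxx) (by rw [hc]; exact hg1)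
        (by rw [hc]; exact hg1') hg2Q hg2' (by rw [hc]; exact hg12)
      rw [← hs, hs2, List.length_singleton, show 1 + 2 * r + 1 = 2 * r + 2 by omega] at hf
      exact hno2 f hf
  obtain ⟨q, hq, q', hq', hqq, x, hx, x', hx', hxx, h1, h2, h3, h4, h5⟩ :
      ∃ q ∈ Q, ∃ q' ∈ Q, q ≠ q' ∧ ∃ x, x ∉ Q ∧ ∃ x', x' ∉ Q ∧ x ≠ x' ∧
        c q x ∈ exclusiveColors c Q ∧ c q x ∉ colorsIn c Q ∧
        c q' x' ∈ exclusiveColors c Q ∧ c q' x' ∉ colorsIn c Q ∧ c q x ≠ c q' x' := by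
    by_cases hxx : x1 = x2
    · subst hxx
      have hci := Finset.card_insert_of_notMem hx1
      -- A third edge ending away from `x1`. This needs `s (s + 1) / 2 ≤ r s`, hence `s < 2r`; its
      -- color differs from that of every edge from `Q` to `x1`.
      obtain ⟨q3, hq3, x3, hx3, hg3, hg3'⟩ := hleave Q (insert x1 Q) hQne subset_rfl
        (Finset.subset_insert _ _) (by
        have h1 := two_mul_choose_two (s + 1)
        have h2 := Nat.mul_le_mul_right s (show s + 1 ≤ 2 * r by omega)
        rw [Nat.add_sub_cancel] at h1
        rw [hci, ← hs]
        nlinarith)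
      rw [Finset.mem_insert, not_or] at hx3
      have hg3Q : c q3 x3 ∉ colorsIn c Q :=
        fun h => hg3' (colorsIn_mono (Finset.subset_insert _ _) h)
      have hne : ∀ q ∈ Q, c q x1 ≠ c q3 x3 := by
        intro q hq he
        refine hg3' (mem_colorsIn.2 ⟨q, Finset.mem_insert_of_mem hq, x1,
          Finset.mem_insert_self _ _, fun e => hx1 (e ▸ hq), he⟩)
      by_cases hq31 : q3 = q1
      · subst hq31
        exact ⟨q2, hq2Q, q3, hq3, hq21, x1, hx1, x3, hx3.2, Ne.symm hx3.1, hg2Q, hg2', hg3, hg3Q,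
          hne q2 hq2Q⟩
      · exact ⟨q1, hq1, q3, hq3, Ne.symm hq31, x1, hx1, x3, hx3.2, Ne.symm hx3.1, hg1, hg1', hg3,
          hg3Q, hne q1 hq1⟩
    · exact ⟨q1, hq1, q2, hq2Q, hq21.symm, x1, hx1, x2, hx2, hxx, hg1, hg1', hg2Q, hg2', hg12⟩
  -- A tail on `2r - s` vertices is needed: with `Q` and `x'` it makes a cycle of length `2r + 1`.
  have htail : ∀ i, i ≤ 2 * r - 1 - s → ∃ l : List V, ∃ hne : l ≠ [], IsTail c Q x' l ∧
      l.length = i + 1 ∧ l.getLast hne = x := by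
    intro i
    induction i with
    | zero => exact fun _ => ⟨[x], by simp, hsingle x x' hx hxx, rfl, rfl⟩
    | succ i ih =>
      intro hi
      obtain ⟨l, hne, hl, hlen, hlast⟩ := ih (by omega)
      set w := l.head hne with hw
      have hwl : w ∈ l := List.head_mem hne
      have hwQ := hl.notMem w hwl
      by_cases hstep : ∃ y, y ≠ w ∧ y ∉ Q ∧ y ≠ x' ∧ y ∉ l ∧ c y w ∈ exclusiveColors c {w}
      · obtain ⟨y, hyw, hyQ, hyx, hyl, hyk⟩ := hstep
        obtain ⟨b, l', rfl⟩ := List.exists_cons_of_ne_nil hne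
        have hwb : w = b := rfl
        refine ⟨y :: b :: l', by simp, ⟨?_, ?_, ?_, ?_⟩, by simp [hlen], ?_⟩
        · exact List.nodup_cons.2 ⟨hyl, hl.nodup⟩
        · intro z hz
          rcases List.mem_cons.1 hz with rfl | hz
          · exact ⟨hyQ, hyx⟩
          · exact hl.notMem z hz
        · simp only [edgeColors]
          exact List.nodup_cons.2 ⟨hl.closing_notMem hne hyl, hl.colors_nodup⟩
        · intro k hk
          simp only [edgeColors] at hk
          rcases List.mem_cons.1 hk with rfl | hk
          · exact ⟨notMem_exclusiveColors hyQ hwQ.1 hyw, w, by simp [hwb], hyk⟩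
          · obtain ⟨h1, v, hv, h2⟩ := hl.exclusive k hk
            exact ⟨h1, v, List.mem_of_mem_tail hv, h2⟩
        · rw [List.getLast_cons hne]; exact hlast
      · exfalso
        push Not at hstep
        -- A stuck end `w` sends its exclusive colors only to `T` and `Q`. At least `r + 1 - (i +
        -- 1)` of them avoid `T`, which suffices to add `w` to `Q`, against the maximality of `Q`.
        set T := (insert x' l.toFinset).erase w with hT
        set A := (exclusiveColors c {w}) \ T.image (c w) with hA
        have hTcard : T.card ≤ i + 1 := by
          rw [hT, Finset.card_erase_of_mem (by simp [hwl])]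
          have h1 := Finset.card_insert_le x' l.toFinset
          have h2 := l.toFinset_card_le
          omega
        have hAcard : r ≤ A.card + i := by
          have h1 := Finset.le_card_sdiff (T.image (c w)) (exclusiveColors c {w})
          have h2 : (T.image (c w)).card ≤ T.card := Finset.card_image_le
          have h3 := hexcl {w} (Finset.singleton_nonempty w) (by simp; omega)
          rw [Finset.card_singleton, mul_one] at h3
          rw [hA]
          omega
        have hlinked := hQ.insert_vertex hc hwQ.1 (A := A) Finset.sdiff_subset ?_ (by omega)
        · have h1 := hQmax _ hlinked (by
            rw [Finset.card_insert_of_notMem hwQ.1]; omega)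
          rw [Finset.card_insert_of_notMem hwQ.1] at h1
          omega
        · intro y hyw hyA
          by_contra hyQ
          rw [hA, Finset.mem_sdiff] at hyA
          have hyT : y ∉ T := fun h => hyA.2 (Finset.mem_image_of_mem _ h)
          have hyT' : y ≠ x' ∧ y ∉ l := by
            constructor
            · rintro rfl; exact hyT (by simp [hT, hyw])
            · intro h; exact hyT (by simp [hT, hyw, h])
          refine hstep y hyw hyQ hyT'.1 hyT'.2 ?_
          rw [hc]; exact hyA.1
  obtain ⟨l, hne, hl, hlen, hlast⟩ := htail _ le_rfl
  obtain ⟨f, hf⟩ := hQ.exists_rainbowCycle hq hq' hqq hx' hne hl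
    (by rw [hlast, hc]; exact h1) (by rw [hlast, hc]; exact h2) h3 h4
    (by rw [hlast, hc]; exact h5)
  rw [hlen, ← hs, show 2 * r - 1 - s + 1 + s + 1 = 2 * r + 1 by omega] at hf
  exact hno1 f hf

end Existence

/-! ### The color bound without a rainbow member of the family. -/

section AntiRamsey

variable {V K : Type*} [Fintype V] [DecidableEq V] [DecidableEq K] {c : V → V → K}

/-- A coloring with more than `r (n - 1)` colors has a rainbow cycle of length `2r+1` or
`2r+2`. -/
theorem exists_rainbowCycle_of_card_colors [Nonempty V] (hc : ∀ x y, c x y = c y x) {r : ℕ}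
    (hr : 2 ≤ r) (hbig : r * (Fintype.card V - 1) + 1 ≤ (colorsIn c Finset.univ).card) :
    ∃ f, RainbowCycle c (2 * r + 1) f ∨ RainbowCycle c (2 * r + 2) f := by
  classical
  -- A smallest vertex set `U` with more than `r (|U| - 1)` colors satisfies the minimality
  -- hypothesis.
  obtain ⟨U, hU, hmin⟩ := Finset.exists_min_image
    (Finset.univ.filter fun U : Finset V => U.Nonempty ∧ r * (U.card - 1) + 1 ≤
      (colorsIn c U).card) Finset.card
    ⟨Finset.univ, Finset.mem_filter.2 ⟨Finset.mem_univ _, Finset.univ_nonempty, hbig⟩⟩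
  simp only [Finset.mem_filter, Finset.mem_univ, true_and] at hU hmin
  let c' : U → U → K := fun x y => c x y
  have hcol : ∀ S : Finset U, colorsIn c' S = colorsIn c (S.map (Function.Embedding.subtype _)) := by
    intro S
    ext k
    rw [mem_colorsIn, mem_colorsIn]
    constructor
    · rintro ⟨x, hx, y, hy, hxy, h⟩
      exact ⟨x, Finset.mem_map_of_mem _ hx, y, Finset.mem_map_of_mem _ hy,
        fun e => hxy (Subtype.ext e), h⟩
    · rintro ⟨x, hx, y, hy, hxy, h⟩
      obtain ⟨x, hx', rfl⟩ := Finset.mem_map.1 hx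
      obtain ⟨y, hy', rfl⟩ := Finset.mem_map.1 hy
      exact ⟨x, hx', y, hy', fun e => hxy (by rw [e]), h⟩
  have huniv : (Finset.univ : Finset U).map (Function.Embedding.subtype _) = U := by
    ext x; simp
  obtain ⟨f, hf⟩ := exists_rainbowCycle_of_minimal (c := c') (fun x y => hc x y) hr (by
    rw [hcol, huniv, Fintype.card_coe]; exact hU.2) (by
    intro S hS hne
    by_contra hlt
    have h1 := hmin (S.map (Function.Embedding.subtype _)) ⟨hS.map, by
      rw [← hcol, Finset.card_map]; omega⟩
    rw [Finset.card_map] at h1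
    apply hne
    apply Finset.eq_univ_of_card
    have := Finset.card_le_univ S
    rw [Fintype.card_coe] at this ⊢
    omega)
  have hmap : ∀ N, RainbowCycle c' N f → RainbowCycle c N (fun i => (f i : V)) := by
    intro N h
    exact ⟨fun i hi j hj hij => h.1 hi hj (Subtype.ext hij), h.2⟩
  exact ⟨fun i => (f i : V), hf.imp (hmap _) (hmap _)⟩

omit [Fintype V] [DecidableEq V] [DecidableEq K] in
lemma RainbowCycle.rotate {N : ℕ} {f : ℕ → V} (h : RainbowCycle c N f) (k : ℕ) :
    RainbowCycle c N (fun j => f ((k + j) % N)) := by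
  have hmod : ∀ i j, i < N → j < N → (k + i) % N = (k + j) % N → i = j := by
    intro i j hi hj hij
    exact Nat.ModEq.eq_of_lt_of_lt (Nat.ModEq.add_left_cancel' k hij) hi hj
  refine ⟨fun i hi j hj hij => ?_, fun i hi j hj hij => ?_⟩
  · simp only [Set.mem_Iio] at hi hj
    exact hmod i j hi hj (h.1 (Nat.mod_lt _ (by omega)) (Nat.mod_lt _ (by omega)) hij)
  · simp only [Set.mem_Iio] at hi hj
    have e : ∀ i, (k + (i + 1) % N) % N = ((k + i) % N + 1) % N := by
      intro i; rw [Nat.add_mod_mod, Nat.mod_add_mod, add_assoc]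
    dsimp only at hij
    rw [e, e] at hij
    exact hmod i j hi hj (h.2 (Nat.mod_lt _ (by omega)) (Nat.mod_lt _ (by omega)) hij)

omit [Fintype V] [DecidableEq V] [DecidableEq K] in
-- The closing edge of the cycle is replaced by the path through `x`.
lemma RainbowCycle.insert_vertex (hc : ∀ x y, c x y = c y x) {N : ℕ} (hN : 2 ≤ N) {f : ℕ → V}
    (h : RainbowCycle c N f) {x : V} (hx : ∀ i < N, f i ≠ x)
    (h0 : ∀ i j, i < N → j < N → i ≠ j → c (f i) (f j) ≠ c x (f 0))
    (h1 : ∀ i j, i < N → j < N → i ≠ j → c (f i) (f j) ≠ c x (f (N - 1)))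
    (h2 : c x (f 0) ≠ c x (f (N - 1))) :
    RainbowCycle c (N + 1) (fun i => if i < N then f i else x) := by
  have hedge : ∀ i j, i + 1 < N → j + 1 < N → c (f i) (f (i + 1)) = c (f j) (f (j + 1)) →
      i = j := by
    intro i j hi hj hij
    refine h.2 (show i < N by omega) (show j < N by omega) ?_
    dsimp only
    rw [Nat.mod_eq_of_lt hi, Nat.mod_eq_of_lt hj]
    exact hij
  refine rainbowCycle_of_path ?_ ?_ ?_
  · intro a ha b hb hab
    simp only [Set.mem_Iio] at ha hb
    dsimp only at hab
    split_ifs at hab with c1 c2 c3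
    · exact h.1 c1 c2 hab
    · exact absurd hab (hx _ c1)
    · exact absurd hab.symm (hx _ c3)
    · omega
  · intro i j hi hj hij
    have hi' : i < N := by omega
    have hj' : j < N := by omega
    simp only [hi', hj', if_true] at hij
    by_cases c1 : i + 1 < N <;> by_cases c2 : j + 1 < N <;>
      simp only [c1, c2, if_true, if_false] at hij
    · exact hedge i j c1 c2 hij
    · rw [show j = N - 1 by omega, hc (f (N - 1))] at hij
      exact absurd hij (h1 _ _ hi' c1 (by omega))
    · rw [show i = N - 1 by omega, hc (f (N - 1))] at hij
      exact absurd hij.symm (h1 _ _ hj' c2 (by omega))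
    · omega
  · intro i hi hij
    have hi' : i < N := by omega
    have hN0 : 0 < N := by omega
    simp only [Nat.add_sub_cancel, lt_irrefl, if_false, hN0, hi', if_true] at hij
    by_cases c1 : i + 1 < N <;> simp only [c1, if_true, if_false] at hij
    · exact h0 _ _ hi' c1 (by omega) hij.symm
    · rw [show i = N - 1 by omega, hc (f (N - 1))] at hij
      exact h2 hij

/-- A coloring with a rainbow cycle of length `2r+1` has fewer than `r n` colors unless it has a
rainbow cycle of length `2r+2` or a rainbow `C_{2r+1} ∪ K_2`. -/
theorem card_colors_lt_of_rainbowCycle (hc : ∀ x y, c x y = c y x) {r : ℕ} (hr : 2 ≤ r)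
    (hV : 2 * r + 2 ≤ Fintype.card V) {f : ℕ → V} (hf : RainbowCycle c (2 * r + 1) f)
    (hno : ∀ g, ¬ RainbowCycle c (2 * r + 2) g)
    (hout : ∀ a b, a ≠ b → (∀ i < 2 * r + 1, f i ≠ a) → (∀ i < 2 * r + 1, f i ≠ b) →
      ∃ i < 2 * r + 1, c a b = c (f i) (f ((i + 1) % (2 * r + 1)))) :
    (colorsIn c Finset.univ).card < r * Fintype.card V := by
  classical
  set N := 2 * r + 1 with hN
  set C := (Finset.range N).image f with hC
  have hCcard : C.card = N := by
    rw [hC, Finset.card_image_of_injOn (by simpa [Set.InjOn] using hf.1), Finset.card_range]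
  have hCmem : ∀ i < N, f i ∈ C := fun i hi => Finset.mem_image_of_mem _ (Finset.mem_range.2 hi)
  have hCout : ∀ x, x ∉ C → ∀ i < N, f i ≠ x := fun x hx i hi h => hx (h ▸ hCmem i hi)
  set A := colorsIn c C with hA
  have hAcard : A.card ≤ r * N := by
    have h1 := card_colorsIn_le hc C
    have h2 := two_mul_choose_two N
    rw [hCcard] at h1
    rw [show N - 1 = 2 * r by omega] at h2
    nlinarith
  -- Edges disjoint from the cycle repeat cycle colors, so colors outside `A` occur only between `C`
  -- and its complement.
  set New : V → Finset K := fun x => (C.image (c x)) \ A with hNew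
  have hsub : colorsIn c Finset.univ ⊆ A ∪ Cᶜ.biUnion New := by
    intro k hk
    obtain ⟨x, -, y, -, hxy, rfl⟩ := mem_colorsIn.1 hk
    rw [Finset.mem_union]
    by_contra hcon
    rw [not_or] at hcon
    obtain ⟨hkA, hkN⟩ := hcon
    have hmix : ∀ x y, x ∉ C → y ∈ C → c x y ∉ A → c x y ∈ Cᶜ.biUnion New := by
      intro x y hx hy h
      exact Finset.mem_biUnion.2 ⟨x, Finset.mem_compl.2 hx,
        Finset.mem_sdiff.2 ⟨Finset.mem_image_of_mem _ hy, h⟩⟩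
    by_cases hx : x ∈ C <;> by_cases hy : y ∈ C
    · exact hkA (mem_colorsIn.2 ⟨x, hx, y, hy, hxy, rfl⟩)
    · rw [hc] at hkA hkN
      exact hkN (hmix y x hy hx hkA)
    · exact hkN (hmix x y hx hy hkA)
    · obtain ⟨i, hi, h⟩ := hout x y hxy (hCout x hx) (hCout y hy)
      have hne : f i ≠ f ((i + 1) % N) := fun e => by
        have h3 : i = (i + 1) % N := hf.1 (show i < N from hi)
          (show (i + 1) % N < N from Nat.mod_lt _ (by omega)) e
        by_cases hi' : i + 1 < N
        · rw [Nat.mod_eq_of_lt hi'] at h3; omega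
        · rw [show i + 1 = N by omega, Nat.mod_self] at h3; omega
      exact hkA (mem_colorsIn.2 ⟨_, hCmem i hi, _, hCmem _ (Nat.mod_lt _ (by omega)), hne, h.symm⟩)
  have hidx : ∀ x, ∃ y : K → ℕ, ∀ k ∈ New x, y k < N ∧ c x (f (y k)) = k ∧ k ∉ A := by
    intro x
    have : ∀ k ∈ New x, ∃ i, i < N ∧ c x (f i) = k ∧ k ∉ A := by
      intro k hk
      obtain ⟨h1, h2⟩ := Finset.mem_sdiff.1 hk
      obtain ⟨v, hv, rfl⟩ := Finset.mem_image.1 h1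
      obtain ⟨i, hi, rfl⟩ := Finset.mem_image.1 hv
      exact ⟨i, Finset.mem_range.1 hi, rfl, h2⟩
    choose! y hy using this
    exact ⟨y, hy⟩
  have hins : ∀ g : ℕ → V, RainbowCycle c N g → (∀ i < N, g i ∈ C) → ∀ x, x ∉ C →
      c x (g 0) ∉ A → c x (g (N - 1)) ∉ A → c x (g 0) = c x (g (N - 1)) := by
    intro g hg hgC x hx h0 h1
    by_contra hne
    have hAij : ∀ i j, i < N → j < N → i ≠ j → c (g i) (g j) ∈ A := by
      intro i j hi hj hij
      exact mem_colorsIn.2 ⟨_, hgC i hi, _, hgC j hj,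
        fun e => hij (hg.1 hi hj e), rfl⟩
    exact hno _ (hg.insert_vertex hc (by omega) (fun i hi e => hx (by rw [← e]; exact hgC i hi))
      (fun i j hi hj hij e => h0 (e ▸ hAij i j hi hj hij))
      (fun i j hi hj hij e => h1 (e ▸ hAij i j hi hj hij)) hne)
  -- One index is chosen per new color. More than `r` of the `2r + 1` indices include two
  -- consecutive ones, and inserting `x` between them gives a rainbow `C_{2r+2}`.
  have hNewr : ∀ x, x ∉ C → (New x).card ≤ r := by
    intro x hx
    by_contra hlt
    obtain ⟨y, hy⟩ := hidx x
    set I := (New x).image y with hI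
    have hyinj : ∀ k ∈ New x, ∀ k' ∈ New x, y k = y k' → k = k' := by
      intro k hk k' hk' h
      rw [← (hy k hk).2.1, ← (hy k' hk').2.1, h]
    have hIcard : I.card = (New x).card := Finset.card_image_of_injOn hyinj
    have hIlt : ∀ i ∈ I, i < N := by
      intro i hi
      obtain ⟨k, hk, rfl⟩ := Finset.mem_image.1 hi
      exact (hy k hk).1
    set I' := I.image (fun i => (i + 1) % N) with hI'
    have hI'card : I'.card = I.card := by
      apply Finset.card_image_of_injOn
      intro i hi j hj hij
      exact Nat.ModEq.eq_of_lt_of_lt (Nat.ModEq.add_right_cancel' 1 hij) (hIlt i hi) (hIlt j hj)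
    have hun : (I ∪ I').card ≤ N := by
      refine (Finset.card_le_card (t := Finset.range N) ?_).trans (by simp)
      intro i hi
      rw [Finset.mem_range]
      rcases Finset.mem_union.1 hi with hi | hi
      · exact hIlt i hi
      · obtain ⟨j, hj, rfl⟩ := Finset.mem_image.1 hi
        exact Nat.mod_lt _ (by omega)
    have hui := Finset.card_union_add_card_inter I I'
    obtain ⟨m, hm⟩ := Finset.card_pos.1 (show 0 < (I ∩ I').card by omega)
    obtain ⟨hm1, hm2⟩ := Finset.mem_inter.1 hm
    obtain ⟨j, hj, rfl⟩ := Finset.mem_image.1 hm2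
    obtain ⟨k, hk, hk1⟩ := Finset.mem_image.1 hm1
    obtain ⟨k', hk', rfl⟩ := Finset.mem_image.1 hj
    have hmN := (hy k hk).1
    have e1 : (y k + 0) % N = y k := by simp [Nat.mod_eq_of_lt hmN]
    have e2 : (y k + (N - 1)) % N = y k' := by
      rw [hk1, Nat.mod_add_mod, show y k' + 1 + (N - 1) = y k' + N by omega, Nat.add_mod_right,
        Nat.mod_eq_of_lt (hy k' hk').1]
    have key := hins _ (hf.rotate (y k)) (fun i _ => hCmem _ (Nat.mod_lt _ (by omega))) x hx
      (by rw [e1, (hy k hk).2.1]; exact (hy k hk).2.2)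
      (by rw [e2, (hy k' hk').2.1]; exact (hy k' hk').2.2)
    rw [e1, e2, (hy k hk).2.1, (hy k' hk').2.1] at key
    subst key
    have h1 := (hy k hk).1
    by_cases h2 : y k + 1 < N
    · rw [Nat.mod_eq_of_lt h2] at hk1; omega
    · rw [show y k + 1 = N by omega, Nat.mod_self] at hk1; omega
  have hCc : Cᶜ.card = Fintype.card V - N := by rw [Finset.card_compl, hCcard]
  have htot : (colorsIn c Finset.univ).card ≤ A.card + (Cᶜ.biUnion New).card :=
    (Finset.card_le_card hsub).trans (Finset.card_union_le _ _)
  have hsplit : r * Fintype.card V = r * N + (Fintype.card V - N) * r := by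
    rw [mul_comm _ r, ← mul_add]; congr 1; omega
  -- The crude total `|A| + r (n - N)` is below `r n` unless all edges inside `C` have distinct
  -- colors.
  rcases hAcard.lt_or_eq with hlt | heq
  · have h1 : (Cᶜ.biUnion New).card ≤ Cᶜ.card * r :=
      Finset.card_biUnion_le_card_mul _ _ _ (fun x hx => hNewr x (Finset.mem_compl.1 hx))
    rw [hCc] at h1
    omega
  · have hfull : (colorsIn c C).card = C.card.choose 2 := by
      have h2 := two_mul_choose_two N
      rw [show N - 1 = 2 * r by omega] at h2
      rw [hCcard, ← hA]
      nlinarith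
    have hNew1 : ∀ x ∈ Cᶜ, (New x).card ≤ 1 := by
      intro x hx
      rw [Finset.mem_compl] at hx
      by_contra hlt
      obtain ⟨k, hk, k', hk', hkk⟩ := Finset.one_lt_card.1 (show 1 < (New x).card by omega)
      obtain ⟨y, hy⟩ := hidx x
      have hyk := hy k hk
      have hyk' := hy k' hk'
      have hne : f (y k) ≠ f (y k') := fun e => hkk (by
        rw [← hyk.2.1, ← hyk'.2.1, e])
      -- In a totally rainbow `C`, any two vertices are consecutive on some rainbow cycle through
      -- `C`, so a single new color per outside vertex remains.
      obtain ⟨g, ⟨hg1, hg2, hg3⟩, hg0, hgl⟩ := hamConnected_of_complete (H := (⊤ : SimpleGraph V))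
        (Q := C) (fun a _ b _ h => h) _ (hCmem _ hyk.1) _ (hCmem _ hyk'.1) hne
      rw [hCcard] at hg1 hg2 hg3 hgl
      have inj : ∀ a b, a < N → b < N → g a = g b → a = b := fun a b h h' h'' => hg1 h h' h''
      have hsym : ∀ i j i' j', i < N → j < N → i' < N → j' < N → i ≠ j → i' ≠ j' →
          c (g i) (g j) = c (g i') (g j') → (i = i' ∧ j = j') ∨ (i = j' ∧ j = i') := by
        intro i j i' j' hi hj hi' hj' hij hij' he
        have := eq_of_color_eq_of_card_colorsIn hc hfull (hg2 i hi) (hg2 j hj) (hg2 i' hi')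
          (hg2 j' hj') (fun e => hij (inj _ _ hi hj e)) (fun e => hij' (inj _ _ hi' hj' e)) he
        rcases Sym2.eq_iff.1 this with ⟨h1, h2⟩ | ⟨h1, h2⟩
        · exact Or.inl ⟨inj _ _ hi hi' h1, inj _ _ hj hj' h2⟩
        · exact Or.inr ⟨inj _ _ hi hj' h1, inj _ _ hj hi' h2⟩
      have hgr : RainbowCycle c N g := by
        refine rainbowCycle_of_path hg1 ?_ ?_
        · intro i j hi hj he
          have := hsym i (i + 1) j (j + 1) (by omega) hi (by omega) hj (by omega) (by omega) he
          omega
        · intro i hi he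
          have := hsym (N - 1) 0 i (i + 1) (by omega) (by omega) (by omega) hi (by omega)
            (by omega) he
          omega
      have := hins g hgr hg2 x hx (by rw [hg0, hyk.2.1]; exact hyk.2.2)
        (by rw [hgl, hyk'.2.1]; exact hyk'.2.2)
      rw [hg0, hgl, hyk.2.1, hyk'.2.1] at this
      exact hkk this
    have h1 : (Cᶜ.biUnion New).card ≤ Cᶜ.card * 1 :=
      Finset.card_biUnion_le_card_mul _ _ _ hNew1
    rw [hCc] at h1
    have h2 : (Fintype.card V - N) * 2 ≤ (Fintype.card V - N) * r := Nat.mul_le_mul_left _ hr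
    omega

end AntiRamsey

/-! ### Rainbow cycles in pierced colorings. -/

/-- Every set of `p` vertices contains a monochromatic set of `q` vertices. -/
def HasMonoCliques {V K : Type*} (c : V → V → K) (p q : ℕ) : Prop :=
  ∀ S : Finset V, S.card = p → ∃ T ⊆ S, T.card = q ∧ ∃ k, ∀ x ∈ T, ∀ y ∈ T, x ≠ y → c x y = k

lemma ZMod.natCast_injOn {N a b : ℕ} (ha : a < N) (hb : b < N) (h : (a : ZMod N) = b) :
    a = b := by
  rw [ZMod.natCast_eq_natCast_iff'] at h
  rwa [Nat.mod_eq_of_lt ha, Nat.mod_eq_of_lt hb] at h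

section Piercing

variable {V K : Type*} [DecidableEq V] {c : V → V → K}

/-- `v` is an injective enumeration of the vertices of a rainbow cycle by `ZMod N`. -/
structure IsRainbowCycle {V K : Type*} (c : V → V → K) {N : ℕ} (v : ZMod N → V) : Prop where
  injective : Function.Injective v
  colors_injective : Function.Injective fun z => c (v z) (v (z + 1))

omit [DecidableEq V] in
lemma RainbowCycle.isRainbowCycle {N : ℕ} [NeZero N] (hN : 1 < N) {f : ℕ → V}
    (hf : RainbowCycle c N f) : IsRainbowCycle c (fun z : ZMod N => f z.val) := by
  have : Fact (1 < N) := ⟨hN⟩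
  refine ⟨fun x y h => ZMod.val_injective N (hf.1 (ZMod.val_lt x) (ZMod.val_lt y) h),
    fun x y h => ZMod.val_injective N (hf.2 (ZMod.val_lt x) (ZMod.val_lt y) ?_)⟩
  simpa [ZMod.val_add, ZMod.val_one] using h

lemma card_index_le {N : ℕ} [NeZero N] {v : ZMod N → V} (T : Finset V) :
    (T ∩ Finset.univ.image v).card ≤ (Finset.univ.filter fun z => v z ∈ T).card := by
  refine (Finset.card_le_card (t := (Finset.univ.filter fun z => v z ∈ T).image v) ?_).trans
    Finset.card_image_le
  intro x hx
  obtain ⟨h1, h2⟩ := Finset.mem_inter.1 hx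
  obtain ⟨z, -, rfl⟩ := Finset.mem_image.1 h2
  exact Finset.mem_image.2 ⟨z, Finset.mem_filter.2 ⟨Finset.mem_univ _, h1⟩, rfl⟩

/-- The successors of the elements of `I` whose successor is not in `I` are distinct and lie outside
`I`. -/
lemma card_add_card_shift {N : ℕ} [NeZero N] (I : Finset (ZMod N)) :
    (I \ I.filter fun z => z + 1 ∈ I).card + I.card ≤ N := by
  have h1 : ((I \ I.filter fun z => z + 1 ∈ I).image (· + 1)).card =
      (I \ I.filter fun z => z + 1 ∈ I).card :=
    Finset.card_image_of_injective _ (add_left_injective 1)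
  rw [← h1, ← Finset.card_union_of_disjoint]
  · exact (Finset.card_le_univ _).trans (ZMod.card N).le
  · rw [Finset.disjoint_left]
    intro z hz hzI
    obtain ⟨w, hw, rfl⟩ := Finset.mem_image.1 hz
    rw [Finset.mem_sdiff, Finset.mem_filter] at hw
    exact hw.2 ⟨hw.1, hzI⟩

/-- A monochromatic set contains at most one edge of a rainbow cycle. -/
lemma IsRainbowCycle.card_edges_le {N : ℕ} [NeZero N] {v : ZMod N → V} (hN : 1 < N)
    (hv : IsRainbowCycle c v) {T : Finset V} {k : K}
    (hk : ∀ x ∈ T, ∀ y ∈ T, x ≠ y → c x y = k) :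
    ((Finset.univ.filter fun z => v z ∈ T).filter
      fun z => z + 1 ∈ Finset.univ.filter fun z => v z ∈ T).card ≤ 1 := by
  have : Fact (1 < N) := ⟨hN⟩
  rw [Finset.card_le_one]
  intro z hz w hw
  simp only [Finset.mem_filter, Finset.mem_univ, true_and] at hz hw
  have hne : ∀ z, v z ≠ v (z + 1) := fun z h => by
    have := hv.injective h
    simp at this
  apply hv.colors_injective
  dsimp only
  rw [hk _ hz.1 _ hz.2 (hne z), hk _ hw.1 _ hw.2 (hne w)]

/-- Any `r + 2` of the `2r + 2` cycle vertices span at least two cycle edges, which have different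
colors. -/
lemma HasMonoCliques.not_rainbowCycle {r : ℕ} (h : HasMonoCliques c (2 * r + 2) (r + 2))
    {f : ℕ → V} (hf : RainbowCycle c (2 * r + 2) f) : False := by
  set v : ZMod (2 * r + 2) → V := fun z => f z.val with hv
  have hvr : IsRainbowCycle c v := hf.isRainbowCycle (by omega)
  have hcard : (Finset.univ.image v).card = 2 * r + 2 := by
    rw [Finset.card_image_of_injective _ hvr.injective, Finset.card_univ, ZMod.card]
  obtain ⟨T, hTS, hT, k, hk⟩ := h _ hcard
  have h1 := card_index_le (v := v) T
  rw [Finset.inter_eq_left.2 hTS, hT] at h1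
  have h2 := card_add_card_shift (Finset.univ.filter fun z => v z ∈ T)
  have h3 := hvr.card_edges_le (by omega) hk
  have h4 := Finset.le_card_sdiff ((Finset.univ.filter fun z => v z ∈ T).filter
      fun z => z + 1 ∈ Finset.univ.filter fun z => v z ∈ T) (Finset.univ.filter fun z => v z ∈ T)
  omega

section OddCycle

variable {r : ℕ} {v : ZMod (2 * r + 1) → V}

/-- The vertex `x` and every second vertex of the cycle `v`, starting with `v (i + 1)`, form a
monochromatic set in the color of the edge from `v i` to `v (i + 1)`. -/
def HasType (c : V → V → K) (v : ZMod (2 * r + 1) → V) (x : V) (i : ZMod (2 * r + 1)) : Prop :=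
  ∀ j ≤ r, c x (v (i + 1 + (2 * j : ℕ))) = c (v i) (v (i + 1)) ∧
    ∀ j' ≤ r, j ≠ j' → c (v (i + 1 + (2 * j : ℕ))) (v (i + 1 + (2 * j' : ℕ))) =
      c (v i) (v (i + 1))

/-- A monochromatic set spans at most one cycle edge, so it has at most `r + 1` vertices on the odd
cycle. Thus the one found among the cycle and `x` contains `x` and attains this bound, which forces
the alternating pattern around its unique edge. -/
lemma HasMonoCliques.exists_type (hr : 1 ≤ r) (h : HasMonoCliques c (2 * r + 2) (r + 2))
    (hv : IsRainbowCycle c v) {x : V} (hx : ∀ z, v z ≠ x) : ∃ i, HasType c v x i := by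
  classical
  have hxv : x ∉ Finset.univ.image v := by simpa using hx
  have hcard : (insert x (Finset.univ.image v)).card = 2 * r + 2 := by
    rw [Finset.card_insert_of_notMem hxv, Finset.card_image_of_injective _ hv.injective,
      Finset.card_univ, ZMod.card]
  obtain ⟨T, hTS, hT, k, hk⟩ := h _ hcard
  set I := Finset.univ.filter fun z => v z ∈ T with hI
  set J := I.filter fun z => z + 1 ∈ I with hJ
  have h1 : (T ∩ Finset.univ.image v).card ≤ I.card := card_index_le (v := v) T
  have h2 : (I \ J).card + I.card ≤ 2 * r + 1 := card_add_card_shift I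
  have h3 : J.card ≤ 1 := hv.card_edges_le (by omega) hk
  have h4 : (I \ J).card + J.card = I.card := by
    rw [Finset.card_sdiff_add_card_eq_card (Finset.filter_subset _ _)]
  have h5 : T.card ≤ (T ∩ Finset.univ.image v).card + 1 := by
    have : T ⊆ insert x (T ∩ Finset.univ.image v) := by
      intro y hy
      rcases Finset.mem_insert.1 (hTS hy) with rfl | hy'
      · exact Finset.mem_insert_self _ _
      · exact Finset.mem_insert_of_mem (Finset.mem_inter.2 ⟨hy, hy'⟩)
    exact (Finset.card_le_card this).trans (Finset.card_insert_le _ _)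
  have hxT : x ∈ T := by
    by_contra hxT
    have : T ⊆ T ∩ Finset.univ.image v := by
      intro y hy
      rcases Finset.mem_insert.1 (hTS hy) with rfl | hy'
      · exact absurd hy hxT
      · exact Finset.mem_inter.2 ⟨hy, hy'⟩
    have := Finset.card_le_card this
    omega
  obtain ⟨i, hi⟩ := Finset.card_eq_one.1 (show J.card = 1 by omega)
  have hJi : ∀ z, z ∈ J ↔ z = i := by simp [hi]
  -- Equality in the counting: every index missing from `I` follows an element of `I`, so no two
  -- consecutive indices are missing.
  have hshift : (I \ J).image (· + 1) = Iᶜ := by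
    apply Finset.eq_of_subset_of_card_le
    · intro z hz
      obtain ⟨w, hw, rfl⟩ := Finset.mem_image.1 hz
      rw [Finset.mem_compl]
      intro hw'
      rw [Finset.mem_sdiff] at hw
      exact hw.2 (Finset.mem_filter.2 ⟨hw.1, hw'⟩)
    · rw [Finset.card_image_of_injective _ (add_left_injective 1), Finset.card_compl, ZMod.card]
      omega
  have hiI : i ∈ I ∧ i + 1 ∈ I := Finset.mem_filter.1 ((hJi i).2 rfl)
  have hmem : ∀ j ≤ r, i + 1 + (2 * j : ℕ) ∈ I := by
    intro j
    induction j with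
    | zero => intro _; simpa using hiI.2
    | succ j ih =>
      intro hj
      have hw := ih (by omega)
      set w := i + 1 + ((2 * j : ℕ) : ZMod (2 * r + 1)) with hwdef
      have hwi : w ≠ i := by
        intro e
        have : ((1 + 2 * j : ℕ) : ZMod (2 * r + 1)) = (0 : ℕ) := by
          have : i + (1 + ((2 * j : ℕ) : ZMod (2 * r + 1))) = i + 0 := by
            rw [add_zero, ← add_assoc]; exact e
          simpa using add_left_cancel this
        have := ZMod.natCast_injOn (by omega) (by omega) this
        omega
      have hw1 : w + 1 ∉ I := by
        intro h
        exact hwi ((hJi w).1 (Finset.mem_filter.2 ⟨hw, h⟩))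
      have e : i + 1 + ((2 * (j + 1) : ℕ) : ZMod (2 * r + 1)) = w + 1 + 1 := by
        rw [hwdef]; push_cast; ring
      rw [e]
      by_contra hcon
      rw [← Finset.mem_compl, ← hshift] at hcon
      obtain ⟨u, hu, hu'⟩ := Finset.mem_image.1 hcon
      have : u = w + 1 := add_right_cancel hu'
      subst this
      exact hw1 (Finset.mem_sdiff.1 hu).1
  have hT' : ∀ z, z ∈ I → v z ∈ T := fun z hz => (Finset.mem_filter.1 hz).2
  have hne : v i ≠ v (i + 1) := fun e => by
    have : Fact (1 < 2 * r + 1) := ⟨by omega⟩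
    have := hv.injective e
    simp at this
  have hki : c (v i) (v (i + 1)) = k := hk _ (hT' _ hiI.1) _ (hT' _ hiI.2) hne
  refine ⟨i, fun j hj => ⟨?_, fun j' hj' hjj => ?_⟩⟩
  · rw [hki]
    exact hk _ hxT _ (hT' _ (hmem j hj)) (hx _).symm
  · rw [hki]
    refine hk _ (hT' _ (hmem j hj)) _ (hT' _ (hmem j' hj')) (fun e => hjj ?_)
    have := ZMod.natCast_injOn (by omega) (by omega) (add_left_cancel (hv.injective e))
    omega

omit [DecidableEq V] in
-- The cycle is `x, y, v (i + 2), …, v (i + 2r + 1) = v i`. The edges from `y` to `v (i + 2)` and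
-- from `v i` to `x` have the colors of the edges of `v` at `i + 1` and `i`; all other edges except
-- `xy` lie on `v`.
lemma exists_rainbowCycle_of_consecutive_types (hc : ∀ x y, c x y = c y x) (hr : 1 ≤ r)
    (hv : IsRainbowCycle c v) {x y : V} (hx : ∀ z, v z ≠ x) (hy : ∀ z, v z ≠ y) (hxy : x ≠ y)
    (hnew : ∀ z, c x y ≠ c (v z) (v (z + 1))) {i : ZMod (2 * r + 1)} (hxi : HasType c v x i)
    (hyi : HasType c v y (i + 1)) : ∃ f, RainbowCycle c (2 * r + 2) f := by
  have inj : ∀ a b : ℕ, a < 2 * r + 1 → b < 2 * r + 1 → i + (a : ZMod (2 * r + 1)) = i + b →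
      a = b := fun a b ha hb h => ZMod.natCast_injOn ha hb (add_left_cancel h)
  have hlast : ((2 * r + 1 : ℕ) : ZMod (2 * r + 1)) = 0 := ZMod.natCast_self _
  set g : ℕ → V := fun k => if k = 0 then x else if k = 1 then y else v (i + k) with hg
  have hg2 : ∀ k, 2 ≤ k → g k = v (i + k) := by
    intro k hk
    simp only [hg]
    rw [if_neg (by omega), if_neg (by omega)]
  have inj' : ∀ a b : ℕ, 1 ≤ a → 1 ≤ b → a < 2 * r + 2 → b < 2 * r + 2 →
      i + (a : ZMod (2 * r + 1)) = i + b → a = b := by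
    intro a b ha hb ha' hb' h
    have : a - 1 = b - 1 := inj _ _ (by omega) (by omega) (by
      rw [Nat.cast_sub ha, Nat.cast_sub hb, ← add_sub_assoc, ← add_sub_assoc, h])
    omega
  have hcol : ∀ k, 1 ≤ k → k + 1 < 2 * r + 2 →
      c (g k) (g (k + 1)) = c (v (i + k)) (v (i + k + 1)) := by
    intro k hk hk'
    rw [hg2 (k + 1) (by omega)]
    rcases hk.lt_or_eq with h1 | rfl
    · rw [hg2 k h1]; push_cast; rw [add_assoc]
    · have := (hyi 0 (by omega)).1
      simp only [mul_zero, Nat.cast_zero, add_zero] at this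
      have e : g 1 = y := by simp [hg]
      rw [e]
      push_cast
      rw [← this]
      congr 2
      ring
  have hcl : c (g (2 * r + 2 - 1)) (g 0) =
      c (v (i + (2 * r + 1 : ℕ))) (v (i + (2 * r + 1 : ℕ) + 1)) := by
    have e : g 0 = x := by simp [hg]
    have := (hxi r le_rfl).1
    rw [e, hg2 _ (by omega), show 2 * r + 2 - 1 = 2 * r + 1 by omega, hlast, add_zero, ← this, hc]
    congr 2
    have h2 : (1 : ZMod (2 * r + 1)) + (2 * r : ℕ) = 0 := by
      rw [← hlast]; push_cast; ring
    rw [add_assoc, h2, add_zero]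
  have h01 : c (g 0) (g (0 + 1)) = c x y := by simp [hg]
  refine ⟨g, rainbowCycle_of_path ?_ ?_ ?_⟩
  · intro a ha b hb hab
    simp only [Set.mem_Iio] at ha hb
    simp only [hg] at hab
    split_ifs at hab with c1 c2 c3 c4 c5 c6 c7 c8
    all_goals first
      | omega
      | exact absurd hab hxy
      | exact absurd hab.symm hxy
      | exact absurd hab (hx _)
      | exact absurd hab.symm (hx _)
      | exact absurd hab (hy _)
      | exact absurd hab.symm (hy _)
      | exact inj' _ _ (by omega) (by omega) ha hb (hv.injective hab)
  · intro a b ha hb hab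
    rcases Nat.eq_zero_or_pos a with rfl | ha0 <;> rcases Nat.eq_zero_or_pos b with rfl | hb0
    · rfl
    · rw [h01, hcol b hb0 hb] at hab
      exact absurd hab (hnew _)
    · rw [h01, hcol a ha0 ha] at hab
      exact absurd hab.symm (hnew _)
    · rw [hcol a ha0 ha, hcol b hb0 hb] at hab
      exact inj' _ _ ha0 hb0 (by omega) (by omega) (hv.colors_injective hab)
  · intro a ha hab
    rw [hcl] at hab
    rcases Nat.eq_zero_or_pos a with rfl | ha0
    · rw [h01] at hab
      exact hnew _ hab.symm
    · rw [hcol a ha0 ha] at hab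
      have := inj' _ _ (by omega) ha0 (by omega) (by omega) (hv.colors_injective hab)
      omega

/-- Two outside vertices joined by a new color have the same type. -/
lemma HasMonoCliques.type_eq (hc : ∀ x y, c x y = c y x) (hr : 1 ≤ r)
    (h : HasMonoCliques c (2 * r + 2) (r + 2))
    (hv : IsRainbowCycle c v) {x y : V} (hx : ∀ z, v z ≠ x) (hy : ∀ z, v z ≠ y) (hxy : x ≠ y)
    (hnew : ∀ z, c x y ≠ c (v z) (v (z + 1))) {i i' : ZMod (2 * r + 1)} (hxi : HasType c v x i)
    (hyi : HasType c v y i') : i = i' := by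
  -- As the cycle is odd, one of `i' - i` and `i - i'` has an even representative `2g` with `1 ≤ g ≤
  -- r`.
  have key : ∀ {x y : V} {i i' : ZMod (2 * r + 1)} (g : ℕ), (∀ z, v z ≠ x) → (∀ z, v z ≠ y) →
      x ≠ y → (∀ z, c x y ≠ c (v z) (v (z + 1))) → HasType c v x i → HasType c v y i' →
      1 ≤ g → g ≤ r → i' = i + (2 * g : ℕ) → i = i' := by
    intro x y i i' g hx hy hxy hnew hxi hyi hg hgr hii
    by_cases hgr' : g = r
    · subst hgr'
      have h2 : ((2 * g : ℕ) : ZMod (2 * g + 1)) + 1 = 0 := by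
        have := ZMod.natCast_self (2 * g + 1)
        exact_mod_cast this
      have e : i = i' + 1 := by rw [hii, add_assoc, h2, add_zero]
      rw [e] at hxi
      obtain ⟨f, hf⟩ := exists_rainbowCycle_of_consecutive_types hc hr hv hy hx hxy.symm
        (fun z => by rw [hc]; exact hnew z) hyi hxi
      exact (h.not_rainbowCycle hf).elim
    -- The vertices `v (i' + 1)` and `v i` belong to both alternating sets and are distinct as `g <
    -- r`; the color of the edge between them determines both types.
    · have h1 := (hxi g hgr).2 r le_rfl hgr'
      have h2 := (hyi 0 (by omega)).2 (r - g) (by omega) (by omega)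
      have e1 : i' + 1 + ((2 * 0 : ℕ) : ZMod (2 * r + 1)) = i + 1 + (2 * g : ℕ) := by
        rw [hii]; push_cast; ring
      have e2 : i' + 1 + ((2 * (r - g) : ℕ) : ZMod (2 * r + 1)) = i + 1 + (2 * r : ℕ) := by
        have : ((2 * r : ℕ) : ZMod (2 * r + 1)) = (2 * g : ℕ) + (2 * (r - g) : ℕ) := by
          rw [← Nat.cast_add]; congr 1; omega
        rw [hii, this]; ring
      rw [e1, e2, h1] at h2
      exact hv.colors_injective h2
  have hcast : ∀ z : ZMod (2 * r + 1), ((z.val : ℕ) : ZMod (2 * r + 1)) = z :=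
    fun z => ZMod.natCast_zmod_val z
  by_contra hne
  have hd := ZMod.val_lt (i' - i)
  have hd0 : (i' - i).val ≠ 0 := by
    rw [Ne, ZMod.val_eq_zero, sub_eq_zero]; exact Ne.symm hne
  rcases Nat.even_or_odd' (i' - i).val with ⟨g, hg | hg⟩
  · refine hne (key g hx hy hxy hnew hxi hyi (by omega) (by omega) ?_)
    rw [← hg, hcast]; ring
  · refine hne (key (r - g) hy hx hxy.symm (fun z => by rw [hc]; exact hnew z) hyi hxi
      (by omega) (by omega) ?_).symm
    have h1 : ((2 * (r - g) : ℕ) : ZMod (2 * r + 1)) + ((i' - i).val : ℕ) = 0 := by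
      rw [← Nat.cast_add, hg, show 2 * (r - g) + (2 * g + 1) = 2 * r + 1 by omega,
        ZMod.natCast_self]
    rw [hcast] at h1
    rw [eq_neg_of_add_eq_zero_left h1]; ring

/-- Two outside vertices joined by a new color form a monochromatic set with the remaining
vertices of the cycle. -/
lemma HasMonoCliques.mono_of_type_eq (hr : 1 ≤ r)
    (h : HasMonoCliques c (2 * r + 2) (r + 2))
    (hv : IsRainbowCycle c v) {x y : V} (hx : ∀ z, v z ≠ x) (hy : ∀ z, v z ≠ y) (hxy : x ≠ y)
    (hnew : ∀ z, c x y ≠ c (v z) (v (z + 1))) {i : ZMod (2 * r + 1)} (hxi : HasType c v x i)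
    (hyi : HasType c v y i) : ∀ j < r, c x (v (i + 2 + (2 * j : ℕ))) = c x y ∧
      c y (v (i + 2 + (2 * j : ℕ))) = c x y ∧ ∀ j' < r, j ≠ j' →
        c (v (i + 2 + (2 * j : ℕ))) (v (i + 2 + (2 * j' : ℕ))) = c x y := by
  classical
  set od : ℕ → V := fun t => v (i + 1 + (2 * t : ℕ)) with hod
  set ev : ℕ → V := fun t => v (i + 2 + (2 * t : ℕ)) with hev
  have hidx : ∀ t, ev t = v (i + 1 + (2 * t : ℕ) + 1) := by
    intro t; simp only [hev]; congr 1; ring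
  have hev' : ∀ t, ev t = v (i + 1 + (2 * t + 1 : ℕ)) := by
    intro t; rw [hidx]; congr 1; push_cast; ring
  have hinj : ∀ a b : ℕ, a < 2 * r + 1 → b < 2 * r + 1 →
      v (i + 1 + (a : ZMod (2 * r + 1))) = v (i + 1 + b) → a = b := fun a b ha hb h =>
    ZMod.natCast_injOn ha hb (add_left_cancel (hv.injective h))
  have hodinj : Set.InjOn od (Set.Iio r) := by
    intro a ha b hb hab
    simp only [Set.mem_Iio] at ha hb
    have := hinj _ _ (by omega) (by omega) hab
    omega
  have hevinj : Set.InjOn ev (Set.Iio r) := by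
    intro a ha b hb hab
    simp only [Set.mem_Iio] at ha hb
    rw [hev', hev'] at hab
    have := hinj _ _ (by omega) (by omega) hab
    omega
  have hodev : ∀ a b, a < r → b < r → od a ≠ ev b := by
    intro a b ha hb hab
    rw [hev'] at hab
    have := hinj _ _ (by omega) (by omega) hab
    omega
  -- The piercing condition is applied to `x`, `y` and all cycle vertices except `v i`, which fall
  -- into `r` cycle edges joining `od t` to `ev t`.
  set O := (Finset.range r).image od with hO
  set E := (Finset.range r).image ev with hE
  have hOcard : O.card = r := by
    rw [hO, Finset.card_image_of_injOn (by simpa [Set.InjOn] using hodinj), Finset.card_range]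
  have hEcard : E.card = r := by
    rw [hE, Finset.card_image_of_injOn (by simpa [Set.InjOn] using hevinj), Finset.card_range]
  have hdisj : Disjoint O E := by
    rw [Finset.disjoint_left]
    intro a ha hb
    obtain ⟨s, hs, rfl⟩ := Finset.mem_image.1 ha
    obtain ⟨t, ht, hst⟩ := Finset.mem_image.1 hb
    exact hodev s t (Finset.mem_range.1 hs) (Finset.mem_range.1 ht) hst.symm
  have hOE : ∀ w ∈ O ∪ E, ∃ z, v z = w := by
    intro w hw
    rcases Finset.mem_union.1 hw with hw | hw
    · obtain ⟨t, -, rfl⟩ := Finset.mem_image.1 hw; exact ⟨_, rfl⟩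
    · obtain ⟨t, -, rfl⟩ := Finset.mem_image.1 hw; exact ⟨_, rfl⟩
  have hxOE : x ∉ O ∪ E := fun hw => by obtain ⟨z, hz⟩ := hOE x hw; exact hx z hz
  have hyOE : y ∉ O ∪ E := fun hw => by obtain ⟨z, hz⟩ := hOE y hw; exact hy z hz
  have hcard : (({x, y} : Finset V) ∪ (O ∪ E)).card = 2 * r + 2 := by
    rw [Finset.card_union_of_disjoint, Finset.card_union_of_disjoint hdisj, hOcard, hEcard,
      Finset.card_pair hxy]
    · omega
    · rw [Finset.disjoint_left]
      intro a ha
      rcases Finset.mem_insert.1 ha with rfl | ha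
      · exact hxOE
      · rw [Finset.mem_singleton] at ha
        rw [ha]; exact hyOE
  obtain ⟨T, hTS, hT, k, hk⟩ := h _ hcard
  have hxtype : ∀ t < r, c x (od t) = c (v i) (v (i + 1)) := fun t ht => (hxi t ht.le).1
  have hytype : ∀ t < r, c y (od t) = c (v i) (v (i + 1)) := fun t ht => (hyi t ht.le).1
  have hode : ∀ t < r, ∀ w, (∀ z, v z ≠ w) → w ∈ T → od t ∈ T → c w (od t) = k :=
    fun t ht w hw hwT htT => hk w hwT _ htT (hw _).symm
  set P := (Finset.range r).filter fun t => od t ∈ T with hP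
  set P' := (Finset.range r).filter fun t => ev t ∈ T with hP'
  have hedge : ∀ t ∈ P ∩ P', k = c (v (i + 1 + (2 * t : ℕ))) (v (i + 1 + (2 * t : ℕ) + 1)) ∧
      t < r ∧ od t ∈ T := by
    intro t ht
    rw [Finset.mem_inter, hP, hP', Finset.mem_filter, Finset.mem_filter, Finset.mem_range] at ht
    have := hk _ ht.1.2 _ ht.2.2 (hodev t t ht.1.1 ht.1.1)
    rw [hidx] at this
    exact ⟨this.symm, ht.1⟩
  have hPP' : P.card + P'.card ≤ r + (P ∩ P').card := by
    rw [← Finset.card_union_add_card_inter]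
    refine Nat.add_le_add_right ?_ _
    refine (Finset.card_le_card (t := Finset.range r) ?_).trans (by simp)
    exact Finset.union_subset (Finset.filter_subset _ _) (Finset.filter_subset _ _)
  have hTcard : r + 2 ≤ (T ∩ {x, y}).card + P.card + P'.card := by
    rw [← hT]
    have hsub : T ⊆ (T ∩ {x, y}) ∪ (P.image od ∪ P'.image ev) := by
      intro w hw
      rcases Finset.mem_union.1 (hTS hw) with h1 | h1
      · exact Finset.mem_union_left _ (Finset.mem_inter.2 ⟨hw, h1⟩)
      · apply Finset.mem_union_right
        rcases Finset.mem_union.1 h1 with h1 | h1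
        · obtain ⟨t, ht, rfl⟩ := Finset.mem_image.1 h1
          exact Finset.mem_union_left _ (Finset.mem_image_of_mem _ (Finset.mem_filter.2 ⟨ht, hw⟩))
        · obtain ⟨t, ht, rfl⟩ := Finset.mem_image.1 h1
          exact Finset.mem_union_right _ (Finset.mem_image_of_mem _ (Finset.mem_filter.2 ⟨ht, hw⟩))
    have h1 := (Finset.card_le_card hsub).trans (Finset.card_union_le _ _)
    have h2 := Finset.card_union_le (P.image od) (P'.image ev)
    have h3 : (P.image od).card ≤ P.card := Finset.card_image_le
    have h4 : (P'.image ev).card ≤ P'.card := Finset.card_image_le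
    omega
  have hinter1 : (P ∩ P').card ≤ 1 := by
    rw [Finset.card_le_one]
    intro s hs t ht
    obtain ⟨h1, h2, -⟩ := hedge s hs
    obtain ⟨h3, h4, -⟩ := hedge t ht
    have := ZMod.natCast_injOn (by omega) (by omega)
      (add_left_cancel (hv.colors_injective (h1.symm.trans h3)))
    omega
  -- If `T` contains such a cycle edge together with `x` or `y`, the type gives it the color of the
  -- cycle edge at `i`, contradicting rainbowness.
  have hcontra : ∀ w, (w = x ∨ w = y) → w ∈ T → P ∩ P' = ∅ := by
    intro w hw hwT
    rw [Finset.eq_empty_iff_forall_notMem]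
    intro t ht
    obtain ⟨h1, h2, h3⟩ := hedge t ht
    have hki : c (v i) (v (i + 1)) = k := by
      rcases hw with rfl | rfl
      · rw [← hxtype t h2]; exact hode t h2 _ hx hwT h3
      · rw [← hytype t h2]; exact hode t h2 _ hy hwT h3
    have h4 := hv.colors_injective (hki.trans h1)
    have h5 : ((1 + 2 * t : ℕ) : ZMod (2 * r + 1)) = (0 : ℕ) := by
      have : i + (1 + ((2 * t : ℕ) : ZMod (2 * r + 1))) = i + 0 := by
        rw [add_zero, ← add_assoc]; exact h4.symm
      simpa using add_left_cancel this
    have := ZMod.natCast_injOn (by omega) (by omega) h5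
    omega
  have hxT : x ∈ T ∧ y ∈ T := by
    by_contra hcon
    have h1 : (T ∩ {x, y}).card ≤ 1 := by
      rw [Finset.card_le_one]
      intro a ha b hb
      simp only [Finset.mem_inter, Finset.mem_insert, Finset.mem_singleton] at ha hb
      rcases ha with ⟨ha, rfl | rfl⟩ <;> rcases hb with ⟨hb, rfl | rfl⟩
      · rfl
      · exact absurd ⟨ha, hb⟩ hcon
      · exact absurd ⟨hb, ha⟩ hcon
      · rfl
    rcases Finset.eq_empty_or_nonempty (T ∩ {x, y}) with h2 | ⟨w, hw⟩
    · rw [h2, Finset.card_empty] at hTcard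
      omega
    · simp only [Finset.mem_inter, Finset.mem_insert, Finset.mem_singleton] at hw
      rw [hcontra w hw.2 hw.1, Finset.card_empty] at hPP'
      omega
  have hkxy : c x y = k := hk x hxT.1 y hxT.2 hxy
  -- Now `x, y ∈ T`, so the color of `T` is the new color of `xy`, whereas `x` sends a cycle color
  -- to every `od t`.
  have hPempty : P = ∅ := by
    rw [Finset.eq_empty_iff_forall_notMem]
    intro t ht
    rw [hP, Finset.mem_filter, Finset.mem_range] at ht
    apply hnew i
    rw [← hxtype t ht.1, hkxy]
    exact (hode t ht.1 x hx hxT.1 ht.2).symm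
  have hP'full : P' = Finset.range r := by
    apply Finset.eq_of_subset_of_card_le (Finset.filter_subset _ _)
    have h1 : (T ∩ {x, y}).card ≤ 2 :=
      (Finset.card_le_card Finset.inter_subset_right).trans Finset.card_le_two
    rw [hPempty, Finset.card_empty] at hTcard
    rw [Finset.card_range]
    change r ≤ P'.card
    omega
  have hmem : ∀ j < r, ev j ∈ T := by
    intro j hj
    have : j ∈ P' := by rw [hP'full]; exact Finset.mem_range.2 hj
    exact (Finset.mem_filter.1 this).2
  intro j hj
  rw [hkxy]
  refine ⟨hk _ hxT.1 _ (hmem j hj) (hx _).symm, hk _ hxT.2 _ (hmem j hj) (hy _).symm, ?_⟩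
  intro j' hj' hjj
  exact hk _ (hmem j hj) _ (hmem j' hj') (fun e => hjj (hevinj hj hj' e))

end OddCycle

end Piercing

/-! ### Counting the colors of a pierced coloring. -/

section PiercingCount

variable {V K : Type*} [DecidableEq V] {c : V → V → K} {r : ℕ} {v : ZMod (2 * r + 1) → V}

lemma ZMod.exists_alternating (i z : ZMod (2 * r + 1)) :
    (∃ j ≤ r, z = i + 1 + (2 * j : ℕ)) ∨ ∃ j < r, z = i + 2 + (2 * j : ℕ) := by
  have hz : z = i + 1 + ((z - i - 1).val : ℕ) := by
    rw [ZMod.natCast_zmod_val]; ring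
  have hlt := ZMod.val_lt (z - i - 1)
  rcases Nat.even_or_odd' (z - i - 1).val with ⟨j, hj | hj⟩
  · exact Or.inl ⟨j, by omega, by rw [← hj]; exact hz⟩
  · refine Or.inr ⟨j, by omega, ?_⟩
    rw [hj] at hz
    rw [hz]; push_cast; ring

/-- If every `2 * r + 2` vertices contain a monochromatic set of `r + 2` vertices and some edge
disjoint from a rainbow cycle of length `2 * r + 1` has a color not on the cycle, there are few
colors. -/
theorem HasMonoCliques.card_colors_add_le [Fintype V] [DecidableEq K]
    (hc : ∀ x y, c x y = c y x) (hr : 2 ≤ r)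
    (h : HasMonoCliques c (2 * r + 2) (r + 2)) (hv : IsRainbowCycle c v) {a b : V}
    (ha : ∀ z, v z ≠ a) (hb : ∀ z, v z ≠ b) (hab : a ≠ b)
    (hnew : ∀ z, c a b ≠ c (v z) (v (z + 1))) :
    (colorsIn c Finset.univ).card + r * (2 * r + 3) ≤
      r * (r + 1) + 2 + r * Fintype.card V := by
  classical
  have hty : ∀ x, ∃ i, (∀ z, v z ≠ x) → HasType c v x i := by
    intro x
    by_cases hx : ∀ z, v z ≠ x
    · obtain ⟨i, hi⟩ := h.exists_type (by omega) hv hx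
      exact ⟨i, fun _ => hi⟩
    · exact ⟨0, fun h => absurd h hx⟩
  choose τ hτ using hty
  set C := Finset.univ.image v with hC
  have hvC : ∀ z, v z ∈ C := fun z => Finset.mem_image_of_mem _ (Finset.mem_univ _)
  have hCmem : ∀ x, x ∉ C → ∀ z, v z ≠ x := fun x hx z e => hx (e ▸ hvC z)
  have : Fact (1 < 2 * r + 1) := ⟨by omega⟩
  set A := colorsIn c C with hA
  have hAmem : ∀ z w, z ≠ w → c (v z) (v w) ∈ A := fun z w hzw =>
    mem_colorsIn.2 ⟨_, hvC z, _, hvC w, hv.injective.ne hzw, rfl⟩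
  have hcyc : ∀ z, c (v z) (v (z + 1)) ∈ A := fun z => hAmem _ _ (by simp)
  have hE : ∀ i : ZMod (2 * r + 1), i + 2 + (2 * 0 : ℕ) ≠ i + 2 + (2 * 1 : ℕ) := by
    intro i e
    have := ZMod.natCast_injOn (by omega) (by omega) (add_left_cancel e)
    omega
  have hab1 := h.type_eq hc (by omega) hv ha hb hab hnew (hτ a ha) (hτ b hb)
  have hmono := h.mono_of_type_eq (by omega) hv ha hb hab hnew (hτ a ha)
    (hab1 ▸ hτ b hb)
  -- Since `r ≥ 2`, the class of remaining cycle vertices contains an edge, which has the color of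
  -- `ab`.
  have habA : c a b ∈ A := by
    rw [← (hmono 0 (by omega)).2.2 1 (by omega) (by omega)]
    exact hAmem _ _ (hE _)
  -- Each of the two alternating classes, of sizes `r + 1` and `r`, is monochromatic; only the edges
  -- between them can add further colors.
  have hAcard : A.card ≤ (r + 1) * r + 2 := by
    have hsub : A ⊆ insert (c (v (τ a)) (v (τ a + 1))) (insert (c a b)
        ((Finset.range (r + 1) ×ˢ Finset.range r).image fun p =>
          c (v (τ a + 1 + (2 * p.1 : ℕ))) (v (τ a + 2 + (2 * p.2 : ℕ))))) := by
      intro k hk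
      obtain ⟨x, hx, y, hy, hxy, rfl⟩ := mem_colorsIn.1 hk
      obtain ⟨z, -, rfl⟩ := Finset.mem_image.1 hx
      obtain ⟨w, -, rfl⟩ := Finset.mem_image.1 hy
      simp only [Finset.mem_insert, Finset.mem_image, Finset.mem_product, Finset.mem_range,
        Prod.exists]
      rcases ZMod.exists_alternating (τ a) z with ⟨j, hj, rfl⟩ | ⟨j, hj, rfl⟩ <;>
        rcases ZMod.exists_alternating (τ a) w with ⟨j', hj', rfl⟩ | ⟨j', hj', rfl⟩
      · exact Or.inl ((hτ a ha j hj).2 j' hj' (by rintro rfl; exact hxy rfl))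
      · exact Or.inr (Or.inr ⟨j, j', ⟨by omega, hj'⟩, rfl⟩)
      · exact Or.inr (Or.inr ⟨j', j, ⟨by omega, hj⟩, hc _ _⟩)
      · exact Or.inr (Or.inl ((hmono j hj).2.2 j' hj' (by rintro rfl; exact hxy rfl)))
    refine (Finset.card_le_card hsub).trans ((Finset.card_insert_le _ _).trans ?_)
    have h1 := Finset.card_insert_le (c a b)
      ((Finset.range (r + 1) ×ˢ Finset.range r).image fun p =>
          c (v (τ a + 1 + (2 * p.1 : ℕ))) (v (τ a + 2 + (2 * p.2 : ℕ))))
    have h2 := Finset.card_image_le (s := Finset.range (r + 1) ×ˢ Finset.range r)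
      (f := fun p => c (v (τ a + 1 + (2 * p.1 : ℕ))) (v (τ a + 2 + (2 * p.2 : ℕ))))
    rw [Finset.card_product, Finset.card_range, Finset.card_range] at h2
    omega
  set R := (C ∪ {a, b})ᶜ with hR
  have hRcard : R.card + (2 * r + 3) = Fintype.card V := by
    have h1 : (C ∪ {a, b}).card = 2 * r + 3 := by
      rw [Finset.card_union_of_disjoint, Finset.card_pair hab, hC,
        Finset.card_image_of_injective _ hv.injective, Finset.card_univ, ZMod.card]
      rw [Finset.disjoint_left]
      intro x hx hx'
      obtain ⟨z, -, rfl⟩ := Finset.mem_image.1 hx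
      rcases Finset.mem_insert.1 hx' with hx' | hx'
      · exact ha z hx'
      · exact hb z (Finset.mem_singleton.1 hx')
    rw [← h1, Finset.card_compl_add_card]
  set B := R.biUnion fun x => (Finset.range r).image fun j => c x (v (τ x + 2 + (2 * j : ℕ)))
    with hB
  have hBcard : B.card ≤ R.card * r := by
    apply Finset.card_biUnion_le_card_mul
    intro x _
    exact Finset.card_image_le.trans (Finset.card_range r).le
  -- An outside vertex other than `a` and `b` contributes at most `r` colors beyond `A`, on its
  -- edges to the smaller class of its own type; `a` and `b` contribute none.
  have hout : ∀ x, x ∉ C → ∀ y ∈ C, c x y ∈ A ∪ B := by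
    intro x hx y hy
    obtain ⟨z, -, rfl⟩ := Finset.mem_image.1 hy
    rcases ZMod.exists_alternating (τ x) z with ⟨j, hj, rfl⟩ | ⟨j, hj, rfl⟩
    · rw [(hτ x (hCmem x hx) j hj).1]
      exact Finset.mem_union_left _ (hcyc _)
    · by_cases hxa : x = a
      · subst hxa
        rw [(hmono j hj).1]
        exact Finset.mem_union_left _ habA
      by_cases hxb : x = b
      · subst hxb
        rw [← hab1, (hmono j hj).2.1]
        exact Finset.mem_union_left _ habA
      · apply Finset.mem_union_right
        rw [hB, Finset.mem_biUnion]
        refine ⟨x, ?_, Finset.mem_image.2 ⟨j, Finset.mem_range.2 hj, rfl⟩⟩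
        simp only [hR, Finset.mem_compl, Finset.mem_union, Finset.mem_insert,
          Finset.mem_singleton]
        tauto
  have hall : colorsIn c Finset.univ ⊆ A ∪ B := by
    intro k hk
    obtain ⟨x, -, y, -, hxy, rfl⟩ := mem_colorsIn.1 hk
    by_cases hx : x ∈ C <;> by_cases hy : y ∈ C
    · exact Finset.mem_union_left _ (mem_colorsIn.2 ⟨x, hx, y, hy, hxy, rfl⟩)
    · rw [hc]; exact hout y hy x hx
    · exact hout x hx y hy
    · apply Finset.mem_union_left
      by_cases hn : ∀ z, c x y ≠ c (v z) (v (z + 1))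
      · have h1 := h.type_eq hc (by omega) hv (hCmem x hx) (hCmem y hy) hxy hn
          (hτ x (hCmem x hx)) (hτ y (hCmem y hy))
        have h2 := h.mono_of_type_eq (by omega) hv (hCmem x hx) (hCmem y hy) hxy hn
          (hτ x (hCmem x hx)) (h1 ▸ hτ y (hCmem y hy))
        rw [← (h2 0 (by omega)).2.2 1 (by omega) (by omega)]
        exact hAmem _ _ (hE _)
      · push Not at hn
        obtain ⟨z, hz⟩ := hn
        rw [hz]
        exact hcyc z
  have h1 := (Finset.card_le_card hall).trans (Finset.card_union_le _ _)
  rw [← hRcard]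
  nlinarith

end PiercingCount

/-! ### Translation to labelings and copies of graphs. -/

/-- The images of distinct edges of `H` under `φ` have distinct colors. -/
def HasRainbowEdges {V W K : Type*} (c : V → V → K) (H : SimpleGraph W) (φ : W → V) : Prop :=
  ∀ u v u' v', H.Adj u v → H.Adj u' v' → c (φ u) (φ v) = c (φ u') (φ v') → s(u, v) = s(u', v')

section RainbowEdges

variable {V W W' K : Type*} {c : V → V → K} {H : SimpleGraph W} {H' : SimpleGraph W'}

lemma HasRainbowEdges.comp {φ : W → V} (h : HasRainbowEdges c H φ) (e : H' ↪g H) :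
    HasRainbowEdges c H' (φ ∘ e) := by
  intro u v u' v' huv huv' heq
  have := h _ _ _ _ (e.map_adj_iff.2 huv) (e.map_adj_iff.2 huv') heq
  exact Sym2.map.injective e.injective (by simpa using this)

lemma HasRainbowEdges.sum_completeGraph (hc : ∀ x y, c x y = c y x) {φ : W → V}
    (h : HasRainbowEdges c H φ) {ψ : Fin 2 → V}
    (hne : ∀ u v, H.Adj u v → c (φ u) (φ v) ≠ c (ψ 0) (ψ 1)) :
    HasRainbowEdges c (H ⊕g completeGraph (Fin 2)) (Sum.elim φ ψ) := by
  have hfin : ∀ a b : Fin 2, a ≠ b → s(a, b) = s(0, 1) ∧ c (ψ a) (ψ b) = c (ψ 0) (ψ 1) := by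
    intro a b hab
    fin_cases a <;> fin_cases b <;> simp_all
  rintro (u | u) (v | v) (u' | u') (v' | v') huv huv' heq
  all_goals simp only [SimpleGraph.sum_adj, SimpleGraph.top_adj, completeGraph] at huv huv'
  all_goals simp only [Sum.elim_inl, Sum.elim_inr] at heq
  · have := congrArg (Sym2.map (Sum.inl (β := Fin 2))) (h _ _ _ _ huv huv' heq)
    simpa using this
  · exact absurd (heq.trans (hfin _ _ huv').2) (hne _ _ huv)
  · exact absurd (heq.symm.trans (hfin _ _ huv).2) (hne _ _ huv')
  · have := congrArg (Sym2.map (Sum.inr (α := W))) ((hfin _ _ huv).1.trans (hfin _ _ huv').1.symm)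
    simpa using this

lemma cycleGraph_adj_iff_mod {N : ℕ} (hN : 2 ≤ N) {u v : Fin N} :
    (cycleGraph N).Adj u v ↔ v.val = (u.val + 1) % N ∨ u.val = (v.val + 1) % N := by
  have hmod : ∀ w : Fin N, (w.val + 1) % N = if w.val + 1 = N then 0 else w.val + 1 := by
    intro w
    split_ifs with h
    · rw [h, Nat.mod_self]
    · exact Nat.mod_eq_of_lt (by omega)
  have hsub : ∀ w w' : Fin N, (w - w').val =
      if w' ≤ w then w.val - w'.val else N + w.val - w'.val := by
    intro w w'
    split_ifs with h
    · exact Fin.coe_sub_iff_le.2 h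
    · exact Fin.coe_sub_iff_lt.2 (not_le.1 h)
  rw [cycleGraph_adj', hsub, hsub, hmod, hmod]
  simp only [Fin.le_def]
  split_ifs <;> omega

lemma eq_of_cycle_edge_eq {N i j : ℕ} (hN : 3 ≤ N) (hi : i < N) (hj : j < N)
    (h1 : i = (j + 1) % N) (h2 : (i + 1) % N = j) : False := by
  rcases Nat.lt_or_ge (j + 1) N with h | h
  · rw [Nat.mod_eq_of_lt h] at h1
    rcases Nat.lt_or_ge (i + 1) N with h' | h'
    · rw [Nat.mod_eq_of_lt h'] at h2; omega
    · rw [show i + 1 = N by omega, Nat.mod_self] at h2; omega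
  · rw [show j + 1 = N by omega, Nat.mod_self] at h1
    subst h1
    rw [Nat.mod_eq_of_lt (by omega)] at h2; omega

lemma RainbowCycle.hasRainbowEdges {N : ℕ} (hN : 2 ≤ N) (hc : ∀ x y, c x y = c y x) {f : ℕ → V}
    (hf : RainbowCycle c N f) : HasRainbowEdges c (cycleGraph N) fun i => f i.val := by
  have key : ∀ u v : Fin N, (cycleGraph N).Adj u v → ∃ i : Fin N,
      s(u, v) = s(i, ⟨(i.val + 1) % N, Nat.mod_lt _ (by omega)⟩) ∧
      c (f u) (f v) = c (f i) (f ((i.val + 1) % N)) := by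
    intro u v huv
    rcases (cycleGraph_adj_iff_mod hN).1 huv with h | h
    · exact ⟨u, by simp [← h], by rw [h]⟩
    · refine ⟨v, ?_, by rw [hc, ← h]⟩
      rw [Sym2.eq_swap]
      simp [← h]
  intro u v u' v' huv huv' heq
  obtain ⟨i, hi, hi'⟩ := key u v huv
  obtain ⟨j, hj, hj'⟩ := key u' v' huv'
  have : i = j := Fin.ext (hf.2 i.2 j.2 (hi'.symm.trans (heq.trans hj')))
  rw [hi, hj, this]

lemma HasRainbowEdges.rainbowCycle {N : ℕ} (hN : 3 ≤ N) {φ : Fin N → V}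
    (hφ : Function.Injective φ) (h : HasRainbowEdges c (cycleGraph N) φ) :
    RainbowCycle c N fun i => φ ⟨i % N, Nat.mod_lt _ (by omega)⟩ := by
  constructor
  · intro i hi j hj hij
    have := congrArg Fin.val (hφ hij)
    simpa [Nat.mod_eq_of_lt (Set.mem_Iio.1 hi), Nat.mod_eq_of_lt (Set.mem_Iio.1 hj)] using this
  · intro i hi j hj hij
    rw [Set.mem_Iio] at hi hj
    have hadj : ∀ k (hk : k < N), (cycleGraph N).Adj ⟨k % N, Nat.mod_lt _ (by omega)⟩
        ⟨(k + 1) % N % N, Nat.mod_lt _ (by omega)⟩ := fun k hk => by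
      rw [cycleGraph_adj_iff_mod (by omega)]
      left
      simp
    have := h _ _ _ _ (hadj i hi) (hadj j hj) hij
    simp only [Sym2.eq_iff, Fin.mk.injEq, Nat.mod_mod, Nat.mod_eq_of_lt hi,
      Nat.mod_eq_of_lt hj] at this
    rcases this with h1 | h1
    · exact h1.1
    · exact (eq_of_cycle_edge_eq hN hi hj h1.1 h1.2).elim

end RainbowEdges

section Labeling

variable {n m : ℕ} {W : Type} {H : SimpleGraph W}

/-- The color of the edge between `x` and `y`, if these vertices are distinct. -/
def pairColor (C : TopEdgeLabeling (Fin n) (Fin m)) (x y : Fin n) : Option (Fin m) :=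
  if h : x ≠ y then some (C.get x y h) else none

lemma pairColor_comm (C : TopEdgeLabeling (Fin n) (Fin m)) (x y : Fin n) :
    pairColor C x y = pairColor C y x := by
  unfold pairColor
  by_cases h : x = y
  · simp [h]
  · rw [dif_pos h, dif_pos (Ne.symm h), EdgeLabeling.get_comm]

lemma pairColor_of_ne (C : TopEdgeLabeling (Fin n) (Fin m)) {x y : Fin n} (h : x ≠ y) :
    pairColor C x y = some (C ⟨s(x, y), h⟩) :=
  dif_pos h

lemma card_colorsIn_pairColor {C : TopEdgeLabeling (Fin n) (Fin m)} (hC : UsesAllColors C) :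
    (colorsIn (pairColor C) Finset.univ).card = m := by
  have : colorsIn (pairColor C) Finset.univ = Finset.univ.map Function.Embedding.some := by
    ext k
    rw [mem_colorsIn, Finset.mem_map]
    constructor
    · rintro ⟨x, -, y, -, hxy, rfl⟩
      exact ⟨_, Finset.mem_univ _, (pairColor_of_ne C hxy).symm⟩
    · rintro ⟨k, -, rfl⟩
      obtain ⟨⟨e, he⟩, rfl⟩ := hC k
      induction e using Sym2.inductionOn with
      | hf x y => exact ⟨x, Finset.mem_univ _, y, Finset.mem_univ _, he, pairColor_of_ne C he⟩
  rw [this, Finset.card_map, Finset.card_univ, Fintype.card_fin]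

lemma pairColor_apply_copy (C : TopEdgeLabeling (Fin n) (Fin m))
    (φ : Copy H (⊤ : SimpleGraph (Fin n))) {u v : W} (h : H.Adj u v) :
    pairColor C (φ u) (φ v) = some (C (φ.mapEdgeSet ⟨s(u, v), h⟩)) :=
  pairColor_of_ne C (φ.injective.ne h.ne)

lemma isRainbow_iff (C : TopEdgeLabeling (Fin n) (Fin m))
    (φ : Copy H (⊤ : SimpleGraph (Fin n))) :
    IsRainbow C φ ↔ HasRainbowEdges (pairColor C) H φ := by
  constructor
  · intro h u v u' v' huv huv' heq
    rw [pairColor_apply_copy C φ huv, pairColor_apply_copy C φ huv', Option.some_inj] at heq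
    exact congrArg Subtype.val (h heq)
  · rintro h ⟨e, he⟩ ⟨e', he'⟩ heq
    induction e using Sym2.inductionOn with
    | hf u v =>
      induction e' using Sym2.inductionOn with
      | hf u' v' =>
        refine Subtype.ext (h u v u' v' he he' ?_)
        rw [pairColor_apply_copy C φ he, pairColor_apply_copy C φ he', Option.some_inj]
        exact heq

/-- An injective map from the vertices of `H` gives a copy of `H` in a complete graph. -/
def copyOfInjective {V : Type*} (H : SimpleGraph W) {φ : W → V} (hφ : Function.Injective φ) :
    Copy H (⊤ : SimpleGraph V) :=
  ⟨⟨φ, fun h => hφ.ne h.ne⟩, hφ⟩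

lemma exists_isRainbow_iff (C : TopEdgeLabeling (Fin n) (Fin m)) :
    (∃ φ : Copy H (⊤ : SimpleGraph (Fin n)), IsRainbow C φ) ↔
      ∃ φ : W → Fin n, Function.Injective φ ∧ HasRainbowEdges (pairColor C) H φ :=
  ⟨fun ⟨φ, hφ⟩ => ⟨φ, φ.injective, (isRainbow_iff C φ).1 hφ⟩,
    fun ⟨_, hφ, h⟩ => ⟨copyOfInjective H hφ, (isRainbow_iff C _).2 h⟩⟩

lemma exists_isRainbow_pairFamily_iff (C : TopEdgeLabeling (Fin n) (Fin m)) {N : ℕ}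
    (hN : 3 ≤ N) :
    (∃ (W : Type) (H : SimpleGraph W),
      pairFamily (cycleGraph N ⊕g completeGraph (Fin 2)) (cycleGraph (N + 1)) W H ∧
        ∃ φ : Copy H (⊤ : SimpleGraph (Fin n)), IsRainbow C φ) ↔
      (∃ f a b, RainbowCycle (pairColor C) N f ∧ a ≠ b ∧ (∀ i < N, f i ≠ a) ∧
        (∀ i < N, f i ≠ b) ∧
        ∀ i < N, pairColor C a b ≠ pairColor C (f i) (f ((i + 1) % N))) ∨
      ∃ f, RainbowCycle (pairColor C) (N + 1) f := by
  have hc := pairColor_comm C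
  simp only [exists_isRainbow_iff]
  constructor
  · rintro ⟨W, H, hH | hH, φ, hφ, hr⟩
    · left
      obtain ⟨e⟩ := hH
      have h1 := hr.comp e.symm.toEmbedding
      have hφ1 : Function.Injective (φ ∘ e.symm.toEmbedding) :=
        hφ.comp e.symm.toEmbedding.injective
      set ψ := φ ∘ e.symm.toEmbedding with hψ
      have h2 := h1.comp (Embedding.sumInl (G := cycleGraph N) (H := completeGraph (Fin 2)))
      have h3 := h2.rainbowCycle hN (hφ1.comp Sum.inl_injective)
      refine ⟨_, ψ (Sum.inr 0), ψ (Sum.inr 1), h3, ?_, ?_, ?_, ?_⟩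
      · exact hφ1.ne (by simp)
      · intro i _
        exact hφ1.ne (by simp)
      · intro i _
        exact hφ1.ne (by simp)
      · intro i hi heq
        have := h1 (Sum.inr 0) (Sum.inr 1) _ _ (by simp [completeGraph]) ?_ heq
        · simp at this
        · change (cycleGraph N).Adj _ _
          rw [cycleGraph_adj_iff_mod (by omega)]
          left
          simp
    · right
      obtain ⟨e⟩ := hH
      exact ⟨_, (hr.comp e.symm.toEmbedding).rainbowCycle (by omega)
        (hφ.comp e.symm.toEmbedding.injective)⟩
  · rintro (⟨f, a, b, hf, hab, ha, hb, hne⟩ | ⟨f, hf⟩)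
    · refine ⟨_, _, Or.inl ⟨Iso.refl⟩, Sum.elim (fun i => f i.val) ![a, b], ?_,
        (hf.hasRainbowEdges (by omega) hc).sum_completeGraph hc ?_⟩
      · rintro (i | i) (j | j) hij
        · exact congrArg Sum.inl (Fin.ext (hf.1 i.2 j.2 hij))
        · fin_cases j
          · exact absurd hij (ha _ i.2)
          · exact absurd hij (hb _ i.2)
        · fin_cases i
          · exact absurd hij.symm (ha _ j.2)
          · exact absurd hij.symm (hb _ j.2)
        · fin_cases i <;> fin_cases j
          · rfl
          · exact absurd hij hab
          · exact absurd hij.symm hab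
          · rfl
      · intro u v huv heq
        simp only [Matrix.cons_val_zero, Matrix.cons_val_one] at heq
        rcases (cycleGraph_adj_iff_mod (by omega)).1 huv with h | h
        · exact hne _ u.2 (by rw [← heq, h])
        · exact hne _ v.2 (by rw [← heq, hc, h])
    · exact ⟨_, _, Or.inr ⟨Iso.refl⟩, fun i => f i.val,
        fun i j hij => Fin.ext (hf.1 i.2 j.2 hij), hf.hasRainbowEdges (by omega) hc⟩

lemma colorGraph_adj {C : TopEdgeLabeling (Fin n) (Fin m)}
    {φ : Copy H (⊤ : SimpleGraph (Fin n))} {k : Fin m} {x y : Fin n} :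
    (colorGraph C φ k).Adj x y ↔
      (∃ u v, H.Adj u v ∧ φ u = x ∧ φ v = y) ∧ pairColor C x y = some k := by
  rw [colorGraph, SimpleGraph.inf_adj, EdgeLabeling.labelGraph_adj]
  refine and_congr ?_ ?_
  · simp [Relation.Map]
  · constructor
    · rintro ⟨h, rfl⟩
      exact pairColor_of_ne C h
    · intro h
      by_cases hxy : x = y
      · simp [pairColor, hxy] at h
      · rw [pairColor_of_ne C hxy, Option.some_inj] at h
        exact ⟨hxy, h⟩

/-- With `2 ≤ q`, every vertex of a monochromatic clique on `q` vertices lies in the support of its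
color class, so discarding isolated vertices loses nothing. -/
lemma isPierced_completeGraph_iff {p q : ℕ} (hq : 2 ≤ q)
    {C : TopEdgeLabeling (Fin n) (Fin m)}
    (φ : Copy (completeGraph (Fin p)) (⊤ : SimpleGraph (Fin n))) :
    IsPierced (upFamily (completeGraph (Fin q))) C φ ↔
      ∃ T : Finset (Fin n), (∀ x ∈ T, ∃ u, φ u = x) ∧ T.card = q ∧
        ∃ k, ∀ x ∈ T, ∀ y ∈ T, x ≠ y → pairColor C x y = some k := by
  classical
  constructor
  · rintro ⟨k, -, ⟨ψ⟩⟩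
    set g : Fin q → Fin n := fun i => (ψ i).val with hg
    have hadj : ∀ i j, i ≠ j → (colorGraph C φ k).Adj (g i) (g j) := fun i j hij =>
      ψ.toHom.map_adj (show (completeGraph (Fin q)).Adj i j from hij)
    refine ⟨Finset.univ.image g, ?_, ?_, k, ?_⟩
    · intro x hx
      obtain ⟨i, -, rfl⟩ := Finset.mem_image.1 hx
      have : Nontrivial (Fin q) := Fin.nontrivial_iff_two_le.2 hq
      obtain ⟨j, hj⟩ := exists_ne i
      obtain ⟨⟨u, _, _, hu, _⟩, _⟩ := colorGraph_adj.1 (hadj i j hj.symm)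
      exact ⟨u, hu⟩
    · rw [Finset.card_image_of_injective, Finset.card_univ, Fintype.card_fin]
      exact Subtype.val_injective.comp ψ.injective
    · intro x hx y hy hxy
      obtain ⟨i, -, rfl⟩ := Finset.mem_image.1 hx
      obtain ⟨j, -, rfl⟩ := Finset.mem_image.1 hy
      exact (colorGraph_adj.1 (hadj i j fun e => hxy (by rw [e]))).2
  · rintro ⟨T, hT, hcard, k, hk⟩
    have hadj : ∀ x ∈ T, ∀ y ∈ T, x ≠ y → (colorGraph C φ k).Adj x y := by
      intro x hx y hy hxy
      obtain ⟨u, rfl⟩ := hT x hx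
      obtain ⟨v, rfl⟩ := hT y hy
      exact colorGraph_adj.2 ⟨⟨u, v, fun e => hxy (by rw [e]), rfl, rfl⟩, hk _ hx _ hy hxy⟩
    have hsupp : ∀ x ∈ T, x ∈ (colorGraph C φ k).support := by
      intro x hx
      obtain ⟨y, hy, hxy⟩ := Finset.exists_mem_ne (show 1 < T.card by omega) x
      exact ⟨y, hadj x hx y hy hxy.symm⟩
    refine ⟨k, ?_, ?_⟩
    · obtain ⟨x, hx, y, hy, hxy⟩ := Finset.one_lt_card.1 (show 1 < T.card by omega)
      intro h
      have := hadj x hx y hy hxy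
      rw [h] at this
      exact this
    · set e := T.orderEmbOfFin hcard with he
      have hmem : ∀ i, e i ∈ T := fun i => T.orderEmbOfFin_mem hcard i
      refine ⟨⟨⟨fun i => ⟨e i, hsupp _ (hmem i)⟩, ?_⟩, ?_⟩⟩
      · intro i j hij
        exact hadj _ (hmem i) _ (hmem j) (e.injective.ne hij)
      · intro i j hij
        exact e.injective (Subtype.mk_eq_mk.1 hij)

lemma hasMonoCliques_of_isPierced {p q : ℕ} (hq : 2 ≤ q) {C : TopEdgeLabeling (Fin n) (Fin m)}
    (h : ∀ φ : Copy (completeGraph (Fin p)) (⊤ : SimpleGraph (Fin n)),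
      IsPierced (upFamily (completeGraph (Fin q))) C φ) : HasMonoCliques (pairColor C) p q := by
  intro S hS
  have hinj : Function.Injective (S.orderEmbOfFin hS) := (S.orderEmbOfFin hS).injective
  obtain ⟨T, hT, hcard, k, hk⟩ :=
    (isPierced_completeGraph_iff hq _).1 (h (copyOfInjective (completeGraph (Fin p)) hinj))
  refine ⟨T, fun x hx => ?_, hcard, _, hk⟩
  obtain ⟨u, rfl⟩ := hT x hx
  exact S.orderEmbOfFin_mem hS u

end Labeling

/-! ### The lower-bound construction. -/

section LowerBound

variable {n : ℕ}

lemma card_le_choose_two_of_usesAllColors {m : ℕ} {C : TopEdgeLabeling (Fin n) (Fin m)}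
    (hC : UsesAllColors C) : m ≤ n.choose 2 := by
  have := card_colorsIn_le (pairColor_comm C) Finset.univ
  rwa [card_colorsIn_pairColor hC, Finset.card_univ, Fintype.card_fin] at this

lemma bddAbove_piercing {W : Type} (G : SimpleGraph W) (𝓕 : GraphFamily) :
    BddAbove {m : ℕ | ∃ C : TopEdgeLabeling (Fin n) (Fin m), UsesAllColors C ∧
      ∀ φ : Copy G (⊤ : SimpleGraph (Fin n)), IsPierced 𝓕 C φ} :=
  ⟨n.choose 2, fun _ ⟨_, hC, _⟩ => card_le_choose_two_of_usesAllColors hC⟩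

/-- Any edge labeling can be turned into one that uses each of finitely many colors. -/
lemma exists_usesAllColors {K : Type*} [DecidableEq K] (κ : TopEdgeLabeling (Fin n) K) :
    ∃ C : TopEdgeLabeling (Fin n) (Fin (Finset.univ.image κ).card), UsesAllColors C ∧
      ∀ e e', C e = C e' ↔ κ e = κ e' := by
  refine ⟨fun e => (Finset.univ.image κ).equivFin
    ⟨κ e, Finset.mem_image_of_mem _ (Finset.mem_univ e)⟩, ?_, fun e e' => by simp⟩
  intro k
  obtain ⟨⟨x, hx⟩, rfl⟩ := (Finset.univ.image κ).equivFin.surjective k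
  obtain ⟨e, -, rfl⟩ := Finset.mem_image.1 hx
  exact ⟨e, rfl⟩

/-- Edges meeting the first `r` vertices get colors of their own, and all other edges share one
color. -/
def starLabeling (n r : ℕ) : TopEdgeLabeling (Fin n) (Option (ℕ × ℕ)) :=
  EdgeLabeling.mk
    (fun x y _ => if min x.val y.val < r then some (min x.val y.val, max x.val y.val) else none)
    fun x y _ => by rw [min_comm, max_comm]

lemma starLabeling_apply {r : ℕ} {x y : Fin n} (h : x ≠ y) :
    starLabeling n r ⟨s(x, y), h⟩ =
      if min x.val y.val < r then some (min x.val y.val, max x.val y.val) else none :=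
  rfl

lemma sum_sub_add_choose {r : ℕ} (hn : r ≤ n) :
    ∑ a ∈ Finset.range r, (n - a - 1) + (r + 1).choose 2 = r * n := by
  induction r with
  | zero => simp
  | succ r ih =>
    have h1 := ih (by omega)
    have h2 : (r + 1 + 1).choose 2 = (r + 1) + (r + 1).choose 2 := by
      rw [Nat.choose_succ_succ' (r + 1) 1, Nat.choose_one_right]
    rw [Finset.sum_range_succ, h2, Nat.succ_mul]
    omega

lemma le_card_image_starLabeling {r : ℕ} (hn : r + 2 ≤ n) :
    r * n + 1 ≤ (Finset.univ.image (starLabeling n r)).card + (r + 1).choose 2 := by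
  set S := (Finset.range r).sigma fun a => Finset.Ioo a n with hS
  set g : (Σ _ : ℕ, ℕ) → Option (ℕ × ℕ) := fun p => some (p.1, p.2) with hg
  have hinj : Function.Injective g := by
    rintro ⟨a, y⟩ ⟨a', y'⟩ h
    simpa [hg] using h
  have hcard : (insert none (S.image g)).card = ∑ a ∈ Finset.range r, (n - a - 1) + 1 := by
    rw [Finset.card_insert_of_notMem (by simp [hg]), Finset.card_image_of_injective _ hinj, hS,
      Finset.card_sigma]
    simp
  have hsub : insert none (S.image g) ⊆ Finset.univ.image (starLabeling n r) := by
    intro k hk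
    refine Finset.mem_image.2 ?_
    rcases Finset.mem_insert.1 hk with rfl | hk
    · have hne : (⟨r, by omega⟩ : Fin n) ≠ ⟨r + 1, by omega⟩ := by simp
      refine ⟨⟨s(_, _), hne⟩, Finset.mem_univ _, ?_⟩
      rw [starLabeling_apply hne, if_neg (by simp)]
    · obtain ⟨⟨a, y⟩, h, rfl⟩ := Finset.mem_image.1 hk
      simp only [hS, Finset.mem_sigma, Finset.mem_range, Finset.mem_Ioo] at h
      have hne : (⟨a, by omega⟩ : Fin n) ≠ ⟨y, h.2.2⟩ := by
        simpa using h.2.1.ne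
      refine ⟨⟨s(_, _), hne⟩, Finset.mem_univ _, ?_⟩
      rw [starLabeling_apply hne]
      simp only [min_eq_left h.2.1.le, max_eq_right h.2.1.le, if_pos h.1, hg]
  have h1 := Finset.card_le_card hsub
  have h2 := sum_sub_add_choose (n := n) (r := r) (by omega)
  omega

/-- A coloring with many colors in which every `2 * r + 2` vertices contain a monochromatic set
of `r + 2` vertices. -/
theorem exists_pierced_labeling {r : ℕ} (hn : r + 2 ≤ n) :
    ∃ m, r * n + 1 ≤ m + (r + 1).choose 2 ∧ ∃ C : TopEdgeLabeling (Fin n) (Fin m),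
      UsesAllColors C ∧ ∀ φ : Copy (completeGraph (Fin (2 * r + 2))) (⊤ : SimpleGraph (Fin n)),
        IsPierced (upFamily (completeGraph (Fin (r + 2)))) C φ := by
  obtain ⟨C, hC, hCe⟩ := exists_usesAllColors (starLabeling n r)
  refine ⟨_, le_card_image_starLabeling hn, C, hC, fun φ => ?_⟩
  rw [isPierced_completeGraph_iff (by omega)]
  set P := Finset.univ.image φ with hP
  have hPcard : P.card = 2 * r + 2 :=
    (Finset.card_image_of_injective _ φ.injective).trans (by simp)
  -- At most `r` of the `2r + 2` vertices are special, and edges among the remaining ones share the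
  -- color `none`.
  have hsmall : (P.filter fun x => x.val < r).card ≤ r := by
    have h1 : ((P.filter fun x => x.val < r).image Fin.val).card =
        (P.filter fun x => x.val < r).card := Finset.card_image_of_injective _ Fin.val_injective
    rw [← h1]
    refine (Finset.card_le_card (t := Finset.range r) ?_).trans (Finset.card_range r).le
    intro a ha
    obtain ⟨x, hx, rfl⟩ := Finset.mem_image.1 ha
    exact Finset.mem_range.2 (Finset.mem_filter.1 hx).2
  have hsplit := Finset.card_filter_add_card_filter_not (s := P) (fun x => x.val < r)
  obtain ⟨T, hT, hTcard⟩ := Finset.exists_subset_card_eq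
    (show r + 2 ≤ (P.filter fun x => ¬x.val < r).card by omega)
  have hne : (⟨r, by omega⟩ : Fin n) ≠ ⟨r + 1, by omega⟩ := by simp
  refine ⟨T, fun x hx => ?_, hTcard, C ⟨s(_, _), hne⟩, fun x hx y hy hxy => ?_⟩
  · obtain ⟨u, -, hu⟩ := Finset.mem_image.1 (Finset.mem_filter.1 (hT hx)).1
    exact ⟨u, hu⟩
  · have h1 := (Finset.mem_filter.1 (hT hx)).2
    have h2 := (Finset.mem_filter.1 (hT hy)).2
    rw [pairColor_of_ne C hxy, Option.some_inj, hCe, starLabeling_apply hxy,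
      starLabeling_apply hne, if_neg (min_lt_iff.not.2 (not_or.2 ⟨h1, h2⟩)), if_neg (by simp)]

end LowerBound

/-! ### Combination of the bounds. -/

section Bounds

variable {n m r : ℕ}

lemma exists_rainbow_of_antiRamsey_le {𝓗 : GraphFamily} {k : ℕ}
    (h : ∀ m : ℕ, k ≤ m → ∀ C : TopEdgeLabeling (Fin n) (Fin m), UsesAllColors C →
      ∃ (W : Type) (H : SimpleGraph W), 𝓗 W H ∧
        ∃ φ : Copy H (⊤ : SimpleGraph (Fin n)), IsRainbow C φ)
    (hm : antiRamsey n 𝓗 ≤ m) {C : TopEdgeLabeling (Fin n) (Fin m)} (hC : UsesAllColors C) :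
    ∃ (W : Type) (H : SimpleGraph W), 𝓗 W H ∧
      ∃ φ : Copy H (⊤ : SimpleGraph (Fin n)), IsRainbow C φ :=
  Nat.sInf_mem (s := {k : ℕ | ∀ m : ℕ, k ≤ m → ∀ C : TopEdgeLabeling (Fin n) (Fin m),
    UsesAllColors C → ∃ (W : Type) (H : SimpleGraph W), 𝓗 W H ∧
      ∃ φ : Copy H (⊤ : SimpleGraph (Fin n)), IsRainbow C φ}) ⟨k, h⟩ m hm C hC

/-- With at least `r * n` colors there is a rainbow member of the family. -/
theorem exists_rainbow_of_le (hr : 2 ≤ r) (hn : 2 * r + 2 ≤ n) (hm : r * n ≤ m)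
    {C : TopEdgeLabeling (Fin n) (Fin m)} (hC : UsesAllColors C) :
    ∃ (W : Type) (H : SimpleGraph W),
      pairFamily (cycleGraph (2 * r + 1) ⊕g completeGraph (Fin 2)) (cycleGraph (2 * r + 2)) W H ∧
        ∃ φ : Copy H (⊤ : SimpleGraph (Fin n)), IsRainbow C φ := by
  rw [exists_isRainbow_pairFamily_iff C (by omega)]
  by_contra hcon
  rw [not_or] at hcon
  have hcard := card_colorsIn_pairColor hC
  have : Nonempty (Fin n) := ⟨⟨0, by omega⟩⟩
  obtain ⟨f, hf | hf⟩ := exists_rainbowCycle_of_card_colors (pairColor_comm C) hr (by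
    rw [hcard, Fintype.card_fin]
    refine le_trans ?_ hm
    obtain ⟨k, rfl⟩ : ∃ k, n = k + 1 := ⟨n - 1, by omega⟩
    rw [Nat.add_sub_cancel, Nat.mul_succ]
    omega)
  · have := card_colors_lt_of_rainbowCycle (pairColor_comm C) hr (by rwa [Fintype.card_fin]) hf
      (fun g hg => hcon.2 ⟨g, hg⟩) (fun a b hab ha hb => by
        by_contra h
        push Not at h
        exact hcon.1 ⟨f, a, b, hf, hab, ha, hb, h⟩)
    rw [hcard, Fintype.card_fin] at this
    omega
  · exact hcon.2 ⟨f, hf⟩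

/-- A pierced coloring with many colors has no rainbow member of the family. -/
theorem not_exists_rainbow_of_isPierced (hr : 2 ≤ r) (hm : r * n + 1 ≤ m + (r + 1).choose 2)
    {C : TopEdgeLabeling (Fin n) (Fin m)} (hC : UsesAllColors C)
    (h : ∀ φ : Copy (completeGraph (Fin (2 * r + 2))) (⊤ : SimpleGraph (Fin n)),
      IsPierced (upFamily (completeGraph (Fin (r + 2)))) C φ) :
    ¬∃ (W : Type) (H : SimpleGraph W),
      pairFamily (cycleGraph (2 * r + 1) ⊕g completeGraph (Fin 2)) (cycleGraph (2 * r + 2)) W H ∧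
        ∃ φ : Copy H (⊤ : SimpleGraph (Fin n)), IsRainbow C φ := by
  rw [exists_isRainbow_pairFamily_iff C (by omega)]
  have hmono := hasMonoCliques_of_isPierced (by omega) h
  rintro (⟨f, a, b, hf, hab, ha, hb, hne⟩ | ⟨f, hf⟩)
  · have : Fact (1 < 2 * r + 1) := ⟨by omega⟩
    have := hmono.card_colors_add_le (pairColor_comm C) hr (hf.isRainbowCycle (by omega))
      (fun z => ha _ (ZMod.val_lt z)) (fun z => hb _ (ZMod.val_lt z)) hab (fun z => by
        have := hne _ (ZMod.val_lt z)
        rwa [ZMod.val_add, ZMod.val_one])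
    rw [card_colorsIn_pairColor hC, Fintype.card_fin] at this
    have h2 := two_mul_choose_two (r + 1)
    rw [Nat.add_sub_cancel] at h2
    -- The two color counts would give `r (r + 3) ≤ 2`, which is false for `r ≥ 2`.
    nlinarith
  · exact hmono.not_rainbowCycle hf

end Bounds

theorem theoremt (p q : ℕ) (hq : 4 ≤ q) (hp : p = 2 * q - 2) :
    ∃ n₀ : ℕ, ∀ n : ℕ, n₀ < n →
      ((p : ℤ) - q) * n - ((p - q + 1).choose 2 : ℕ) + 1
          ≤ (piercing n (completeGraph (Fin p)) (upFamily (completeGraph (Fin q))) : ℤ) ∧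
      piercing n (completeGraph (Fin p)) (upFamily (completeGraph (Fin q)))
          ≤ antiRamsey n
              (pairFamily (cycleGraph (2 * p - 2 * q + 1) ⊕g completeGraph (Fin 2))
                (cycleGraph (2 * p - 2 * q + 2))) ∧
      antiRamsey n
          (pairFamily (cycleGraph (2 * p - 2 * q + 1) ⊕g completeGraph (Fin 2))
            (cycleGraph (2 * p - 2 * q + 2)))
          ≤ (p - q) * n := by
  obtain ⟨r, rfl⟩ : ∃ r, q = r + 2 := ⟨q - 2, by omega⟩
  obtain rfl : p = 2 * r + 2 := by omega
  have hr : 2 ≤ r := by omega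
  rw [show 2 * (2 * r + 2) - 2 * (r + 2) = 2 * r by omega,
    show 2 * r + 2 - (r + 2) = r by omega]
  refine ⟨2 * r + 2, fun n hn => ?_⟩
  have hAr := fun m (hm : r * n ≤ m) (C : TopEdgeLabeling (Fin n) (Fin m))
    (hC : UsesAllColors C) => exists_rainbow_of_le hr hn.le hm hC
  obtain ⟨m₀, hm₀, hex⟩ := exists_pierced_labeling (n := n) (r := r) (by omega)
  have hbdd := bddAbove_piercing (n := n) (completeGraph (Fin (2 * r + 2)))
    (upFamily (completeGraph (Fin (r + 2))))
  have hlow : m₀ ≤ piercing n (completeGraph (Fin (2 * r + 2)))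
    (upFamily (completeGraph (Fin (r + 2)))) := le_csSup hbdd hex
  refine ⟨?_, ?_, Nat.sInf_le hAr⟩
  · have h1 : r * n + 1 ≤ piercing n (completeGraph (Fin (2 * r + 2)))
        (upFamily (completeGraph (Fin (r + 2)))) + (r + 1).choose 2 := by omega
    zify at h1
    push_cast
    linarith
  · by_contra hlt
    rw [not_le] at hlt
    -- The supremum is attained, as the set is nonempty and bounded. The extremal coloring has at
    -- least the `m₀` colors of the construction, as the exclusion of rainbow copies requires.
    obtain ⟨C, hC, hpierced⟩ := Nat.sSup_mem ⟨_, hex⟩ hbdd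
    exact not_exists_rainbow_of_isPierced hr (hm₀.trans (Nat.add_le_add_right hlow _)) hC hpierced
      (exists_rainbow_of_antiRamsey_le hAr hlt.le hC)
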